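/- Conventions: everything is $C^\infty$; $R(X,Y)=\nabla_X\nabla_Y-\nabla_Y\nabla_X-\nabla_{[X,Y]}$, $d\eta(X,Y)=\tfrac12\big(X\eta(Y)-Y\eta(X)-\eta([X,Y])\big)$, and Laplacians are $-\operatorname{trace}\nabla^2$. An isometric immersion $f:M\to N$ with tension field $\tau(f)=\operatorname{trace}\nabla df$ is called biharmonic if its bitension field vanishes, i.e. $\tau_2(f)=-\Delta^f\tau(f)-\operatorname{trace}R^N(df,\tau(f))df=0$, where $\Delta^f$ is the Laplacian on sections of $f^{-1}TN$. Let $n\ge 1$ and let $(N^{2n+1},\varphi,\xi,\eta,g)$ be a strictly regular Sasakian space form of constant $\varphi$-sectional curvature $c$. That is, $(\varphi,\xi,\eta,g)$ satisfies $\varphi^2=-I+\eta\otimes\xi$, $\eta(\xi)=1$, $g(\varphi X,\varphi Y)=g(X,Y)-\eta(X)\eta(Y)$, $g(X,\varphi Y)=d\eta(X,Y)$ and $N_\varphi+2\,d\eta\otimes\xi=0$, where $N_\varphi$ is the Nijenhuis tensor of $\varphi$; the sectional curvature of the plane spanned by $X$ and $\varphi X$ is $c$ for every unit vector $X\perp\xi$;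 every point has a cubic coordinate neighbourhood, flat for $\xi$, through which each maximal integral curve of $\xi$ passes at most once; and all maximal integral curves of $\xi$ are homeomorphic to each other. Let $\pi:N\to\bar N=N/\xi$ be the projection onto the orbit space, which carries the quotient topology and the smooth structure of dimension $2n$ for which $\pi$ is a submersion. Let $\bar M$ be an (immersed) hypersurface of $\bar N$, of dimension $2n-1$, and let $M=\pi^{-1}(\bar M)$ be the Hopf cylinder over $\bar M$ (for an immersion $\bar{\mathbf i}:\bar M\to\bar N$, the fibre product $\{(a,p)\in\bar M\times N:\bar{\mathbf i}(a)=\pi(p)\}$, immersed in $N$ by $(a,p)\mapsto p$), with the metric induced from $N$. Let $B$, $A$, $H=\frac1{2n}\operatorname{trace}B$, $\nabla^\perp$ and $\Delta^\perp$ be the second fundamental form, the shape operator, the mean curvature vector field, the normal connection and the Laplacian on the normal bundle of $M$ in $N$. Then $M$ is biharmonic (that is, its immersion in $N$ is a biharmonic map) if and only if $$ \begin{cases} \Delta^\perp H=\Big(-\|B\|^2+\dfrac{c(n+1)+3n-1}{2}\Big)H,\\[2mm] 2\operatorname{trace}A_{\nabla^\perp_{\cdot}H}(\cdot)+n\operatorname{grad}(\|H\|^2)=0.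 \end{cases} $$ -/

import Mathlib

open scoped Manifold ContDiff Topology Bundle

noncomputable section

namespace HopfCyl

/-- The model Euclidean space of dimension `k`. -/
abbrev Euc (k : ℕ) : Type := EuclideanSpace ℝ (Fin k)

section Local

variable {k : ℕ} {N : Type*} [TopologicalSpace N] [ChartedSpace (Euc k) N]

/-- The `i`-th standard basis vector of the tangent space at `p`, that is, the coordinate vector
`∂ᵢ` at `p` of the preferred chart at `p`. -/
def stdVec (p : N) (i : Fin k) : TangentSpace (𝓡 k) p :=
  (EuclideanSpace.single i (1 : ℝ) : Euc k)

/-- The local vector field whose coordinate expression in the preferred chart around `y` is the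
constant vector `v`. -/
def coordField (y : N) (v : Euc k) (p : N) : TangentSpace (𝓡 k) p :=
  (mfderiv (𝓡 k) 𝓘(ℝ, Euc k) (extChartAt (𝓡 k) y) p).inverse v

/-- The Gram matrix `gᵢⱼ` of a bilinear form on the tangent space at `p`. -/
def gram (p : N) (b : TangentSpace (𝓡 k) p → TangentSpace (𝓡 k) p → ℝ) :
    Matrix (Fin k) (Fin k) ℝ :=
  Matrix.of fun i j => b (stdVec p i) (stdVec p j)

/-- The trace `∑ gⁱʲ Q(eᵢ, eⱼ)` of a bilinear map `Q` on the tangent space at `p` with respect to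
the scalar product `b`; for an orthonormal basis it is `∑ Q(eᵢ, eᵢ)`. -/
def metricTrace {F : Type*} [AddCommGroup F] [Module ℝ F] (p : N)
    (b : TangentSpace (𝓡 k) p → TangentSpace (𝓡 k) p → ℝ)
    (Q : TangentSpace (𝓡 k) p → TangentSpace (𝓡 k) p → F) : F :=
  ∑ i, ∑ j, (gram p b)⁻¹ i j • Q (stdVec p i) (stdVec p j)

/-- The vector `∑ gⁱʲ α(eᵢ) eⱼ` that represents the linear form `α` through the scalar
product `b`. -/
def sharp (p : N) (b : TangentSpace (𝓡 k) p → TangentSpace (𝓡 k) p → ℝ)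
    (α : TangentSpace (𝓡 k) p → ℝ) : TangentSpace (𝓡 k) p :=
  metricTrace p b fun u v => α u • v

variable (g : ∀ p : N, TangentSpace (𝓡 k) p → TangentSpace (𝓡 k) p → ℝ)

/-- The coordinate expression `g_z(u, w)`, at the point with coordinates `z` of the preferred chart
around `y`, of a field of bilinear forms. -/
def metricInChart (y : N) (z u w : Euc k) : ℝ :=
  g ((extChartAt (𝓡 k) y).symm z)
    (coordField y u ((extChartAt (𝓡 k) y).symm z))
    (coordField y w ((extChartAt (𝓡 k) y).symm z))

/-- The Gram matrix of the coordinate fields of the preferred chart around `y`. -/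
def gramInChart (y : N) (z : Euc k) : Matrix (Fin k) (Fin k) ℝ :=
  Matrix.of fun i j =>
    metricInChart g y z (EuclideanSpace.single i 1) (EuclideanSpace.single j 1)

/-- The Christoffel symbols of the Levi-Civita connection in the preferred chart around `y`, as a
bilinear map:
`Γ(u, w) = ½ ∑ gˡʳ (∂_u g(w, e_l) + ∂_w g(u, e_l) - ∂_l g(u, w)) e_r`. -/
def christoffel (y : N) (z u w : Euc k) : Euc k :=
  ∑ l : Fin k, ∑ r : Fin k,
    ((1 / 2 : ℝ) * (gramInChart g y z)⁻¹ l r *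
      (fderiv ℝ (fun z' => metricInChart g y z' w (EuclideanSpace.single l 1)) z u
        + fderiv ℝ (fun z' => metricInChart g y z' u (EuclideanSpace.single l 1)) z w
        - fderiv ℝ (fun z' => metricInChart g y z' u w) z (EuclideanSpace.single l 1))) •
      (EuclideanSpace.single r (1 : ℝ) : Euc k)

/-- The curvature `R(u, v)w`, with
`R(X, Y) = ∇_X ∇_Y - ∇_Y ∇_X - ∇_[X, Y]`, of the Levi-Civita connection at `p`, computed in the
preferred chart around `p` (through which the tangent space at `p` is the model space). -/
def curvature (p : N) (u v w : TangentSpace (𝓡 k) p) : TangentSpace (𝓡 k) p :=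
  let z : Euc k := extChartAt (𝓡 k) p p
  let u' : Euc k := u
  let v' : Euc k := v
  let w' : Euc k := w
  (fderiv ℝ (fun z' => christoffel g p z' v' w') z u'
    - fderiv ℝ (fun z' => christoffel g p z' u' w') z v'
    + christoffel g p z u' (christoffel g p z v' w')
    - christoffel g p z v' (christoffel g p z u' w') : Euc k)

end Local

section Maps

variable (m : ℕ) {k : ℕ} {M : Type*} [TopologicalSpace M] [ChartedSpace (Euc m) M]
  {N : Type*} [TopologicalSpace N] [ChartedSpace (Euc k) N]
  (g : ∀ p : N, TangentSpace (𝓡 k) p → TangentSpace (𝓡 k) p → ℝ)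
  (f : M → N)

/-- The covariant derivative `∇ᶠ_v V` at `x` of a section `V` of `f⁻¹TN`, for the pull-back by `f`
of the Levi-Civita connection of `g`: in the preferred chart around `f x` it is
`dV(v) + Γ(df(v), V)`. For `f = id` it is the Levi-Civita connection itself. -/
def covAlong (V : ∀ x : M, TangentSpace (𝓡 k) (f x)) (x : M) (v : TangentSpace (𝓡 m) x) :
    TangentSpace (𝓡 k) (f x) :=
  let a : Euc k := mfderiv (𝓡 m) 𝓘(ℝ, Euc k)
    (fun x' => (mfderiv (𝓡 k) 𝓘(ℝ, Euc k) (extChartAt (𝓡 k) (f x)) (f x') (V x') : Euc k)) x v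
  let b : Euc k := christoffel g (f x) (extChartAt (𝓡 k) (f x) (f x))
    (mfderiv (𝓡 m) (𝓡 k) f x v) (V x)
  (a + b : Euc k)

/-- The pull-back `f^* g`. -/
def pullbackForm (x : M) (u v : TangentSpace (𝓡 m) x) : ℝ :=
  g (f x) (mfderiv (𝓡 m) (𝓡 k) f x u) (mfderiv (𝓡 m) (𝓡 k) f x v)

/-- The value at `x` of `∇_u ṽ`, where `∇` is the Levi-Civita connection of `f^* g` and `ṽ` is the
coordinate field around `x` with value `v` at `x`. -/
def covCoord (x : M) (u v : TangentSpace (𝓡 m) x) : TangentSpace (𝓡 m) x :=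
  covAlong m (pullbackForm m g f) (id : M → M) (fun x' => coordField (k := m) x v x') x u

/-- The differential `df(ṽ)`, a section of `f⁻¹TN`, of the coordinate field `ṽ` around `x` with
value `v` at `x`. -/
def dfCoord (x : M) (v : TangentSpace (𝓡 m) x) (x' : M) : TangentSpace (𝓡 k) (f x') :=
  mfderiv (𝓡 m) (𝓡 k) f x' (coordField (k := m) x v x')

/-- The tension field `τ(f) = trace ∇df` of the map `f : (M, f^* g) → (N, g)`, where
`(∇df)(u, v) = ∇ᶠ_u df(ṽ) - df(∇_u ṽ)`. -/
def tension (x : M) : TangentSpace (𝓡 k) (f x) :=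
  metricTrace x (pullbackForm m g f x) fun u v =>
    covAlong m g f (dfCoord m f x v) x u - mfderiv (𝓡 m) (𝓡 k) f x (covCoord m g f x u v)

/-- The Laplacian on sections of `f⁻¹TN`, with the sign for which it is a nonnegative operator:
`Δᶠ V = - trace (∇ᶠ_u ∇ᶠ_ṽ V - ∇ᶠ_{∇_u ṽ} V)`. -/
def lapAlong (V : ∀ x : M, TangentSpace (𝓡 k) (f x)) (x : M) : TangentSpace (𝓡 k) (f x) :=
  - metricTrace x (pullbackForm m g f x) fun u v =>
    covAlong m g f (fun x' => covAlong m g f V x' (coordField (k := m) x v x')) x u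
      - covAlong m g f V x (covCoord m g f x u v)

/-- The bitension field `τ₂(f) = - Δᶠ τ(f) - trace R(df, τ(f)) df` of
`f : (M, f^* g) → (N, g)`. -/
def bitension (x : M) : TangentSpace (𝓡 k) (f x) :=
  - lapAlong m g f (tension m g f) x
    - metricTrace x (pullbackForm m g f x) fun u v =>
        curvature g (f x) (mfderiv (𝓡 m) (𝓡 k) f x u) (tension m g f x)
          (mfderiv (𝓡 m) (𝓡 k) f x v)

/-- The isometric immersion `f : (M, f^* g) → (N, g)` is biharmonic: its bitension field
vanishes. -/
def IsBiharmonic : Prop := ∀ x : M, bitension m g f x = 0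

/-- The component tangent to the immersion `f` of a vector at `f x`, as a tangent vector at `x`. -/
def tangentPart (x : M) (w : TangentSpace (𝓡 k) (f x)) : TangentSpace (𝓡 m) x :=
  sharp x (pullbackForm m g f x) fun u => g (f x) w (mfderiv (𝓡 m) (𝓡 k) f x u)

/-- The component normal to the immersion `f` of a vector at `f x`. -/
def normalPart (x : M) (w : TangentSpace (𝓡 k) (f x)) : TangentSpace (𝓡 k) (f x) :=
  w - mfderiv (𝓡 m) (𝓡 k) f x (tangentPart m g f x w)

/-- The second fundamental form `B(u, v)`: the normal component of `∇ᶠ_u df(ṽ)`. -/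
def secondFund (x : M) (u v : TangentSpace (𝓡 m) x) : TangentSpace (𝓡 k) (f x) :=
  normalPart m g f x (covAlong m g f (dfCoord m f x v) x u)

/-- The mean curvature vector field `H = (1/m) trace B`, where `m = dim M`. -/
def meanCurv (x : M) : TangentSpace (𝓡 k) (f x) :=
  (1 / (m : ℝ)) • metricTrace x (pullbackForm m g f x) (secondFund m g f x)

/-- The squared norm `‖B‖²` of the second fundamental form. -/
def secondFundNormSq (x : M) : ℝ :=
  metricTrace x (pullbackForm m g f x) fun u u' =>
    metricTrace x (pullbackForm m g f x) fun v v' =>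
      g (f x) (secondFund m g f x u v) (secondFund m g f x u' v')

/-- The shape operator: `A_ν u` is the vector with `⟨A_ν u, v⟩ = ⟨B(u, v), ν⟩` for all `v`. -/
def shapeOp (x : M) (ν : TangentSpace (𝓡 k) (f x)) (u : TangentSpace (𝓡 m) x) :
    TangentSpace (𝓡 m) x :=
  sharp x (pullbackForm m g f x) fun v => g (f x) (secondFund m g f x u v) ν

/-- The normal connection `∇^⊥_v V`. -/
def normalCov (V : ∀ x : M, TangentSpace (𝓡 k) (f x)) (x : M) (v : TangentSpace (𝓡 m) x) :
    TangentSpace (𝓡 k) (f x) :=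
  normalPart m g f x (covAlong m g f V x v)

/-- The Laplacian of the normal bundle:
`Δ^⊥ V = - trace (∇^⊥_u ∇^⊥_ṽ V - ∇^⊥_{∇_u ṽ} V)`. -/
def normalLap (V : ∀ x : M, TangentSpace (𝓡 k) (f x)) (x : M) : TangentSpace (𝓡 k) (f x) :=
  - metricTrace x (pullbackForm m g f x) fun u v =>
    normalCov m g f (fun x' => normalCov m g f V x' (coordField (k := m) x v x')) x u
      - normalCov m g f V x (covCoord m g f x u v)

/-- `trace A_{∇^⊥_· H}(·)`. -/
def traceShape (x : M) : TangentSpace (𝓡 m) x :=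
  metricTrace x (pullbackForm m g f x) fun u v =>
    shapeOp m g f x (normalCov m g f (meanCurv m g f) x u) v

/-- The gradient, with respect to `f^* g`, of the function `‖H‖²`. -/
def gradMeanCurvSq (x : M) : TangentSpace (𝓡 m) x :=
  sharp x (pullbackForm m g f x) fun u =>
    (mfderiv (𝓡 m) 𝓘(ℝ, ℝ) (fun x' => g (f x') (meanCurv m g f x') (meanCurv m g f x')) x u : ℝ)

end Maps

section Contact


/-- The exterior derivative of a one-form, evaluated on two vector fields, with the normalization
`dη(X, Y) = ½ (X(η(Y)) - Y(η(X)) - η([X, Y]))`. -/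
def extDeriv {k : ℕ} {N : Type*} [TopologicalSpace N] [ChartedSpace (Euc k) N]
    (η : ∀ p : N, TangentSpace (𝓡 k) p →L[ℝ] ℝ) (X Y : ∀ p : N, TangentSpace (𝓡 k) p) (p : N) :
    ℝ :=
  let a : ℝ := mfderiv (𝓡 k) 𝓘(ℝ, ℝ) (fun q => η q (Y q)) p (X p)
  let b : ℝ := mfderiv (𝓡 k) 𝓘(ℝ, ℝ) (fun q => η q (X q)) p (Y p)
  (1 / 2 : ℝ) * (a - b - η p (VectorField.mlieBracket (𝓡 k) X Y p))

/-- A vector field is smooth at `p`. -/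
def FieldSmoothAt {k : ℕ} {N : Type*} [TopologicalSpace N] [ChartedSpace (Euc k) N]
    [IsManifold (𝓡 k) ∞ N] (X : ∀ p : N, TangentSpace (𝓡 k) p) (p : N) : Prop :=
  ContMDiffAt (𝓡 k) ((𝓡 k).prod 𝓘(ℝ, Euc k)) ∞
    (fun q => Bundle.TotalSpace.mk' (Euc k) q (X q)) p

variable (n : ℕ) (N : Type*) [TopologicalSpace N] [ChartedSpace (Euc (2 * n + 1)) N]

/-- A contact metric structure `(φ, ξ, η, g)` on a manifold of dimension `2n + 1`. -/
structure ContactMetricStructure [IsManifold (𝓡 (2 * n + 1)) ∞ N] where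
  /-- the tensor field `φ` of type `(1, 1)` -/
  phi : ∀ p : N, TangentSpace (𝓡 (2 * n + 1)) p →L[ℝ] TangentSpace (𝓡 (2 * n + 1)) p
  /-- the vector field `ξ` -/
  xi : ∀ p : N, TangentSpace (𝓡 (2 * n + 1)) p
  /-- the one-form `η` -/
  eta : ∀ p : N, TangentSpace (𝓡 (2 * n + 1)) p →L[ℝ] ℝ
  /-- the Riemannian metric `g` -/
  metric : Bundle.ContMDiffRiemannianMetric (𝓡 (2 * n + 1)) ∞ (Euc (2 * n + 1))
    (fun p : N => TangentSpace (𝓡 (2 * n + 1)) p)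
  phi_smooth : ContMDiff (𝓡 (2 * n + 1))
    ((𝓡 (2 * n + 1)).prod 𝓘(ℝ, Euc (2 * n + 1) →L[ℝ] Euc (2 * n + 1))) ∞
    (fun p => Bundle.TotalSpace.mk' (Euc (2 * n + 1) →L[ℝ] Euc (2 * n + 1))
      (E := fun q : N => TangentSpace (𝓡 (2 * n + 1)) q →L[ℝ] TangentSpace (𝓡 (2 * n + 1)) q)
      p (phi p))
  xi_smooth : ∀ p, FieldSmoothAt xi p
  eta_smooth : ContMDiff (𝓡 (2 * n + 1))
    ((𝓡 (2 * n + 1)).prod 𝓘(ℝ, Euc (2 * n + 1) →L[ℝ] ℝ)) ∞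
    (fun p => Bundle.TotalSpace.mk' (Euc (2 * n + 1) →L[ℝ] ℝ)
      (E := fun q : N => TangentSpace (𝓡 (2 * n + 1)) q →L[ℝ] Bundle.Trivial N ℝ q)
      p (eta p))
  phi_phi : ∀ p v, phi p (phi p v) = -v + eta p v • xi p
  eta_xi : ∀ p, eta p (xi p) = 1
  metric_phi_phi : ∀ p v w,
    metric.inner p (phi p v) (phi p w) = metric.inner p v w - eta p v * eta p w
  metric_phi : ∀ p (X Y : ∀ q : N, TangentSpace (𝓡 (2 * n + 1)) q),
    FieldSmoothAt X p → FieldSmoothAt Y p →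
    metric.inner p (X p) (phi p (Y p)) = extDeriv eta X Y p

namespace ContactMetricStructure

variable {n N} [IsManifold (𝓡 (2 * n + 1)) ∞ N] (S : ContactMetricStructure n N)

/-- The Riemannian metric, as a field of bilinear forms. -/
def form (p : N) (u v : TangentSpace (𝓡 (2 * n + 1)) p) : ℝ := S.metric.inner p u v

/-- The Nijenhuis tensor
`N_φ(X, Y) = [φX, φY] - φ[φX, Y] - φ[X, φY] + φ²[X, Y]`. -/
def nijenhuis (X Y : ∀ q : N, TangentSpace (𝓡 (2 * n + 1)) q) (p : N) :
    TangentSpace (𝓡 (2 * n + 1)) p :=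
  VectorField.mlieBracket (𝓡 (2 * n + 1)) (fun q => S.phi q (X q)) (fun q => S.phi q (Y q)) p
    - S.phi p (VectorField.mlieBracket (𝓡 (2 * n + 1)) (fun q => S.phi q (X q)) Y p)
    - S.phi p (VectorField.mlieBracket (𝓡 (2 * n + 1)) X (fun q => S.phi q (Y q)) p)
    + S.phi p (S.phi p (VectorField.mlieBracket (𝓡 (2 * n + 1)) X Y p))

/-- The structure is Sasakian if it is normal: `N_φ + 2 dη ⊗ ξ = 0`. -/
def IsSasakian : Prop :=
  ∀ p (X Y : ∀ q : N, TangentSpace (𝓡 (2 * n + 1)) q), FieldSmoothAt X p → FieldSmoothAt Y p →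
    S.nijenhuis X Y p + (2 * extDeriv S.eta X Y p) • S.xi p = 0

/-- All `φ`-sectional curvatures, that is, the sectional curvatures of the planes spanned by `X`
and `φX` with `X` a unit vector orthogonal to `ξ`, are equal to `c`. -/
def HasConstPhiCurvature (c : ℝ) : Prop :=
  ∀ p (X : TangentSpace (𝓡 (2 * n + 1)) p), S.form p X X = 1 → S.form p X (S.xi p) = 0 →
    S.form p (curvature S.form p X (S.phi p X) (S.phi p X)) X = c

/-- Two points lie on a common integral curve of `ξ`. -/
def OnCommonCurve (p q : N) : Prop :=
  ∃ (γ : ℝ → N) (J : Set ℝ), IsOpen J ∧ J.OrdConnected ∧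
    IsMIntegralCurveOn (I := 𝓡 (2 * n + 1)) γ S.xi J ∧ p ∈ γ '' J ∧ q ∈ γ '' J

/-- The orbit space `N / ξ`, with the quotient topology. -/
abbrev OrbitSpace : Type _ := Quot S.OnCommonCurve

/-- The projection `π : N → N / ξ`. -/
def proj (p : N) : S.OrbitSpace := Quot.mk _ p

/-- Regularity: every point has a cubic coordinate neighbourhood, in which `ξ` is the first
coordinate field, such that every (maximal) integral curve of `ξ` passes through it in at most one
coordinate line. -/
def IsRegular : Prop :=
  ∀ p : N, ∃ e ∈ IsManifold.maximalAtlas (𝓡 (2 * n + 1)) ∞ N, ∃ a : ℝ, 0 < a ∧ p ∈ e.source ∧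
    e.target = {z : Euc (2 * n + 1) | ∀ i, |z i| < a} ∧
    (∀ q ∈ e.source, mfderiv (𝓡 (2 * n + 1)) 𝓘(ℝ, Euc (2 * n + 1)) e q (S.xi q)
      = (EuclideanSpace.single 0 (1 : ℝ) : Euc (2 * n + 1))) ∧
    ∀ q ∈ e.source, ∀ q' ∈ e.source, S.proj q = S.proj q' →
      ∀ i : Fin (2 * n + 1), i ≠ 0 → e q i = e q' i

/-- Strict regularity: the structure is regular and all (maximal) integral curves of `ξ` are
homeomorphic to each other. -/
def IsStrictlyRegular : Prop :=
  S.IsRegular ∧ ∀ p q : N, Nonempty ({x : N | S.proj x = S.proj p} ≃ₜ {x : N | S.proj x = S.proj q})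

/-- The Hopf cylinder `π⁻¹(M̄)` over an immersed submanifold `i : M̄ → N / ξ`: the fibre product of
`i` and `π`, with the topology of a subspace of `M̄ × N`. If `i` is injective, then its points
correspond through `(a, p) ↦ p` to the points of the subset `π⁻¹(i(M̄))` of `N`. -/
def HopfCylinder {Mb : Type*} (i : Mb → S.OrbitSpace) : Type _ :=
  {z : Mb × N // i z.1 = S.proj z.2}

instance {Mb : Type*} [TopologicalSpace Mb] (i : Mb → S.OrbitSpace) :
    TopologicalSpace (S.HopfCylinder i) :=
  inferInstanceAs (TopologicalSpace {z : Mb × N // i z.1 = S.proj z.2})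

/-- The inclusion of the Hopf cylinder into `M̄ × N`. -/
def cylIncl {Mb : Type*} (i : Mb → S.OrbitSpace) (z : S.HopfCylinder i) : Mb × N := z.1

/-- The immersion of the Hopf cylinder into `N`. -/
def cylMap {Mb : Type*} (i : Mb → S.OrbitSpace) (z : S.HopfCylinder i) : N := z.1.2

end ContactMetricStructure

end Contact

end HopfCyl

end

open scoped Manifold ContDiff Topology Bundle

set_option maxSynthPendingDepth 3
set_option synthInstance.maxHeartbeats 200000

noncomputable section

/-! Let `f` be the immersion of the cylinder in `N`, `m = 2n` its dimension, and `τ = mH` its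
tension field. The cylinder is a hypersurface, so the bitension field at a point vanishes exactly
when its products with all vectors `df(w)` and with a unit normal `ν` vanish. These two families of
equations are the two lines of the system.

Rough Laplacian. The field `τ` is normal. Differentiating `g(τ, df W) = 0` twice along a frame `eᵢ`
that is orthonormal and parallel at the point, and interchanging the fields by torsion-freeness and
the derivatives by curvature, one finds that the tangential part of `trace ∇²τ` is `-2 ∑ g(∇τ, B(eᵢ,
w)) - ½ w|τ|² - ∑ g(τ, R(eᵢ, w)eᵢ)` (`IsSoldered.sum_form_second_tangent`). Splitting `∇τ` into
tangential and normal components shows that the normal part is the trace of the second normal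
derivatives minus `‖B‖²τ`; codimension one identifies the shape operator term with `‖B‖²τ`
(`IsSoldered.sum_form_second_normal`).

Curvature. Differentiating the structure equations gives `∇ξ = -φ` and `(∇_X φ)Y = g(X, Y)ξ - η(Y)X`
(`IsAlmostContact.deriv_xi`, `IsAlmostContact.deriv_phi`), hence `R(X, Y)ξ` and the commutator of
`R(X, Y)` with `φ`. As in complex space forms, polarisation of the constant `φ`-sectional curvature
then determines the sectional curvature of horizontal planes, and summation shows that the Ricci
operator acts on horizontal vectors as the constant `κ = (c(n+1) + 3n - 1)/2`
(`IsSasakianCurvature.sum_curv`).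

Geometry of the cylinder. The composite of `f` and `π` factors through the hypersurface of the orbit
space, which has one dimension less than the cylinder. Some nonzero tangent vector is therefore sent
by `df` into the line `ker dπ`, which is spanned by `ξ`. So `ξ` is tangent to the cylinder and the
normal is horizontal (`ContactMetricStructure.eta_eq_zero_of_normal`). Consequently `∑ R(eᵢ, τ)eᵢ =
-κτ`: the curvature enters only the normal equation, and by pair symmetry the curvature term in the
tangential equation vanishes.

All of this is computed in the preferred charts at a base point, where the tangent spaces are the
model spaces. An immersion becomes a metric connection on a trivial bundle with a torsion-free
injective soldering form (`IsSoldered`), and transition lemmas show that the globally defined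
sections have smooth coordinate expressions there. -/

namespace HopfCyl

/-! ### Traces, orthonormal bases and bilinear forms on Euclidean space -/

section LinearAlgebra

variable {m : ℕ} {F : Type*} [AddCommGroup F] [Module ℝ F]

/-- The `i`-th standard basis vector. -/
abbrev stdE (m : ℕ) (i : Fin m) : Euc m := EuclideanSpace.single i (1 : ℝ)

/-- A map of two variables that is linear in each of them. -/
structure IsBilin {V F : Type*} [AddCommGroup V] [Module ℝ V] [AddCommGroup F] [Module ℝ F]
    (Q : V → V → F) : Prop where
  add_left : ∀ u u' v, Q (u + u') v = Q u v + Q u' v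
  smul_left : ∀ (r : ℝ) u v, Q (r • u) v = r • Q u v
  add_right : ∀ u v v', Q u (v + v') = Q u v + Q u v'
  smul_right : ∀ (r : ℝ) u v, Q u (r • v) = r • Q u v

/-- The trace of `Q` with respect to the scalar product `b`, computed in the basis `a`. -/
def traceIn (a : Fin m → Euc m) (b : Euc m → Euc m → ℝ) (Q : Euc m → Euc m → F) : F :=
  ∑ i, ∑ j, (Matrix.of fun i j => b (a i) (a j))⁻¹ i j • Q (a i) (a j)

namespace IsBilin

variable {V : Type*} [AddCommGroup V] [Module ℝ V]

theorem sum_left {Q : V → V → F} (hQ : IsBilin Q) {ι : Type*} (s : Finset ι) (u : ι → V) (v : V) :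
    Q (∑ i ∈ s, u i) v = ∑ i ∈ s, Q (u i) v := by
  classical
  have h0 : Q 0 v = 0 := by simpa using hQ.smul_left 0 0 v
  induction s using Finset.induction_on with
  | empty => simpa using h0
  | insert i s hi ih => rw [Finset.sum_insert hi, Finset.sum_insert hi, hQ.add_left, ih]

theorem flip {Q : V → V → F} (hQ : IsBilin Q) : IsBilin fun u v => Q v u :=
  ⟨fun u u' v => hQ.add_right v u u', fun r u v => hQ.smul_right r v u,
    fun u v v' => hQ.add_left v v' u, fun r u v => hQ.smul_left r v u⟩

theorem sum_right {Q : V → V → F} (hQ : IsBilin Q) {ι : Type*} (s : Finset ι) (u : V) (v : ι → V) :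
    Q u (∑ i ∈ s, v i) = ∑ i ∈ s, Q u (v i) := hQ.flip.sum_left s v u

theorem zero_left {Q : V → V → F} (hQ : IsBilin Q) (v : V) : Q 0 v = 0 := by
  simpa using hQ.smul_left 0 0 v

theorem zero_right {Q : V → V → F} (hQ : IsBilin Q) (v : V) : Q v 0 = 0 := by
  simpa using hQ.smul_right 0 v 0

end IsBilin

theorem euc_eq_sum (v : Euc m) : v = ∑ i, v i • stdE m i := by
  have := (EuclideanSpace.basisFun (Fin m) ℝ).sum_repr v
  simpa using this.symm

theorem IsBilin.expand {Q : Euc m → Euc m → F} (hQ : IsBilin Q) (u v : Euc m) :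
    Q u v = ∑ l, ∑ k, (u l * v k) • Q (stdE m l) (stdE m k) := by
  conv_lhs => rw [euc_eq_sum u, hQ.sum_left]
  refine Finset.sum_congr rfl fun l _ => ?_
  rw [hQ.smul_left]
  conv_lhs => rw [euc_eq_sum v, hQ.sum_right, Finset.smul_sum]
  refine Finset.sum_congr rfl fun k _ => ?_
  rw [hQ.smul_right, smul_smul]

/-- The matrix whose rows are the coordinates of a family of vectors. -/
def rowMatrix (a : Fin m → Euc m) : Matrix (Fin m) (Fin m) ℝ := Matrix.of fun i l => a i l

theorem isUnit_rowMatrix {a : Fin m → Euc m} (ha : LinearIndependent ℝ a) :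
    IsUnit (rowMatrix a) := by
  rw [← Matrix.linearIndependent_rows_iff_isUnit]
  have := ha.map' (EuclideanSpace.equiv (Fin m) ℝ).toLinearEquiv.toLinearMap
    (LinearEquiv.ker _)
  exact this

theorem linearIndependent_of_isUnit_rowMatrix {a : Fin m → Euc m} (h : IsUnit (rowMatrix a)) :
    LinearIndependent ℝ a := by
  rw [← Matrix.linearIndependent_rows_iff_isUnit] at h
  exact h.map' (EuclideanSpace.equiv (Fin m) ℝ).symm.toLinearEquiv.toLinearMap (LinearEquiv.ker _)

theorem gram_change (a : Fin m → Euc m) {b : Euc m → Euc m → ℝ} (hb : IsBilin b) :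
    (Matrix.of fun i j => b (a i) (a j)) =
      rowMatrix a * (Matrix.of fun i j => b (stdE m i) (stdE m j)) * (rowMatrix a).transpose := by
  ext i j
  simp only [Matrix.of_apply, Matrix.mul_apply, rowMatrix, Matrix.transpose_apply, Finset.sum_mul]
  rw [hb.expand, Finset.sum_comm]
  refine Finset.sum_congr rfl fun l _ => Finset.sum_congr rfl fun k _ => ?_
  simp only [smul_eq_mul]; ring

/-- The trace does not depend on the basis. -/
theorem traceIn_eq_std {a : Fin m → Euc m} (ha : LinearIndependent ℝ a)
    {b : Euc m → Euc m → ℝ} (hb : IsBilin b) {Q : Euc m → Euc m → F} (hQ : IsBilin Q) :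
    traceIn a b Q = traceIn (stdE m) b Q := by
  have hP := isUnit_rowMatrix ha
  have hPd : IsUnit (rowMatrix a).det := (Matrix.isUnit_iff_isUnit_det _).1 hP
  have hPtd : IsUnit (rowMatrix a).transpose.det := by rwa [Matrix.det_transpose]
  unfold traceIn
  -- The Gram matrix changes by the congruence `P G Pᵀ`, so its inverse changes contragrediently and
  -- cancels the coefficients that `Q` acquires.
  have key : (rowMatrix a).transpose * (Matrix.of fun i j => b (a i) (a j))⁻¹ * rowMatrix a
      = (Matrix.of fun i j => b (stdE m i) (stdE m j))⁻¹ := by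
    rw [gram_change a hb, Matrix.mul_inv_rev, Matrix.mul_inv_rev, ← Matrix.mul_assoc,
      Matrix.mul_nonsing_inv _ hPtd, Matrix.one_mul, Matrix.mul_assoc,
      Matrix.nonsing_inv_mul _ hPd, Matrix.mul_one]
  rw [← key]
  generalize (Matrix.of fun i j => b (a i) (a j))⁻¹ = S
  have h1 : ∀ i j, S i j • Q (a i) (a j)
      = ∑ l, ∑ k, (a i l * S i j * a j k) • Q (stdE m l) (stdE m k) := by
    intro i j
    rw [hQ.expand, Finset.smul_sum]
    refine Finset.sum_congr rfl fun l _ => ?_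
    rw [Finset.smul_sum]
    refine Finset.sum_congr rfl fun k _ => ?_
    rw [smul_smul]; congr 1; ring
  simp_rw [h1]
  have h2 : ∀ l k, ((rowMatrix a).transpose * S * rowMatrix a) l k • Q (stdE m l) (stdE m k)
      = ∑ i, ∑ j, (a i l * S i j * a j k) • Q (stdE m l) (stdE m k) := by
    intro l k
    simp only [Matrix.mul_apply, Matrix.transpose_apply, rowMatrix, Matrix.of_apply,
      Finset.sum_mul, Finset.sum_smul]
    rw [Finset.sum_comm]
  simp_rw [h2]
  -- Four transpositions of adjacent sums carry the order `i, j, l, k` to `l, k, i, j`.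
  calc ∑ i, ∑ j, ∑ l, ∑ k, (a i l * S i j * a j k) • Q (stdE m l) (stdE m k)
      = ∑ i, ∑ l, ∑ j, ∑ k, (a i l * S i j * a j k) • Q (stdE m l) (stdE m k) :=
        Finset.sum_congr rfl fun i _ => Finset.sum_comm
    _ = ∑ l, ∑ i, ∑ j, ∑ k, (a i l * S i j * a j k) • Q (stdE m l) (stdE m k) := Finset.sum_comm
    _ = ∑ l, ∑ i, ∑ k, ∑ j, (a i l * S i j * a j k) • Q (stdE m l) (stdE m k) :=
        Finset.sum_congr rfl fun l _ => Finset.sum_congr rfl fun i _ => Finset.sum_comm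
    _ = ∑ l, ∑ k, ∑ i, ∑ j, (a i l * S i j * a j k) • Q (stdE m l) (stdE m k) :=
        Finset.sum_congr rfl fun l _ => Finset.sum_comm

/-- A family is orthonormal for the bilinear form `b`. -/
def IsOrthonormal {ι V : Type*} [DecidableEq ι] (b : V → V → ℝ) (o : ι → V) : Prop :=
  ∀ i j, b (o i) (o j) = if i = j then 1 else 0

theorem IsOrthonormal.coeff {ι V : Type*} [DecidableEq ι] [Fintype ι] [AddCommGroup V] [Module ℝ V]
    {b : V → V → ℝ} {o : ι → V} (ho : IsOrthonormal b o) (hb : IsBilin b) (r : ι → ℝ) (j : ι) :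
    b (∑ i, r i • o i) (o j) = r j := by
  rw [hb.sum_left]
  simp [hb.smul_left, ho _ j]

theorem IsOrthonormal.linearIndependent {ι V : Type*} [DecidableEq ι] [Fintype ι] [AddCommGroup V]
    [Module ℝ V] {b : V → V → ℝ} {o : ι → V} (ho : IsOrthonormal b o) (hb : IsBilin b) :
    LinearIndependent ℝ o := by
  rw [Fintype.linearIndependent_iff]
  intro r hr j
  rw [← ho.coeff hb r j, hr, hb.zero_left]

theorem IsOrthonormal.traceIn_eq {b : Euc m → Euc m → ℝ} {o : Fin m → Euc m}
    (ho : IsOrthonormal b o) (Q : Euc m → Euc m → F) :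
    traceIn o b Q = ∑ i, Q (o i) (o i) := by
  have h : (Matrix.of fun i j => b (o i) (o j)) = (1 : Matrix (Fin m) (Fin m) ℝ) := by
    ext i j
    simp [ho i j, Matrix.one_apply]
  simp only [traceIn, h, inv_one, Matrix.one_apply]
  simp

/-- The trace is the sum over an orthonormal basis. -/
theorem IsOrthonormal.traceIn_std {b : Euc m → Euc m → ℝ} {o : Fin m → Euc m}
    (ho : IsOrthonormal b o) (hb : IsBilin b) {Q : Euc m → Euc m → F} (hQ : IsBilin Q) :
    traceIn (stdE m) b Q = ∑ i, Q (o i) (o i) := by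
  rw [← traceIn_eq_std (ho.linearIndependent hb) hb hQ, ho.traceIn_eq]

/-- An orthonormal family whose cardinality is the dimension expands every vector. -/
theorem IsOrthonormal.expand {b : Euc m → Euc m → ℝ} {o : Fin m → Euc m}
    (ho : IsOrthonormal b o) (hb : IsBilin b) (v : Euc m) : v = ∑ i, b v (o i) • o i := by
  let B := basisOfLinearIndependentOfCardEqFinrank' o (ho.linearIndependent hb) (by simp)
  have hv := B.sum_repr v
  have hB : ∀ i, B i = o i := fun i => by simp [B]
  simp only [hB] at hv
  have hc : ∀ j, b v (o j) = B.repr v j := fun j => by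
    conv_lhs => rw [← hv]
    exact ho.coeff hb _ j
  simp only [hc, hv]

/-- A symmetric positive definite bilinear form has an orthonormal basis. -/
theorem exists_isOrthonormal {b : Euc m → Euc m → ℝ} (hb : IsBilin b)
    (hs : ∀ u v, b u v = b v u) (hpos : ∀ u, u ≠ 0 → 0 < b u u) :
    ∃ o : Fin m → Euc m, IsOrthonormal b o := by
  let B : LinearMap.BilinForm ℝ (Euc m) := LinearMap.mk₂ ℝ b hb.add_left
    (fun c u v => hb.smul_left c u v) hb.add_right (fun c u v => hb.smul_right c u v)
  have hB : LinearMap.IsSymm B := ⟨fun u v => hs u v⟩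
  obtain ⟨v, hv⟩ := LinearMap.BilinForm.exists_orthogonal_basis (B := B) hB
  have hfin : Module.finrank ℝ (Euc m) = m := by simp
  let w := v.reindex (finCongr hfin)
  have hw : ∀ i j, i ≠ j → b (w i) (w j) = 0 := by
    intro i j hij
    have := (LinearMap.isOrthoᵢ_def.1 hv) ((finCongr hfin).symm i) ((finCongr hfin).symm j)
      (fun h => hij ((finCongr hfin).symm.injective h))
    simpa [w, B] using this
  have hp : ∀ i, 0 < b (w i) (w i) := fun i => hpos _ (w.ne_zero i)
  refine ⟨fun i => (Real.sqrt (b (w i) (w i)))⁻¹ • w i, fun i j => ?_⟩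
  rw [hb.smul_left, hb.smul_right]
  split_ifs with h
  · subst h
    have h1 := Real.mul_self_sqrt (hp i).le
    have h2 : Real.sqrt (b (w i) (w i)) ≠ 0 := (Real.sqrt_pos.2 (hp i)).ne'
    simp only [smul_eq_mul]
    field_simp
    nlinarith
  · simp [hw i j h]

/-- The vector obtained by raising an index represents the linear form. -/
theorem form_traceIn_smul {b : Euc m → Euc m → ℝ} (hb : IsBilin b)
    (hs : ∀ u v, b u v = b v u) (hpos : ∀ u, u ≠ 0 → 0 < b u u)
    {α : Euc m → ℝ} (hadd : ∀ u v, α (u + v) = α u + α v) (hsmul : ∀ (r : ℝ) u, α (r • u) = r * α u)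
    (w : Euc m) : b (traceIn (stdE m) b fun u v => α u • v) w = α w := by
  obtain ⟨o, ho⟩ := exists_isOrthonormal hb hs hpos
  have hQ : IsBilin fun u v : Euc m => α u • v :=
    ⟨fun u u' v => by simp [hadd, add_smul], fun r u v => by simp [hsmul, mul_smul],
      fun u v v' => by simp, fun r u v => by rw [smul_comm]⟩
  rw [ho.traceIn_std hb hQ, hb.sum_left]
  let A : Euc m →ₗ[ℝ] ℝ := { toFun := α, map_add' := hadd, map_smul' := hsmul }
  have : α w = A (∑ i, b w (o i) • o i) := by rw [← ho.expand hb w]; rfl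
  rw [this, map_sum]
  refine Finset.sum_congr rfl fun i _ => ?_
  rw [hb.smul_left, map_smul, hs w]
  simp only [smul_eq_mul]
  exact mul_comm _ _

theorem eq_of_form_eq {V : Type*} [AddCommGroup V] [Module ℝ V] {b : V → V → ℝ} (hb : IsBilin b)
    (hpos : ∀ u, u ≠ 0 → 0 < b u u)
    {u v : V} (h : ∀ w, b u w = b v w) : u = v := by
  by_contra hne
  have h1 := hpos (u - v) (sub_ne_zero.2 hne)
  have h2 : b (u - v) (u - v) = 0 := by
    rw [sub_eq_add_neg, hb.add_left, ← neg_one_smul ℝ v, hb.smul_left, h]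
    simp
  linarith

end LinearAlgebra

/-! ### Product rules and symmetry of second derivatives -/

section Calculus

variable {E V W Y : Type*} [NormedAddCommGroup E] [NormedSpace ℝ E]
  [NormedAddCommGroup V] [NormedSpace ℝ V] [NormedAddCommGroup W] [NormedSpace ℝ W]
  [NormedAddCommGroup Y] [NormedSpace ℝ Y]

theorem fderiv_apply₁ {A : E → V →L[ℝ] W} {a : E → V} {z : E}
    (hA : DifferentiableAt ℝ A z) (ha : DifferentiableAt ℝ a z) (u : E) :
    fderiv ℝ (fun y => A y (a y)) z u = fderiv ℝ A z u (a z) + A z (fderiv ℝ a z u) := by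
  have := (hA.hasFDerivAt.clm_apply ha.hasFDerivAt).fderiv
  rw [this]
  simp [add_comm]

theorem fderiv_apply₂ {A : E → V →L[ℝ] W →L[ℝ] Y} {a : E → V} {b : E → W} {z : E}
    (hA : DifferentiableAt ℝ A z) (ha : DifferentiableAt ℝ a z) (hb : DifferentiableAt ℝ b z)
    (u : E) :
    fderiv ℝ (fun y => A y (a y) (b y)) z u
      = fderiv ℝ A z u (a z) (b z) + A z (fderiv ℝ a z u) (b z) + A z (a z) (fderiv ℝ b z u) := by
  rw [fderiv_apply₁ (hA.clm_apply ha) hb, fderiv_apply₁ hA ha]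
  simp

theorem fderiv_apply_const {A : E → V →L[ℝ] W} {z : E} (hA : DifferentiableAt ℝ A z) (a : V)
    (u : E) : fderiv ℝ (fun y => A y a) z u = fderiv ℝ A z u a := by
  rw [fderiv_apply₁ hA (differentiableAt_const a)]; simp

theorem fderiv_apply_const₂ {A : E → V →L[ℝ] W →L[ℝ] Y} {z : E} (hA : DifferentiableAt ℝ A z)
    (a : V) (b : W) (u : E) : fderiv ℝ (fun y => A y a b) z u = fderiv ℝ A z u a b := by
  rw [fderiv_apply₂ hA (differentiableAt_const a) (differentiableAt_const b)]; simp

theorem _root_.ContDiffAt.diff {f : E → V} {z : E} (h : ContDiffAt ℝ ∞ f z) :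
    DifferentiableAt ℝ f z := h.differentiableAt (by simp)

theorem _root_.ContDiffAt.smooth_fderiv {f : E → V} {z : E} (h : ContDiffAt ℝ ∞ f z) :
    ContDiffAt ℝ ∞ (fderiv ℝ f) z := h.fderiv_right (by simp)

theorem _root_.ContDiffAt.second_symm {f : E → V} {z : E} (h : ContDiffAt ℝ ∞ f z) (u v : E) :
    fderiv ℝ (fderiv ℝ f) z u v = fderiv ℝ (fderiv ℝ f) z v u :=
  (h.isSymmSndFDerivAt (by simp [minSmoothness_of_isRCLikeNormedField]; exact ENat.LEInfty.out)).eq u v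

end Calculus

/-! ### Scalar products as invertible operators -/

section Forms

variable {K : Type*} [NormedAddCommGroup K] [NormedSpace ℝ K]

/-- A symmetric positive definite continuous bilinear form. -/
structure IsScalarProduct (b : K →L[ℝ] K →L[ℝ] ℝ) : Prop where
  symm : ∀ u v, b u v = b v u
  pos : ∀ u, u ≠ 0 → 0 < b u u

theorem isBilin_clm {F : Type*} [NormedAddCommGroup F] [NormedSpace ℝ F]
    (b : K →L[ℝ] K →L[ℝ] F) : IsBilin fun u v => b u v :=
  ⟨by simp, by simp, by simp, by simp⟩

variable {b : K →L[ℝ] K →L[ℝ] ℝ}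

theorem IsScalarProduct.ext (hb : IsScalarProduct b) {u v : K} (h : ∀ w, b u w = b v w) : u = v :=
  eq_of_form_eq (isBilin_clm b) hb.pos h

variable [FiniteDimensional ℝ K]

/-- Definiteness makes the map to the dual injective, and a finite-dimensional space has the
dimension of its dual. Raising an index is then operator inversion, whose smoothness is known. -/
theorem IsScalarProduct.isInvertible (hb : IsScalarProduct b) : b.IsInvertible := by
  have hinj : Function.Injective b.toLinearMap := fun u v h => hb.ext fun w => by
    have : b u = b v := h
    rw [this]
  have hdim : Module.finrank ℝ K = Module.finrank ℝ (K →L[ℝ] ℝ) := by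
    rw [← (LinearMap.toContinuousLinearMap : (K →ₗ[ℝ] ℝ) ≃ₗ[ℝ] (K →L[ℝ] ℝ)).finrank_eq]
    exact Subspace.dual_finrank_eq.symm
  refine ⟨(LinearEquiv.ofInjectiveOfFinrankEq b.toLinearMap hinj hdim).toContinuousLinearEquiv, ?_⟩
  ext u v
  rfl

theorem IsScalarProduct.apply_inverse (hb : IsScalarProduct b) (α : K →L[ℝ] ℝ) :
    b (b.inverse α) = α := hb.isInvertible.self_apply_inverse α

end Forms

/-! ### Connections on a trivial bundle and their curvature -/

section Connection

variable {E K : Type*} [NormedAddCommGroup E] [NormedSpace ℝ E]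
  [NormedAddCommGroup K] [NormedSpace ℝ K]

/-- The covariant derivative with connection form `θ` on the trivial bundle with fibre `K`. -/
def covD (θ : E → E →L[ℝ] K →L[ℝ] K) (X : E → K) (z : E) : E →L[ℝ] K :=
  fderiv ℝ X z + (θ z).flip (X z)

/-- The curvature of the connection form `θ`. -/
def curvForm (θ : E → E →L[ℝ] K →L[ℝ] K) (z : E) (u v : E) (a : K) : K :=
  fderiv ℝ θ z u v a - fderiv ℝ θ z v u a + θ z u (θ z v a) - θ z v (θ z u a)

variable {θ : E → E →L[ℝ] K →L[ℝ] K}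

theorem covD_apply (X : E → K) (z u : E) : covD θ X z u = fderiv ℝ X z u + θ z u (X z) := rfl

theorem ContDiffAt.covD {X : E → K} {z : E} (hθ : ContDiffAt ℝ ∞ θ z) (hX : ContDiffAt ℝ ∞ X z) :
    ContDiffAt ℝ ∞ (covD θ X) z := by
  refine hX.smooth_fderiv.add ?_
  have : ContDiffAt ℝ ∞ (fun y => (θ y).flip) z :=
    (ContinuousLinearMap.flipₗᵢ ℝ E K K).toContinuousLinearEquiv.contDiff.contDiffAt.comp z hθ
  exact this.clm_apply hX

theorem covD_add {X Y : E → K} {z : E} (hX : DifferentiableAt ℝ X z)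
    (hY : DifferentiableAt ℝ Y z) (u : E) :
    covD θ (fun y => X y + Y y) z u = covD θ X z u + covD θ Y z u := by
  simp only [covD_apply, fderiv_fun_add hX hY, map_add, add_apply]
  abel

theorem covD_sub {X Y : E → K} {z : E} (hX : DifferentiableAt ℝ X z)
    (hY : DifferentiableAt ℝ Y z) (u : E) :
    covD θ (fun y => X y - Y y) z u = covD θ X z u - covD θ Y z u := by
  simp only [covD_apply, fderiv_fun_sub hX hY, map_sub, sub_apply]
  abel

theorem covD_smul (r : ℝ) {X : E → K} {z : E} (hX : DifferentiableAt ℝ X z) (u : E) :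
    covD θ (fun y => r • X y) z u = r • covD θ X z u := by
  simp only [covD_apply, fderiv_fun_const_smul hX, map_smul, smul_apply, smul_add]

theorem covD_congr {X Y : E → K} {z : E} (h : X =ᶠ[𝓝 z] Y) : covD θ X z = covD θ Y z := by
  unfold covD
  rw [h.fderiv_eq, h.self_of_nhds]

/-- The commutator of covariant derivatives is the curvature. -/
theorem covD_comm {X : E → K} {z : E} {U V : E → E} (hθ : ContDiffAt ℝ ∞ θ z)
    (hX : ContDiffAt ℝ ∞ X z) (hU : DifferentiableAt ℝ U z) (hV : DifferentiableAt ℝ V z) :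
    covD θ (fun y => covD θ X y (V y)) z (U z) - covD θ (fun y => covD θ X y (U y)) z (V z)
      = curvForm θ z (U z) (V z) (X z)
        + covD θ X z (fderiv ℝ V z (U z) - fderiv ℝ U z (V z)) := by
  -- Full expansion of a second covariant derivative. In the commutator the Hessian of `X` and the
  -- mixed terms of `θ` with the derivative of `X` are symmetric and cancel.
  have key : ∀ {V : E → E}, DifferentiableAt ℝ V z → ∀ u, covD θ (fun y => covD θ X y (V y)) z u
      = fderiv ℝ (fderiv ℝ X) z u (V z) + fderiv ℝ X z (fderiv ℝ V z u)
        + (fderiv ℝ θ z u (V z) (X z) + θ z (fderiv ℝ V z u) (X z) + θ z (V z) (fderiv ℝ X z u))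
        + θ z u (fderiv ℝ X z (V z) + θ z (V z) (X z)) := by
    intro V hV u
    rw [covD_apply]
    simp only [covD_apply]
    rw [fderiv_fun_add (hX.smooth_fderiv.diff.clm_apply hV)
      ((hθ.diff.clm_apply hV).clm_apply hX.diff), add_apply,
      fderiv_apply₁ hX.smooth_fderiv.diff hV, fderiv_apply₂ hθ.diff hV hX.diff]
  rw [key hV, key hU, hX.second_symm (V z) (U z)]
  simp only [covD_apply, curvForm, map_add, map_sub]
  abel

/-- A metric connection differentiates the scalar product by the product rule. -/
theorem fderiv_form_covD {g : E → K →L[ℝ] K →L[ℝ] ℝ} {z : E} (hg : DifferentiableAt ℝ g z)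
    {u : E} (hc : ∀ a b, fderiv ℝ g z u a b = g z (θ z u a) b + g z a (θ z u b))
    {X Y : E → K} (hX : DifferentiableAt ℝ X z) (hY : DifferentiableAt ℝ Y z) :
    fderiv ℝ (fun y => g y (X y) (Y y)) z u
      = g z (covD θ X z u) (Y z) + g z (X z) (covD θ Y z u) := by
  rw [fderiv_apply₂ hg hX hY, hc]
  simp only [covD_apply, map_add, add_apply]
  ring

/-- The curvature of a metric connection is skew-symmetric. -/
theorem curvForm_skew {g : E → K →L[ℝ] K →L[ℝ] ℝ} {z : E} (hg : ContDiffAt ℝ ∞ g z)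
    (hθ : ContDiffAt ℝ ∞ θ z)
    (hc : ∀ᶠ y in 𝓝 z, ∀ u a b, fderiv ℝ g y u a b = g y (θ y u a) b + g y a (θ y u b))
    (u v : E) (a b : K) :
    g z (curvForm θ z u v a) b = - g z a (curvForm θ z u v b) := by
  have hcz := hc.self_of_nhds
  have key : ∀ u v, fderiv ℝ (fderiv ℝ g) z u v a b
      = (fderiv ℝ g z u (θ z v a) b + g z (fderiv ℝ θ z u v a) b)
        + (fderiv ℝ g z u a (θ z v b) + g z a (fderiv ℝ θ z u v b)) := by
    intro u v
    have h1 : fderiv ℝ (fun y => fderiv ℝ g y v a b) z u = fderiv ℝ (fderiv ℝ g) z u v a b := by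
      rw [fderiv_apply_const (hg.smooth_fderiv.diff.clm_apply (differentiableAt_const v)
        |>.clm_apply (differentiableAt_const a)), fderiv_apply_const₂ hg.smooth_fderiv.diff]
    have h2 : (fun y => fderiv ℝ g y v a b)
        =ᶠ[𝓝 z] fun y => g y (θ y v a) b + g y a (θ y v b) := by
      filter_upwards [hc] with y hy using hy v a b
    have hθv : ∀ a : K, DifferentiableAt ℝ (fun y => θ y v a) z := fun a =>
      (hθ.diff.clm_apply (differentiableAt_const v)).clm_apply (differentiableAt_const a)
    rw [← h1, h2.fderiv_eq, fderiv_fun_add ((hg.diff.clm_apply (hθv a)).clm_apply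
        (differentiableAt_const b))
        ((hg.diff.clm_apply (differentiableAt_const a)).clm_apply (hθv b)),
      add_apply, fderiv_apply₂ hg.diff (hθv a) (differentiableAt_const b),
      fderiv_apply₂ hg.diff (differentiableAt_const a) (hθv b),
      fderiv_apply_const₂ hθ.diff, fderiv_apply_const₂ hθ.diff]
    simp
  -- The Hessian of `g` is symmetric in `u, v`. Alternating its formula therefore gives zero, and
  -- what remains is the sum of the two curvature terms.
  have h := key u v
  rw [hg.second_symm u v, key v u, hcz, hcz, hcz, hcz] at h
  simp only [curvForm, map_add, map_sub, add_apply,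
    sub_apply]
  linarith

/-- The first Bianchi identity for a symmetric connection. -/
theorem curvForm_bianchi {θ : K → K →L[ℝ] K →L[ℝ] K} {z : K} (hθ : DifferentiableAt ℝ θ z)
    (hs : ∀ᶠ y in 𝓝 z, ∀ u v, θ y u v = θ y v u) (u v w : K) :
    curvForm θ z u v w + curvForm θ z v w u + curvForm θ z w u v = 0 := by
  have hsz := hs.self_of_nhds
  have key : ∀ u v w, fderiv ℝ θ z u v w = fderiv ℝ θ z u w v := by
    intro u v w
    rw [← fderiv_apply_const₂ hθ, ← fderiv_apply_const₂ hθ]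
    have : (fun y => θ y v w) =ᶠ[𝓝 z] fun y => θ y w v := by
      filter_upwards [hs] with y hy using hy v w
    rw [this.fderiv_eq]
  simp only [curvForm]
  rw [key u v w, key v w u, key w u v, hsz v w, hsz w u, hsz u v]
  abel

theorem curvForm_swap (z u v : E) (a : K) : curvForm θ z u v a = - curvForm θ z v u a := by
  simp only [curvForm]; abel

/-- The curvature of a pull-back connection is the pull-back of the curvature. -/
theorem curvForm_pullback {Γ : K → K →L[ℝ] K →L[ℝ] K} {F : E → K} {z : E}
    (hF : ContDiffAt ℝ ∞ F z) (hΓ : ContDiffAt ℝ ∞ Γ (F z)) (u v : E) (a : K) :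
    curvForm (fun y => (Γ (F y)).comp (fderiv ℝ F y)) z u v a
      = curvForm Γ (F z) (fderiv ℝ F z u) (fderiv ℝ F z v) a := by
  have hΓF : DifferentiableAt ℝ (fun y => Γ (F y)) z := hΓ.diff.comp z hF.diff
  have hd : DifferentiableAt ℝ (fun y => (Γ (F y)).comp (fderiv ℝ F y)) z :=
    hΓF.clm_comp hF.smooth_fderiv.diff
  have key : ∀ u v, fderiv ℝ (fun y => (Γ (F y)).comp (fderiv ℝ F y)) z u v a
      = fderiv ℝ Γ (F z) (fderiv ℝ F z u) (fderiv ℝ F z v) a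
        + Γ (F z) (fderiv ℝ (fderiv ℝ F) z u v) a := by
    intro u v
    rw [← fderiv_apply_const₂ hd]
    simp only [ContinuousLinearMap.comp_apply]
    rw [fderiv_apply₂ hΓF (hF.smooth_fderiv.diff.clm_apply (differentiableAt_const v))
      (differentiableAt_const a), fderiv_apply_const hF.smooth_fderiv.diff]
    have : fderiv ℝ (fun y => Γ (F y)) z = (fderiv ℝ Γ (F z)).comp (fderiv ℝ F z) :=
      fderiv_comp z hΓ.diff hF.diff
    rw [this]
    simp
  -- The only term beyond the pulled-back curvature contains the Hessian of `F`, which is symmetric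
  -- and disappears on alternation.
  simp only [curvForm, key, hF.second_symm u v, ContinuousLinearMap.comp_apply]
  abel

end Connection

/-! ### The Levi-Civita connection in a vector space -/

section LeviCivita

variable {K : Type*} [NormedAddCommGroup K] [NormedSpace ℝ K]

/-- The Koszul expression `½ (A(u, w, t) + A(w, u, t) - A(t, u, w))`. -/
def koszul (A : K →L[ℝ] K →L[ℝ] K →L[ℝ] ℝ) : K →L[ℝ] K →L[ℝ] K →L[ℝ] ℝ :=
  (1 / 2 : ℝ) • (A + A.flip -
    ((ContinuousLinearMap.flipₗᵢ ℝ K K ℝ).toContinuousLinearEquiv :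
      (K →L[ℝ] K →L[ℝ] ℝ) →L[ℝ] (K →L[ℝ] K →L[ℝ] ℝ)).comp A.flip)

theorem koszul_apply (A : K →L[ℝ] K →L[ℝ] K →L[ℝ] ℝ) (u w t : K) :
    koszul A u w t = 1 / 2 * (A u w t + A w u t - A t u w) := rfl

theorem contDiff_koszul : ContDiff ℝ ∞ (koszul (K := K)) := by
  unfold koszul
  have h : ContDiff ℝ ∞ fun A : K →L[ℝ] K →L[ℝ] K →L[ℝ] ℝ => A.flip :=
    (ContinuousLinearMap.flipₗᵢ ℝ K K (K →L[ℝ] ℝ)).toContinuousLinearEquiv.contDiff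
  exact ((contDiff_id.add h).sub (contDiff_const.clm_comp h)).const_smul _

/-- The Levi-Civita connection form of the metric `G` on a vector space. -/
def lcConn (G : K → K →L[ℝ] K →L[ℝ] ℝ) (z : K) : K →L[ℝ] K →L[ℝ] K :=
  (ContinuousLinearMap.compL ℝ K (K →L[ℝ] ℝ) K (G z).inverse).comp (koszul (fderiv ℝ G z))

variable {G : K → K →L[ℝ] K →L[ℝ] ℝ} {z : K}

theorem lcConn_apply (u w : K) :
    lcConn G z u w = (G z).inverse (koszul (fderiv ℝ G z) u w) := rfl

theorem fderiv_symm_form (hs : ∀ᶠ y in 𝓝 z, IsScalarProduct (G y)) (hG : DifferentiableAt ℝ G z)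
    (u v w : K) : fderiv ℝ G z u v w = fderiv ℝ G z u w v := by
  rw [← fderiv_apply_const₂ hG, ← fderiv_apply_const₂ hG]
  have : (fun y => G y v w) =ᶠ[𝓝 z] fun y => G y w v := by
    filter_upwards [hs] with y hy using hy.symm v w
  rw [this.fderiv_eq]

variable [FiniteDimensional ℝ K]

/-- The Koszul formula on constant fields: brackets vanish, so only derivatives of the metric occur.
-/
theorem form_lcConn (h : IsScalarProduct (G z)) (u w t : K) :
    G z (lcConn G z u w) t
      = 1 / 2 * (fderiv ℝ G z u w t + fderiv ℝ G z w u t - fderiv ℝ G z t u w) := by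
  rw [lcConn_apply, h.apply_inverse, koszul_apply]

theorem contDiffAt_lcConn (h : IsScalarProduct (G z)) (hG : ContDiffAt ℝ ∞ G z) :
    ContDiffAt ℝ ∞ (lcConn G) z := by
  have h1 : ContDiffAt ℝ ∞ (fun y => (G y).inverse) z := by
    obtain ⟨e, he⟩ := h.isInvertible
    have : ContDiffAt ℝ ∞ ContinuousLinearMap.inverse (G z) := he ▸ contDiffAt_map_inverse e
    exact this.comp z hG
  have h2 : ContDiffAt ℝ ∞ (fun y => koszul (fderiv ℝ G y)) z :=
    contDiff_koszul.contDiffAt.comp z hG.smooth_fderiv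
  exact ((ContinuousLinearMap.compL ℝ K (K →L[ℝ] ℝ) K).contDiff.contDiffAt.comp z h1).clm_comp h2

theorem lcConn_symm (hs : ∀ᶠ y in 𝓝 z, IsScalarProduct (G y)) (hG : DifferentiableAt ℝ G z)
    (u w : K) : lcConn G z u w = lcConn G z w u := by
  refine hs.self_of_nhds.ext fun t => ?_
  rw [form_lcConn hs.self_of_nhds, form_lcConn hs.self_of_nhds, fderiv_symm_form hs hG t u w]
  ring

theorem lcConn_compat (hs : ∀ᶠ y in 𝓝 z, IsScalarProduct (G y)) (hG : DifferentiableAt ℝ G z)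
    (u a b : K) :
    fderiv ℝ G z u a b = G z (lcConn G z u a) b + G z a (lcConn G z u b) := by
  have h := hs.self_of_nhds
  rw [h.symm a, form_lcConn h, form_lcConn h, fderiv_symm_form hs hG u b a,
    fderiv_symm_form hs hG a u b, fderiv_symm_form hs hG b u a]
  ring

/-- The Levi-Civita connection is the only symmetric metric connection. -/
theorem lcConn_unique (h : IsScalarProduct (G z))
    {Γ : K → K → K} (hsymm : ∀ u v, Γ u v = Γ v u)
    (hc : ∀ u a b, fderiv ℝ G z u a b = G z (Γ u a) b + G z a (Γ u b)) (u w : K) :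
    lcConn G z u w = Γ u w := by
  refine h.ext fun t => ?_
  rw [form_lcConn h, hc u w t, hc w u t, hc t u w, hsymm w u, hsymm t u, hsymm t w,
    h.symm (Γ u t) w, h.symm u]
  ring

/-- The behaviour of the Levi-Civita connection form under a change of coordinates. -/
theorem lcConn_change {G₂ : K → K →L[ℝ] K →L[ℝ] ℝ} {ψ : K → K}
    (hψ : ContDiffAt ℝ ∞ ψ z) (hinv : (fderiv ℝ ψ z).IsInvertible)
    (hs : ∀ᶠ y in 𝓝 z, IsScalarProduct (G y)) (hG : DifferentiableAt ℝ G z)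
    (hs₂ : ∀ᶠ y in 𝓝 (ψ z), IsScalarProduct (G₂ y)) (hG₂ : DifferentiableAt ℝ G₂ (ψ z))
    (heq : ∀ᶠ y in 𝓝 z, ∀ u w, G y u w = G₂ (ψ y) (fderiv ℝ ψ y u) (fderiv ℝ ψ y w)) (u w : K) :
    fderiv ℝ ψ z (lcConn G z u w)
      = fderiv ℝ (fderiv ℝ ψ) z u w
        + lcConn G₂ (ψ z) (fderiv ℝ ψ z u) (fderiv ℝ ψ z w) := by
  have hi : ∀ a, fderiv ℝ ψ z ((fderiv ℝ ψ z).inverse a) = a := fun a =>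
    hinv.self_apply_inverse a
  -- Derivative of the relation expressing `G` as the pull-back of `G₂`; the Hessian of `ψ` enters
  -- through the two differentials.
  have hGd : ∀ u a b, fderiv ℝ G z u a b
      = fderiv ℝ G₂ (ψ z) (fderiv ℝ ψ z u) (fderiv ℝ ψ z a) (fderiv ℝ ψ z b)
        + G₂ (ψ z) (fderiv ℝ (fderiv ℝ ψ) z u a) (fderiv ℝ ψ z b)
        + G₂ (ψ z) (fderiv ℝ ψ z a) (fderiv ℝ (fderiv ℝ ψ) z u b) := by
    intro u a b
    have h1 : (fun y => G y a b)
        =ᶠ[𝓝 z] fun y => G₂ (ψ y) (fderiv ℝ ψ y a) (fderiv ℝ ψ y b) := by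
      filter_upwards [heq] with y hy using hy a b
    have hd : ∀ a, DifferentiableAt ℝ (fun y => fderiv ℝ ψ y a) z := fun a =>
      hψ.smooth_fderiv.diff.clm_apply (differentiableAt_const a)
    have h2 : fderiv ℝ (fun y => G₂ (ψ y)) z = (fderiv ℝ G₂ (ψ z)).comp (fderiv ℝ ψ z) :=
      fderiv_comp z hG₂ hψ.diff
    have hGψ : DifferentiableAt ℝ (fun y => G₂ (ψ y)) z := hG₂.comp z hψ.diff
    rw [← fderiv_apply_const₂ hG, h1.fderiv_eq, fderiv_apply₂ hGψ (hd a) (hd b), h2,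
      fderiv_apply_const hψ.smooth_fderiv.diff, fderiv_apply_const hψ.smooth_fderiv.diff]
    simp
  have hGz := heq.self_of_nhds
  -- The transformed connection, brought back by the inverse differential, is symmetric and metric
  -- for `G`, so uniqueness identifies it without manipulating Koszul expressions.
  rw [lcConn_unique hs.self_of_nhds (Γ := fun u w => (fderiv ℝ ψ z).inverse
    (fderiv ℝ (fderiv ℝ ψ) z u w + lcConn G₂ (ψ z) (fderiv ℝ ψ z u) (fderiv ℝ ψ z w)))
    (fun u v => by rw [hψ.second_symm u v, lcConn_symm hs₂ hG₂]) (fun u a b => ?_), hi]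
  rw [hGd, hGz, hGz, hi, hi, lcConn_compat hs₂ hG₂]
  simp only [map_add, add_apply]
  ring

end LeviCivita

/-- The pair symmetry of the curvature of the Levi-Civita connection. -/
theorem pair_symm_of_skew {K : Type*} {R : K → K → K → K → ℝ} (h1 : ∀ u v a b, R u v a b = - R v u a b)
    (h2 : ∀ u v a b, R u v a b = - R u v b a)
    (h3 : ∀ u v a b, R u v a b + R v a u b + R a u v b = 0) (u v a b : K) :
    R u v a b = R a b u v := by
  -- The octahedron argument: the four Bianchi sums obtained by rotating the arguments combine,
  -- modulo the skew symmetries, to the pair symmetry.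
  linarith [h3 u v a b, h3 v a b u, h3 a b u v, h3 b u v a, h1 u v a b, h2 u v a b, h1 v a u b,
    h2 v a u b, h1 a u v b, h2 a u v b, h1 v a b u, h2 v a b u, h1 a b v u, h2 a b v u,
    h1 b v a u, h2 b v a u, h1 a b u v, h2 a b u v, h1 b u a v, h2 b u a v, h1 u a b v,
    h2 u a b v, h1 b u v a, h2 b u v a, h1 u v b a, h2 u v b a, h1 v b u a, h2 v b u a]

/-! ### Derivatives of matrix inverses -/

section MatrixCalculus

variable {E : Type*} [NormedAddCommGroup E] [NormedSpace ℝ E] {m : ℕ}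

theorem contDiffAt_det {A : E → Matrix (Fin m) (Fin m) ℝ} {z : E}
    (hA : ∀ i j, ContDiffAt ℝ ∞ (fun y => A y i j) z) :
    ContDiffAt ℝ ∞ (fun y => (A y).det) z := by
  simp only [Matrix.det_apply']
  exact ContDiffAt.sum fun σ _ => contDiffAt_const.mul (contDiffAt_prod fun i _ => hA _ _)

/-- Cramer's rule: each entry of the inverse is a determinant with one row replaced by a constant
row, divided by the determinant of `A`. -/
theorem contDiffAt_matrix_inv {A : E → Matrix (Fin m) (Fin m) ℝ} {z : E}
    (hA : ∀ i j, ContDiffAt ℝ ∞ (fun y => A y i j) z) (h0 : (A z).det ≠ 0) (i j : Fin m) :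
    ContDiffAt ℝ ∞ (fun y => (A y)⁻¹ i j) z := by
  simp only [Matrix.inv_def, Ring.inverse_eq_inv', Matrix.smul_apply, smul_eq_mul,
    Matrix.adjugate_apply]
  refine ((contDiffAt_det hA).inv h0).mul (contDiffAt_det fun a b => ?_)
  simp only [Matrix.updateRow_apply]
  split_ifs
  · exact contDiffAt_const
  · exact hA a b

/-- A matrix field which is the identity to first order at a point has an inverse with the same
property. -/
theorem fderiv_matrix_inv_eq_zero {A : E → Matrix (Fin m) (Fin m) ℝ} {z : E}
    (hA : ∀ i j, ContDiffAt ℝ ∞ (fun y => A y i j) z) (h1 : A z = 1)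
    (hd : ∀ i j, fderiv ℝ (fun y => A y i j) z = 0) (i j : Fin m) :
    fderiv ℝ (fun y => (A y)⁻¹ i j) z = 0 := by
  have h0 : (A z).det ≠ 0 := by simp [h1]
  have hS := contDiffAt_matrix_inv hA h0
  -- Differentiate `A A⁻¹ = 1`, which holds near `z` because the determinant stays nonzero.
  have hev : (fun y => ∑ l, A y i l * (A y)⁻¹ l j)
      =ᶠ[𝓝 z] fun _ => (1 : Matrix (Fin m) (Fin m) ℝ) i j := by
    filter_upwards [(contDiffAt_det hA).continuousAt.eventually_ne h0] with y hy
    rw [← Matrix.mul_apply, Matrix.mul_nonsing_inv _ (isUnit_iff_ne_zero.2 hy)]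
  have h2 := hev.fderiv_eq (𝕜 := ℝ)
  have hm : ∀ l ∈ Finset.univ, DifferentiableAt ℝ (fun y => A y i l * (A y)⁻¹ l j) z :=
    fun l _ => (hA i l).diff.mul (hS l j).diff
  rw [fderiv_fun_sum hm] at h2
  ext u
  have h3 := congrArg (fun L => L u) h2
  simp only [fderiv_fun_const, Pi.zero_apply, sum_apply, zero_apply] at h3
  refine Eq.trans ?_ h3
  have : ∀ l, fderiv ℝ (fun y => A y i l * (A y)⁻¹ l j) z u
      = (1 : Matrix (Fin m) (Fin m) ℝ) i l * fderiv ℝ (fun y => (A y)⁻¹ l j) z u := by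
    intro l
    rw [fderiv_fun_mul (hA i l).diff (hS l j).diff, hd i l, h1]
    simp
  simp only [this, Matrix.one_apply]
  simp

end MatrixCalculus

/-! ### Submanifold geometry for a soldered metric connection -/

section Soldered

variable {m : ℕ} {K : Type*} [NormedAddCommGroup K] [NormedSpace ℝ K]

/-- The induced scalar product `g(Ju, Jv)`. -/
def indMet (g : Euc m → K →L[ℝ] K →L[ℝ] ℝ) (J : Euc m → Euc m →L[ℝ] K) (z : Euc m) :
    Euc m →L[ℝ] Euc m →L[ℝ] ℝ :=
  (((g z).comp (J z)).flip.comp (J z)).flip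

/-- The tangential component, as a vector of the domain of `J`. -/
def tanProj (g : Euc m → K →L[ℝ] K →L[ℝ] ℝ) (J : Euc m → Euc m →L[ℝ] K) (z : Euc m) :
    K →L[ℝ] Euc m :=
  (indMet g J z).inverse.comp ((g z).flip.comp (J z)).flip

/-- The normal component. -/
def norProj (g : Euc m → K →L[ℝ] K →L[ℝ] ℝ) (J : Euc m → Euc m →L[ℝ] K) (z : Euc m) :
    K →L[ℝ] K :=
  ContinuousLinearMap.id ℝ K - (J z).comp (tanProj g J z)

/-- The second derivative `∇_u (J v)` for constant `v`. -/
def secondJ (θ : Euc m → Euc m →L[ℝ] K →L[ℝ] K) (J : Euc m → Euc m →L[ℝ] K) (z u v : Euc m) : K :=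
  covD θ (fun y => J y v) z u

/-- The second fundamental form. -/
def flatB (g : Euc m → K →L[ℝ] K →L[ℝ] ℝ) (θ : Euc m → Euc m →L[ℝ] K →L[ℝ] K)
    (J : Euc m → Euc m →L[ℝ] K) (z u v : Euc m) : K :=
  norProj g J z (secondJ θ J z u v)

/-- The trace of the second fundamental form. -/
def flatTau (g : Euc m → K →L[ℝ] K →L[ℝ] ℝ) (θ : Euc m → Euc m →L[ℝ] K →L[ℝ] K)
    (J : Euc m → Euc m →L[ℝ] K) (z : Euc m) : K :=
  traceIn (stdE m) (fun u v => indMet g J z u v) (flatB g θ J z)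

/-- The vector field with value `v` at `z₀` that is parallel at `z₀` for the induced connection. -/
def parField (g : Euc m → K →L[ℝ] K →L[ℝ] ℝ) (θ : Euc m → Euc m →L[ℝ] K →L[ℝ] K)
    (J : Euc m → Euc m →L[ℝ] K) (z₀ v z : Euc m) : Euc m :=
  v - tanProj g J z₀ (secondJ θ J z₀ (z - z₀) v)

/-- A metric connection `θ` on the trivial bundle over `U` with a torsion-free injective soldering
form `J`. -/
structure IsSoldered (U : Set (Euc m)) (g : Euc m → K →L[ℝ] K →L[ℝ] ℝ)
    (θ : Euc m → Euc m →L[ℝ] K →L[ℝ] K) (J : Euc m → Euc m →L[ℝ] K) : Prop where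
  isOpen : IsOpen U
  smooth_g : ∀ z ∈ U, ContDiffAt ℝ ∞ g z
  smooth_conn : ∀ z ∈ U, ContDiffAt ℝ ∞ θ z
  smooth_J : ∀ z ∈ U, ContDiffAt ℝ ∞ J z
  scalarProduct : ∀ z ∈ U, IsScalarProduct (g z)
  injective : ∀ z ∈ U, Function.Injective (J z)
  compat : ∀ z ∈ U, ∀ u a b, fderiv ℝ g z u a b = g z (θ z u a) b + g z a (θ z u b)
  torsion : ∀ z ∈ U, ∀ u v, fderiv ℝ J z u v + θ z u (J z v) = fderiv ℝ J z v u + θ z v (J z u)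

variable {U : Set (Euc m)} {g : Euc m → K →L[ℝ] K →L[ℝ] ℝ}
  {θ : Euc m → Euc m →L[ℝ] K →L[ℝ] K} {J : Euc m → Euc m →L[ℝ] K}

theorem indMet_apply (z u v : Euc m) : indMet g J z u v = g z (J z u) (J z v) := rfl

theorem norProj_apply (z : Euc m) (a : K) : norProj g J z a = a - J z (tanProj g J z a) := rfl

theorem parField_self (z₀ v : Euc m) : parField g θ J z₀ v z₀ = v := by
  simp [parField, secondJ]

theorem hasFDerivAt_parField (z₀ v z : Euc m) :
    HasFDerivAt (parField g θ J z₀ v)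
      (-(tanProj g J z₀).comp (covD θ (fun y => J y v) z₀)) z := by
  have h := ((tanProj g J z₀).comp (covD θ (fun y => J y v) z₀)).hasFDerivAt.comp z
    ((hasFDerivAt_id z).sub_const z₀)
  exact h.const_sub v

theorem fderiv_parField (z₀ v z u : Euc m) :
    fderiv ℝ (parField g θ J z₀ v) z u = - tanProj g J z₀ (secondJ θ J z₀ u v) := by
  rw [(hasFDerivAt_parField z₀ v z).fderiv]; rfl

theorem contDiff_parField (z₀ v : Euc m) : ContDiff ℝ ∞ (parField g θ J z₀ v) := by
  have : parField g θ J z₀ v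
      = fun z => v - ((tanProj g J z₀).comp (covD θ (fun y => J y v) z₀)) (z - z₀) := rfl
  rw [this]
  fun_prop

namespace IsSoldered

variable {z z₀ : Euc m}

theorem mem_nhds (h : IsSoldered U g θ J) (hz : z ∈ U) : U ∈ 𝓝 z := h.isOpen.mem_nhds hz

theorem isScalarProduct_indMet (h : IsSoldered U g θ J) (hz : z ∈ U) :
    IsScalarProduct (indMet g J z) :=
  ⟨fun _ _ => (h.scalarProduct z hz).symm _ _, fun _ hu => (h.scalarProduct z hz).pos _ fun h0 =>
    hu (h.injective z hz (Eq.trans h0 (map_zero (J z)).symm))⟩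

/-- The tangential projection is the adjoint of `J`; this relation characterises it, and its other
properties follow by testing against all `u`. -/
theorem form_tanProj (h : IsSoldered U g θ J) (hz : z ∈ U) (a : K) (u : Euc m) :
    indMet g J z (tanProj g J z a) u = g z a (J z u) := by
  have := (h.isScalarProduct_indMet hz).apply_inverse (((g z).flip.comp (J z)).flip a)
  exact congrArg (fun L => L u) this

theorem norProj_normal (h : IsSoldered U g θ J) (hz : z ∈ U) (a : K) (u : Euc m) :
    g z (norProj g J z a) (J z u) = 0 := by
  rw [norProj_apply, map_sub, sub_apply, ← h.form_tanProj hz, indMet_apply, sub_self]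

theorem tanProj_J (h : IsSoldered U g θ J) (hz : z ∈ U) (u : Euc m) :
    tanProj g J z (J z u) = u :=
  (h.isScalarProduct_indMet hz).ext fun w => by rw [h.form_tanProj hz]; rfl

theorem norProj_J (h : IsSoldered U g θ J) (hz : z ∈ U) (u : Euc m) :
    norProj g J z (J z u) = 0 := by
  rw [norProj_apply, h.tanProj_J hz, sub_self]

theorem tanProj_of_normal (h : IsSoldered U g θ J) (hz : z ∈ U) {a : K}
    (ha : ∀ u, g z a (J z u) = 0) : tanProj g J z a = 0 :=
  (h.isScalarProduct_indMet hz).ext fun w => by rw [h.form_tanProj hz, ha]; simp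

theorem norProj_of_normal (h : IsSoldered U g θ J) (hz : z ∈ U) {a : K}
    (ha : ∀ u, g z a (J z u) = 0) : norProj g J z a = a := by
  rw [norProj_apply, h.tanProj_of_normal hz ha, map_zero, sub_zero]

/-- A normal vector only sees normal components. -/
theorem form_norProj {a : K}
    (ha : ∀ u, g z a (J z u) = 0) (b : K) : g z a (norProj g J z b) = g z a b := by
  rw [norProj_apply, map_sub, ha, sub_zero]

theorem secondJ_eq (h : IsSoldered U g θ J) (hz : z ∈ U) (u v : Euc m) :
    secondJ θ J z u v = fderiv ℝ J z u v + θ z u (J z v) := by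
  rw [secondJ, covD_apply, fderiv_apply_const (h.smooth_J z hz).diff]

theorem secondJ_symm (h : IsSoldered U g θ J) (hz : z ∈ U) (u v : Euc m) :
    secondJ θ J z u v = secondJ θ J z v u := by
  rw [h.secondJ_eq hz, h.secondJ_eq hz, h.torsion z hz]

theorem isBilin_secondJ (h : IsSoldered U g θ J) (hz : z ∈ U) : IsBilin (secondJ θ J z) := by
  constructor
  · intro u u' v; simp [secondJ]
  · intro r u v; simp [secondJ]
  · intro u v v'; simp only [h.secondJ_eq hz, map_add]; abel
  · intro r u v; simp only [h.secondJ_eq hz, map_smul, smul_add]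

theorem isBilin_flatB (h : IsSoldered U g θ J) (hz : z ∈ U) : IsBilin (flatB g θ J z) := by
  have hb := h.isBilin_secondJ hz
  exact ⟨fun u u' v => by simp only [flatB, hb.add_left, map_add],
    fun r u v => by simp only [flatB, hb.smul_left, map_smul],
    fun u u' v => by simp only [flatB, hb.add_right, map_add],
    fun r u v => by simp only [flatB, hb.smul_right, map_smul]⟩

/-- The covariant derivative of a tangent field. -/
theorem covD_J (h : IsSoldered U g θ J) (hz : z ∈ U) {Y : Euc m → Euc m}
    (hY : DifferentiableAt ℝ Y z) (u : Euc m) :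
    covD θ (fun y => J y (Y y)) z u = secondJ θ J z u (Y z) + J z (fderiv ℝ Y z u) := by
  rw [covD_apply, fderiv_apply₁ (h.smooth_J z hz).diff hY, h.secondJ_eq hz]
  abel

theorem norProj_covD_J (h : IsSoldered U g θ J) (hz : z ∈ U) {Y : Euc m → Euc m}
    (hY : DifferentiableAt ℝ Y z) (u : Euc m) :
    norProj g J z (covD θ (fun y => J y (Y y)) z u) = flatB g θ J z u (Y z) := by
  rw [h.covD_J hz hY, map_add, h.norProj_J hz, add_zero, flatB]

/-- The covariant derivative at `z₀` of a field that is parallel at `z₀`. -/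
theorem covD_J_parField (h : IsSoldered U g θ J) (hz : z₀ ∈ U) (u v : Euc m) :
    covD θ (fun y => J y (parField g θ J z₀ v y)) z₀ u = flatB g θ J z₀ u v := by
  rw [h.covD_J hz (contDiff_parField z₀ v).contDiffAt.diff, fderiv_parField, parField_self,
    map_neg, ← sub_eq_add_neg]
  rfl

theorem smooth_indMet (h : IsSoldered U g θ J) (hz : z ∈ U) :
    ContDiffAt ℝ ∞ (indMet g J) z := by
  have hJ := h.smooth_J z hz
  have h1 : ContDiffAt ℝ ∞ (fun y => ((g y).comp (J y)).flip) z :=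
    (ContinuousLinearMap.flipₗᵢ ℝ (Euc m) K ℝ).toContinuousLinearEquiv.contDiff.contDiffAt.comp z
      ((h.smooth_g z hz).clm_comp hJ)
  exact (ContinuousLinearMap.flipₗᵢ ℝ (Euc m) (Euc m)
    ℝ).toContinuousLinearEquiv.contDiff.contDiffAt.comp z (h1.clm_comp hJ)

theorem smooth_tanProj (h : IsSoldered U g θ J) (hz : z ∈ U) :
    ContDiffAt ℝ ∞ (tanProj g J) z := by
  have h1 : ContDiffAt ℝ ∞ (fun y => (indMet g J y).inverse) z := by
    obtain ⟨e, he⟩ := (h.isScalarProduct_indMet hz).isInvertible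
    have : ContDiffAt ℝ ∞ ContinuousLinearMap.inverse (indMet g J z) :=
      he ▸ contDiffAt_map_inverse e
    exact this.comp z (h.smooth_indMet hz)
  have h2 : ContDiffAt ℝ ∞ (fun y => (g y).flip) z :=
    (ContinuousLinearMap.flipₗᵢ ℝ K K ℝ).toContinuousLinearEquiv.contDiff.contDiffAt.comp z
      (h.smooth_g z hz)
  have h3 : ContDiffAt ℝ ∞ (fun y => ((g y).flip.comp (J y)).flip) z :=
    (ContinuousLinearMap.flipₗᵢ ℝ (Euc m) K ℝ).toContinuousLinearEquiv.contDiff.contDiffAt.comp z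
      (h2.clm_comp (h.smooth_J z hz))
  exact h1.clm_comp h3

theorem smooth_norProj (h : IsSoldered U g θ J) (hz : z ∈ U) :
    ContDiffAt ℝ ∞ (norProj g J) z :=
  contDiffAt_const.sub ((h.smooth_J z hz).clm_comp (h.smooth_tanProj hz))

theorem smooth_covD (h : IsSoldered U g θ J) (hz : z ∈ U) {X : Euc m → K}
    (hX : ContDiffAt ℝ ∞ X z) : ContDiffAt ℝ ∞ (covD θ X) z :=
  ContDiffAt.covD (h.smooth_conn z hz) hX

theorem smooth_J_apply (h : IsSoldered U g θ J) (hz : z ∈ U) {Y : Euc m → Euc m}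
    (hY : ContDiffAt ℝ ∞ Y z) : ContDiffAt ℝ ∞ (fun y => J y (Y y)) z :=
  (h.smooth_J z hz).clm_apply hY

theorem smooth_flatB (h : IsSoldered U g θ J) (hz : z ∈ U) (u v : Euc m) :
    ContDiffAt ℝ ∞ (fun y => flatB g θ J y u v) z :=
  (h.smooth_norProj hz).clm_apply
    ((h.smooth_covD hz (h.smooth_J_apply hz contDiffAt_const)).clm_apply contDiffAt_const)

/-- The Gram matrix is congruent to that of an orthonormal basis, which is the identity. -/
theorem gram_det_ne_zero {b : Euc m → Euc m → ℝ} (hb : IsBilin b) (hs : ∀ u v, b u v = b v u)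
    (hpos : ∀ u, u ≠ 0 → 0 < b u u) :
    (Matrix.of fun i j => b (stdE m i) (stdE m j)).det ≠ 0 := by
  obtain ⟨o, ho⟩ := exists_isOrthonormal hb hs hpos
  have h1 : (Matrix.of fun i j => b (o i) (o j)) = (1 : Matrix (Fin m) (Fin m) ℝ) := by
    ext i j; simp [ho i j, Matrix.one_apply]
  rw [gram_change o hb] at h1
  have h2 := congrArg Matrix.det h1
  intro h0
  simp [Matrix.det_mul, h0] at h2

theorem smooth_flatTau (h : IsSoldered U g θ J) (hz : z ∈ U) :
    ContDiffAt ℝ ∞ (flatTau g θ J) z := by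
  have hs := h.isScalarProduct_indMet hz
  unfold flatTau traceIn
  refine ContDiffAt.sum fun i _ => ?_
  refine ContDiffAt.sum fun j _ => ?_
  refine ContDiffAt.smul ?_ (h.smooth_flatB hz _ _)
  refine contDiffAt_matrix_inv (A := fun y => Matrix.of fun i j =>
    indMet g J y (stdE m i) (stdE m j)) (fun i j => ?_) ?_ i j
  · exact ((h.smooth_indMet hz).clm_apply contDiffAt_const).clm_apply contDiffAt_const
  · exact gram_det_ne_zero (isBilin_clm _) hs.symm hs.pos

theorem flatTau_normal (h : IsSoldered U g θ J) (hz : z ∈ U) (u : Euc m) :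
    g z (flatTau g θ J z) (J z u) = 0 := by
  simp only [flatTau, traceIn, map_sum, map_smul, sum_apply, smul_apply, flatB,
    h.norProj_normal hz, smul_zero, Finset.sum_const_zero]

theorem fderiv_form (h : IsSoldered U g θ J) (hz : z ∈ U) {X Y : Euc m → K}
    (hX : DifferentiableAt ℝ X z) (hY : DifferentiableAt ℝ Y z) (u : Euc m) :
    fderiv ℝ (fun y => g y (X y) (Y y)) z u
      = g z (covD θ X z u) (Y z) + g z (X z) (covD θ Y z u) :=
  fderiv_form_covD (h.smooth_g z hz).diff (h.compat z hz u) hX hY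

end IsSoldered

end Soldered

/-! ### Tangential and normal parts of the rough Laplacian -/

namespace IsSoldered

variable {m : ℕ} {K : Type*} [NormedAddCommGroup K] [NormedSpace ℝ K]
variable {U : Set (Euc m)} {g : Euc m → K →L[ℝ] K →L[ℝ] ℝ}
  {θ : Euc m → Euc m →L[ℝ] K →L[ℝ] K} {J : Euc m → Euc m →L[ℝ] K} {z z₀ : Euc m}

theorem smooth_covD_apply (h : IsSoldered U g θ J) (hz : z ∈ U) {X : Euc m → K}
    (hX : ContDiffAt ℝ ∞ X z) {Y : Euc m → Euc m} (hY : ContDiffAt ℝ ∞ Y z) :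
    ContDiffAt ℝ ∞ (fun y => covD θ X y (Y y)) z :=
  (h.smooth_covD hz hX).clm_apply hY

theorem smooth_J_parField (h : IsSoldered U g θ J) (hz : z ∈ U) (v : Euc m) :
    ContDiffAt ℝ ∞ (fun y => J y (parField g θ J z₀ v y)) z :=
  h.smooth_J_apply hz (contDiff_parField z₀ v).contDiffAt

/-- Near `z₀` the trace of the second fundamental form may be computed in a frame that is
orthonormal and parallel at `z₀`; this is the derivative of its square. -/
theorem fderiv_form_flatTau (h : IsSoldered U g θ J) (hz : z₀ ∈ U) {o : Fin m → Euc m}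
    (ho : IsOrthonormal (fun u v => indMet g J z₀ u v) o) (w : Euc m) :
    fderiv ℝ (fun y => g y (flatTau g θ J y) (flatTau g θ J y)) z₀ w
      = ∑ i, fderiv ℝ (fun y => g y (flatTau g θ J y)
          (covD θ (fun x => J x (parField g θ J z₀ (o i) x)) y (parField g θ J z₀ (o i) y)))
          z₀ w := by
  set X : Fin m → Euc m → Euc m := fun i => parField g θ J z₀ (o i) with hX
  have hXs : ∀ i z, ContDiffAt ℝ ∞ (X i) z := fun i z => (contDiff_parField z₀ (o i)).contDiffAt
  have hX0 : ∀ i, X i z₀ = o i := fun i => parField_self z₀ (o i)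
  set γ : Euc m → Matrix (Fin m) (Fin m) ℝ := fun y => Matrix.of fun i j =>
    indMet g J y (X i y) (X j y) with hγ
  have hγs : ∀ i j, ContDiffAt ℝ ∞ (fun y => γ y i j) z₀ := fun i j =>
    ((h.smooth_indMet hz).clm_apply (hXs i z₀)).clm_apply (hXs j z₀)
  have hγ1 : γ z₀ = 1 := by
    ext i j
    simp only [hγ, Matrix.of_apply, hX0, Matrix.one_apply]
    exact ho i j
  -- At `z₀` the derivatives of the frame are values of the second fundamental form, hence normal,
  -- and they pair to zero with the tangent frame.
  have hγd : ∀ i j, fderiv ℝ (fun y => γ y i j) z₀ = 0 := by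
    intro i j
    ext u
    have : (fun y => γ y i j) = fun y => g y (J y (X i y)) (J y (X j y)) := rfl
    rw [this, h.fderiv_form hz (h.smooth_J_parField hz _).diff (h.smooth_J_parField hz _).diff,
      h.covD_J_parField hz, h.covD_J_parField hz, (h.scalarProduct z₀ hz).symm (J z₀ _),
      flatB, flatB, h.norProj_normal hz, h.norProj_normal hz]
    simp
  -- The frame remains a basis near `z₀`, so the trace may be computed in it at all nearby points
  -- and then differentiated.
  have hdet : ∀ᶠ y in 𝓝 z₀, (rowMatrix fun i => X i y).det ≠ 0 := by
    have hc : ContinuousAt (fun y => (rowMatrix fun i => X i y).det) z₀ := by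
      refine (contDiffAt_det fun i j => ?_).continuousAt
      exact (EuclideanSpace.proj j : Euc m →L[ℝ] ℝ).contDiff.contDiffAt.comp z₀ (hXs i z₀)
    refine hc.eventually_ne ?_
    have hli : LinearIndependent ℝ o := ho.linearIndependent (isBilin_clm _)
    simp only [hX0]
    exact ((Matrix.isUnit_iff_isUnit_det _).1 (isUnit_rowMatrix hli)).ne_zero
  set Y : Fin m → Fin m → Euc m → K := fun i j y => covD θ (fun x => J x (X j x)) y (X i y) with hY
  have hYs : ∀ i j, ContDiffAt ℝ ∞ (Y i j) z₀ := fun i j =>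
    h.smooth_covD_apply hz (h.smooth_J_parField hz _) (hXs i z₀)
  have hτ := h.smooth_flatTau hz
  have hev : (fun y => g y (flatTau g θ J y) (flatTau g θ J y))
      =ᶠ[𝓝 z₀] fun y => ∑ i, ∑ j, (γ y)⁻¹ i j * g y (flatTau g θ J y) (Y i j y) := by
    filter_upwards [hdet, h.mem_nhds hz] with y hy hyU
    have hli : LinearIndependent ℝ fun i => X i y := linearIndependent_of_isUnit_rowMatrix
      ((Matrix.isUnit_iff_isUnit_det _).2 (isUnit_iff_ne_zero.2 hy))
    have h1 : flatTau g θ J y = ∑ i, ∑ j, (γ y)⁻¹ i j • flatB g θ J y (X i y) (X j y) :=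
      (traceIn_eq_std hli (isBilin_clm _) (h.isBilin_flatB hyU)).symm
    refine (congrArg (g y (flatTau g θ J y)) h1).trans ?_
    rw [map_sum]
    refine Finset.sum_congr rfl fun i _ => ?_
    rw [map_sum]
    refine Finset.sum_congr rfl fun j _ => ?_
    -- Pairing with the normal vector `τ` makes the normal projection in the second fundamental form
    -- superfluous.
    rw [map_smul, smul_eq_mul, ← h.norProj_covD_J hyU (hXs j y).diff,
      form_norProj (h.flatTau_normal hyU)]
  have hsm : ∀ i j, ContDiffAt ℝ ∞ (fun y => g y (flatTau g θ J y) (Y i j y)) z₀ := fun i j =>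
    ((h.smooth_g z₀ hz).clm_apply hτ).clm_apply (hYs i j)
  have hSs := contDiffAt_matrix_inv hγs (by simp [hγ1])
  rw [hev.fderiv_eq]
  have hd1 : ∀ i ∈ Finset.univ, DifferentiableAt ℝ
      (fun y => ∑ j, (γ y)⁻¹ i j * g y (flatTau g θ J y) (Y i j y)) z₀ := fun i _ =>
    (ContDiffAt.sum fun j _ => (hSs i j).mul (hsm i j)).diff
  rw [fderiv_fun_sum hd1, sum_apply]
  refine Finset.sum_congr rfl fun i _ => ?_
  have hd2 : ∀ j ∈ Finset.univ, DifferentiableAt ℝ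
      (fun y => (γ y)⁻¹ i j * g y (flatTau g θ J y) (Y i j y)) z₀ := fun j _ =>
    ((hSs i j).mul (hsm i j)).diff
  rw [fderiv_fun_sum hd2, sum_apply]
  -- The inverse Gram matrix is the identity to first order at `z₀`, so only the diagonal terms
  -- survive and its own derivative does not contribute.
  have : ∀ j, fderiv ℝ (fun y => (γ y)⁻¹ i j * g y (flatTau g θ J y) (Y i j y)) z₀ w
      = (1 : Matrix (Fin m) (Fin m) ℝ) i j
        * fderiv ℝ (fun y => g y (flatTau g θ J y) (Y i j y)) z₀ w := by
    intro j
    rw [fderiv_fun_mul (hSs i j).diff (hsm i j).diff,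
      fderiv_matrix_inv_eq_zero hγs hγ1 hγd i j, hγ1]
    simp
  simp only [this, Matrix.one_apply]
  simp [hY, hX]

/-- The tangential component of the rough Laplacian of the trace of the second fundamental form. -/
theorem sum_form_second_tangent (h : IsSoldered U g θ J) (hz : z₀ ∈ U) {o : Fin m → Euc m}
    (ho : IsOrthonormal (fun u v => indMet g J z₀ u v) o) (w : Euc m) :
    ∑ i, g z₀ (covD θ (fun y => covD θ (flatTau g θ J) y (parField g θ J z₀ (o i) y)) z₀ (o i))
        (J z₀ w)
      = - 2 * (∑ i, g z₀ (covD θ (flatTau g θ J) z₀ (o i)) (flatB g θ J z₀ (o i) w))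
        - 1 / 2 * fderiv ℝ (fun y => g y (flatTau g θ J y) (flatTau g θ J y)) z₀ w
        - ∑ i, g z₀ (flatTau g θ J z₀) (curvForm θ z₀ (o i) w (J z₀ (o i))) := by
  set τ := flatTau g θ J with hτdef
  have hτ : ∀ z ∈ U, ContDiffAt ℝ ∞ τ z := fun z hz => h.smooth_flatTau hz
  have hτn : ∀ z ∈ U, ∀ u, g z (τ z) (J z u) = 0 := fun z hz => h.flatTau_normal hz
  set X : Euc m → Euc m → Euc m := fun v => parField g θ J z₀ v with hX
  have hXs : ∀ v z, ContDiffAt ℝ ∞ (X v) z := fun v z => (contDiff_parField z₀ v).contDiffAt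
  have hX0 : ∀ v, X v z₀ = v := fun v => parField_self z₀ v
  have hXd : ∀ v z u, fderiv ℝ (X v) z u = - tanProj g J z₀ (secondJ θ J z₀ u v) :=
    fderiv_parField z₀
  set W : Euc m → Euc m → K := fun v y => J y (X v y) with hW
  have hWs : ∀ v, ∀ z ∈ U, ContDiffAt ℝ ∞ (W v) z := fun v z hz => h.smooth_J_parField hz v
  have hDW : ∀ u v, covD θ (W v) z₀ u = flatB g θ J z₀ u v := fun u v =>
    h.covD_J_parField hz u v
  -- the second derivative of `g(τ, W) = 0`
  have step1 : ∀ i, g z₀ (covD θ (fun y => covD θ τ y (X (o i) y)) z₀ (o i)) (J z₀ w)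
      = - 2 * g z₀ (covD θ τ z₀ (o i)) (flatB g θ J z₀ (o i) w)
        - g z₀ (τ z₀) (covD θ (fun y => covD θ (W w) y (X (o i) y)) z₀ (o i)) := by
    intro i
    have hfirst : ∀ y ∈ U, g y (covD θ τ y (X (o i) y)) (W w y)
        + g y (τ y) (covD θ (W w) y (X (o i) y)) = 0 := by
      intro y hy
      rw [← h.fderiv_form hy (hτ y hy).diff (hWs w y hy).diff]
      have : (fun y => g y (τ y) (W w y)) =ᶠ[𝓝 y] fun _ => (0 : ℝ) := by
        filter_upwards [h.mem_nhds hy] with x hx using hτn x hx _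
      rw [this.fderiv_eq]; simp
    have hs1 := h.smooth_covD_apply hz (hτ z₀ hz) (hXs (o i) z₀)
    have hs2 := h.smooth_covD_apply hz (hWs w z₀ hz) (hXs (o i) z₀)
    have hev : (fun y => g y (covD θ τ y (X (o i) y)) (W w y)
        + g y (τ y) (covD θ (W w) y (X (o i) y))) =ᶠ[𝓝 z₀] fun _ => (0 : ℝ) := by
      filter_upwards [h.mem_nhds hz] with x hx using hfirst x hx
    have hd := congrArg (fun L => L (o i)) (hev.fderiv_eq (𝕜 := ℝ))
    rw [fderiv_fun_add
      (((h.smooth_g z₀ hz).clm_apply hs1).clm_apply (hWs w z₀ hz)).diff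
      (((h.smooth_g z₀ hz).clm_apply (hτ z₀ hz)).clm_apply hs2).diff, add_apply,
      h.fderiv_form hz hs1.diff (hWs w z₀ hz).diff, h.fderiv_form hz (hτ z₀ hz).diff hs2.diff,
      hDW, hX0, hDW] at hd
    have hW0 : W w z₀ = J z₀ w := by simp only [hW, hX0]
    rw [hW0] at hd
    simp only [fderiv_fun_const, Pi.zero_apply, zero_apply] at hd
    linarith
  -- interchanging the fields and the derivatives
  have step2 : ∀ i, g z₀ (τ z₀) (covD θ (fun y => covD θ (W w) y (X (o i) y)) z₀ (o i))
      = g z₀ (τ z₀) (covD θ (fun y => covD θ (W (o i)) y (X (o i) y)) z₀ w)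
        + g z₀ (τ z₀) (curvForm θ z₀ (o i) w (J z₀ (o i))) := by
    intro i
    -- The bracket of the two parallel fields. It vanishes at `z₀` but not nearby; since it vanishes
    -- there, its covariant derivative is purely tangential and is invisible to `τ`.
    set Z : Euc m → Euc m := fun y => fderiv ℝ (X w) y (X (o i) y) - fderiv ℝ (X (o i)) y (X w y)
      with hZ
    have hZs : ContDiffAt ℝ ∞ Z z₀ :=
      ((hXs w z₀).smooth_fderiv.clm_apply (hXs _ z₀)).sub
        ((hXs _ z₀).smooth_fderiv.clm_apply (hXs w z₀))
    have hZ0 : Z z₀ = 0 := by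
      simp only [hZ, hXd, hX0, h.secondJ_symm hz w, sub_self]
    have hev : (fun y => covD θ (W w) y (X (o i) y))
        =ᶠ[𝓝 z₀] fun y => covD θ (W (o i)) y (X w y) + J y (Z y) := by
      filter_upwards [h.mem_nhds hz] with y hy
      simp only [hW, hZ]
      rw [h.covD_J hy (hXs w y).diff, h.covD_J hy (hXs (o i) y).diff, h.secondJ_symm hy, map_sub]
      abel
    have hs := h.smooth_covD_apply hz (hWs (o i) z₀ hz) (hXs w z₀)
    rw [covD_congr hev, covD_add hs.diff (h.smooth_J_apply hz hZs).diff,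
      h.covD_J hz hZs.diff, hZ0, (h.isBilin_secondJ hz).zero_right, zero_add, map_add,
      hτn z₀ hz, add_zero]
    have hcomm := covD_comm (h.smooth_conn z₀ hz) (hWs (o i) z₀ hz) (hXs (o i) z₀).diff
      (hXs w z₀).diff
    have hbr : fderiv ℝ (X w) z₀ (X (o i) z₀) - fderiv ℝ (X (o i)) z₀ (X w z₀) = 0 := hZ0
    rw [hbr, map_zero, add_zero] at hcomm
    simp only [hX0] at hcomm
    rw [sub_eq_iff_eq_add.1 hcomm, map_add, add_comm]
    simp only [hW, hX0]
  -- the derivative of the trace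
  have step3 : ∑ i, g z₀ (τ z₀) (covD θ (fun y => covD θ (W (o i)) y (X (o i) y)) z₀ w)
      = 1 / 2 * fderiv ℝ (fun y => g y (τ y) (τ y)) z₀ w := by
    have h1 := h.fderiv_form_flatTau hz ho w
    have h2 := h.fderiv_form hz (hτ z₀ hz).diff (hτ z₀ hz).diff w
    have h3 : ∀ i, fderiv ℝ (fun y => g y (τ y) (covD θ (W (o i)) y (X (o i) y))) z₀ w
        = g z₀ (covD θ τ z₀ w) (flatB g θ J z₀ (o i) (o i))
          + g z₀ (τ z₀) (covD θ (fun y => covD θ (W (o i)) y (X (o i) y)) z₀ w) := by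
      intro i
      rw [h.fderiv_form hz (hτ z₀ hz).diff
        (h.smooth_covD_apply hz (hWs (o i) z₀ hz) (hXs (o i) z₀)).diff, hX0, hDW]
    have h4 : ∑ i, flatB g θ J z₀ (o i) (o i) = τ z₀ :=
      (ho.traceIn_std (isBilin_clm _) (h.isBilin_flatB hz)).symm
    -- Through the trace, the derivative of `|τ|²` is `g(∇τ, τ)` plus the wanted sum; directly, it
    -- is `2 g(∇τ, τ)`. Hence the sum is half of the derivative.
    have h5 : fderiv ℝ (fun y => g y (τ y) (τ y)) z₀ w
        = g z₀ (covD θ τ z₀ w) (τ z₀)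
          + ∑ i, g z₀ (τ z₀) (covD θ (fun y => covD θ (W (o i)) y (X (o i) y)) z₀ w) := by
      rw [h1]
      conv_rhs => rw [← h4, map_sum]
      rw [← Finset.sum_add_distrib]
      refine Finset.sum_congr rfl fun i _ => ?_
      rw [h4]
      exact h3 i
    rw [(h.scalarProduct z₀ hz).symm (τ z₀)] at h2
    linarith
  rw [← step3]
  refine (Finset.sum_congr rfl fun i _ => (step1 i).trans (congrArg _ (step2 i))).trans ?_
  simp only [Finset.sum_sub_distrib, Finset.sum_add_distrib, ← Finset.mul_sum]
  ring

/-- The normal component of the rough Laplacian of a normal section, in codimension one. -/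
theorem sum_form_second_normal (h : IsSoldered U g θ J) (hz : z₀ ∈ U) {o : Fin m → Euc m}
    (ho : IsOrthonormal (fun u v => indMet g J z₀ u v) o) {ν : K} (hν1 : g z₀ ν ν = 1)
    (hν : ∀ u, g z₀ ν (J z₀ u) = 0)
    (hcod : ∀ a, (∀ u, g z₀ a (J z₀ u) = 0) → a = g z₀ a ν • ν)
    {T : Euc m → K} (hT : ∀ z ∈ U, ContDiffAt ℝ ∞ T z) (hTn : ∀ z ∈ U, ∀ u, g z (T z) (J z u) = 0) :
    ∑ i, g z₀ (covD θ (fun y => covD θ T y (parField g θ J z₀ (o i) y)) z₀ (o i)) ν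
      = ∑ i, g z₀ (covD θ (fun y => norProj g J y (covD θ T y (parField g θ J z₀ (o i) y)))
          z₀ (o i)) ν
        - (∑ i, ∑ j, g z₀ (flatB g θ J z₀ (o i) (o j)) (flatB g θ J z₀ (o i) (o j)))
          * g z₀ (T z₀) ν := by
  have hsp := h.scalarProduct z₀ hz
  have hB : ∀ u v, flatB g θ J z₀ u v = g z₀ (flatB g θ J z₀ u v) ν • ν := fun u v =>
    hcod _ (h.norProj_normal hz _)
  have hbil := h.isBilin_flatB hz
  -- The Weingarten equation, from differentiating the normality of `T`.
  have hDT : ∀ u v, g z₀ (covD θ T z₀ u) (J z₀ v) = - g z₀ (T z₀) (flatB g θ J z₀ u v) := by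
    intro u v
    have h1 := h.fderiv_form hz (hT z₀ hz).diff
      (h.smooth_J_apply hz (contDiffAt_const (c := v))).diff u
    have hev : (fun y => g y (T y) (J y v)) =ᶠ[𝓝 z₀] fun _ => (0 : ℝ) := by
      filter_upwards [h.mem_nhds hz] with y hy using hTn y hy v
    rw [hev.fderiv_eq] at h1
    simp only [fderiv_fun_const, Pi.zero_apply, zero_apply] at h1
    rw [flatB, form_norProj (hTn z₀ hz), secondJ]
    linarith
  have key : ∀ i, g z₀ (covD θ (fun y => covD θ T y (parField g θ J z₀ (o i) y)) z₀ (o i)) ν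
      = g z₀ (covD θ (fun y => norProj g J y (covD θ T y (parField g θ J z₀ (o i) y)))
          z₀ (o i)) ν
        - (∑ j, g z₀ (flatB g θ J z₀ (o i) (o j)) (flatB g θ J z₀ (o i) (o j)))
          * g z₀ (T z₀) ν := by
    intro i
    set V : Euc m → K := fun y => covD θ T y (parField g θ J z₀ (o i) y) with hV
    have hVs : ContDiffAt ℝ ∞ V z₀ :=
      h.smooth_covD_apply hz (hT z₀ hz) (contDiff_parField z₀ (o i)).contDiffAt
    have hP : ContDiffAt ℝ ∞ (fun y => tanProj g J y (V y)) z₀ :=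
      (h.smooth_tanProj hz).clm_apply hVs
    have hN : ContDiffAt ℝ ∞ (fun y => norProj g J y (V y)) z₀ :=
      (h.smooth_norProj hz).clm_apply hVs
    -- The normal summand yields the second normal derivative. The derivative of the tangential
    -- summand has as normal part the second fundamental form of the shape operator term.
    have hsplit : V = fun y => norProj g J y (V y) + J y (tanProj g J y (V y)) := by
      funext y; simp [norProj_apply]
    have h1 : covD θ V z₀ (o i) = covD θ (fun y => norProj g J y (V y)) z₀ (o i)
        + covD θ (fun y => J y (tanProj g J y (V y))) z₀ (o i) := by
      conv_lhs => rw [hsplit]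
      exact covD_add hN.diff (h.smooth_J_apply hz hP).diff _
    rw [h1, map_add, add_apply, sub_eq_add_neg]
    congr 1
    rw [hsp.symm, ← form_norProj hν, h.norProj_covD_J hz hP.diff]
    have hV0 : V z₀ = covD θ T z₀ (o i) := by simp only [hV, parField_self]
    have hexp := ho.expand (isBilin_clm _) (tanProj g J z₀ (V z₀))
    -- Codimension one enters here: `B` is a multiple of `ν`, so `g(T, B) g(B, ν) = g(B, B) g(T, ν)`
    -- for each pair of frame vectors.
    rw [hexp, hbil.sum_right, map_sum, Finset.sum_mul, ← Finset.sum_neg_distrib]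
    refine Finset.sum_congr rfl fun j _ => ?_
    rw [hbil.smul_right, map_smul, smul_eq_mul, h.form_tanProj hz, hV0, hDT,
      hsp.symm ν, hB (o i) (o j)]
    simp only [map_smul, smul_apply, smul_eq_mul, hν1]
    ring
  simp only [key, Finset.sum_sub_distrib, ← Finset.sum_mul]

end IsSoldered

/-! ### Pointwise algebra of normal contact metric structures -/

section ContactAlgebra

variable {V : Type*} [NormedAddCommGroup V] [NormedSpace ℝ V]

/-- An almost contact metric structure on a vector space. -/
structure IsAlmostContact (b : V →L[ℝ] V →L[ℝ] ℝ) (Φ : V →L[ℝ] V) (ξ : V) (η : V →L[ℝ] ℝ) :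
    Prop where
  scalarProduct : IsScalarProduct b
  phi_phi : ∀ v, Φ (Φ v) = -v + η v • ξ
  eta_xi : η ξ = 1
  form_phi_phi : ∀ v w, b (Φ v) (Φ w) = b v w - η v * η w

namespace IsAlmostContact

variable {b : V →L[ℝ] V →L[ℝ] ℝ} {Φ : V →L[ℝ] V} {ξ : V} {η : V →L[ℝ] ℝ}

/-- Since `Φ²ξ = 0`, the formula for `Φ²` applied to `Φξ` shows that `Φξ` is a multiple `t ξ`. Then
`0 = Φ²ξ = t² ξ` forces `t = 0`. -/
theorem phi_xi (h : IsAlmostContact b Φ ξ η) : Φ ξ = 0 := by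
  have h1 : Φ (Φ ξ) = 0 := by rw [h.phi_phi, h.eta_xi]; simp
  have h2 := h.phi_phi (Φ ξ)
  rw [h1, map_zero] at h2
  have h3 : Φ ξ = η (Φ ξ) • ξ := by
    have := eq_neg_of_add_eq_zero_right h2.symm
    rw [neg_neg] at this; exact this.symm
  have h4 : (η (Φ ξ) * η (Φ ξ)) • ξ = 0 := by
    have : Φ (Φ ξ) = η (Φ ξ) • Φ ξ := by conv_lhs => rw [h3, map_smul]
    rw [h1] at this
    rw [mul_smul, ← h3, ← this]
  have h5 : η (Φ ξ) * η (Φ ξ) = 0 := by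
    have := congrArg η h4
    simpa [h.eta_xi] using this
  rw [h3, mul_self_eq_zero.1 h5, zero_smul]

/-- Compare the two ways `Φ(Φ²v)` and `Φ²(Φv)` of computing `Φ³v`; they differ by `η(Φv)ξ`. -/
theorem eta_phi (h : IsAlmostContact b Φ ξ η) (v : V) : η (Φ v) = 0 := by
  have h1 := h.phi_phi (Φ v)
  have h0 := congrArg Φ (h.phi_phi v)
  rw [map_add, map_neg, map_smul, h.phi_xi, smul_zero, add_zero, h1] at h0
  have h2 : η (Φ v) • ξ = 0 := by simpa using h0
  have h3 := congrArg η h2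
  simpa [h.eta_xi] using h3

theorem form_xi (h : IsAlmostContact b Φ ξ η) (v : V) : b v ξ = η v := by
  have := h.form_phi_phi v ξ
  rw [h.phi_xi, h.eta_xi, map_zero, mul_one] at this
  linarith

theorem form_phi_left (h : IsAlmostContact b Φ ξ η) (v w : V) : b (Φ v) w = - b v (Φ w) := by
  have := h.form_phi_phi v (Φ w)
  rw [h.phi_phi, h.eta_phi, map_add, map_neg, map_smul, h.form_xi, h.eta_phi] at this
  simp only [smul_eq_mul] at this
  linarith

/-- The pointwise identities between the covariant derivatives `N X = ∇_X ξ` and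
`P X Y = (∇_X φ) Y` on a normal contact metric manifold. -/
structure IsNormalDeriv (b : V →L[ℝ] V →L[ℝ] ℝ) (Φ : V →L[ℝ] V) (ξ : V) (η : V →L[ℝ] ℝ)
    (N : V → V) (P : V → V → V) : Prop where
  N_add : ∀ X Y, N (X + Y) = N X + N Y
  N_smul : ∀ (r : ℝ) X, N (r • X) = r • N X
  P_skew : ∀ X Y Z, b (P X Y) Z = - b (P X Z) Y
  N_xi : ∀ X, b (N X) ξ = 0
  P_xi : ∀ X, P X ξ = - Φ (N X)
  contact : ∀ X Y, 2 * b X (Φ Y) = b (N X) Y - b (N Y) X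
  cyclic : ∀ X Y Z, b (P X Y) Z + b (P Y Z) X + b (P Z X) Y = 0
  nijenhuis : ∀ X Y, P (Φ X) Y - P (Φ Y) X + Φ (P Y X) - Φ (P X Y) + (2 * b X (Φ Y)) • ξ = 0
  phi_deriv : ∀ X Y, P X (Φ Y) + Φ (P X Y) = b (N X) Y • ξ + η Y • N X

variable {N : V → V} {P : V → V → V}

/-- Normality tested against `ξ` makes the form `b(N X, Y)` skew on horizontal vectors, and `ξ` is
null for it in both slots, so it is skew everywhere: `ξ` is a Killing field. The contact condition
prescribes the skew part, hence the whole form. -/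
theorem deriv_xi (h : IsAlmostContact b Φ ξ η) (d : IsNormalDeriv b Φ ξ η N P) (X : V) :
    N X = - Φ X := by
  have hsym := h.scalarProduct.symm
  have hN0 : ∀ Y, b (N ξ) Y = 0 := by
    intro Y
    have h1 := d.contact ξ Y
    rw [d.N_xi, hsym ξ, h.form_xi, h.eta_phi] at h1
    linarith
  -- The cyclic identity with `ξ` in one slot expresses the derivative of `Φ` along `ξ` through `N`
  -- alone.
  have hq : ∀ X W, b (P ξ X) W = b (N X) (Φ W) - b (N W) (Φ X) := by
    intro X W
    have h1 := d.cyclic ξ X W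
    have h2 := d.P_skew X W ξ
    rw [d.P_xi, map_neg, neg_apply, h.form_phi_left] at h2
    rw [d.P_xi W, map_neg, neg_apply, h.form_phi_left] at h1
    linarith
  have hφ : ∀ X Z, b (N (Φ X)) (Φ Z) = - b (N (Φ Z)) (Φ X) := by
    intro X Z
    have h1 := congrArg (fun v => b v Z) (d.nijenhuis X ξ)
    rw [h.phi_xi, d.P_xi, d.P_xi] at h1
    -- Linearity of `P` in the direction of differentiation is not part of the data; its vanishing
    -- at `0` follows from the cyclic identity and skewness.
    have hP0 : b (P 0 X) Z = 0 := by
      have h2 := d.cyclic 0 X Z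
      have h3 := d.cyclic (0 : V) Z X
      have h4 := d.P_skew X Z 0
      have h5 := d.P_skew Z X 0
      have h6 := d.P_skew 0 X Z
      simp only [map_zero] at h2 h3 h4 h5
      linarith
    simp only [map_add, map_sub, map_neg, map_zero, add_apply, sub_apply, neg_apply,
      h.form_phi_left, h.phi_phi, map_smul, smul_apply, hP0, zero_apply, smul_eq_mul,
      mul_zero, zero_smul] at h1
    have h2 := hq X (Φ Z)
    rw [h.phi_phi, map_add, map_neg, map_smul, d.N_xi, smul_zero] at h2
    have h3 : η (N X) = 0 := by rw [← h.form_xi, d.N_xi]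
    rw [h3, zero_mul] at h1
    linarith
  have hdec : ∀ X, X = -Φ (Φ X) + η X • ξ := fun X => by rw [h.phi_phi]; simp
  have hNn : ∀ X, N (-X) = - N X := fun X => by rw [← neg_one_smul ℝ, d.N_smul, neg_one_smul]
  have hskew : ∀ X Z, b (N X) Z = b (N (Φ (Φ X))) (Φ (Φ Z)) := by
    intro X Z
    conv_lhs => rw [hdec X, hdec Z]
    rw [d.N_add, hNn, d.N_smul]
    simp only [map_add, map_neg, map_smul, add_apply, neg_apply, smul_apply, d.N_xi, hN0]
    simp
  refine h.scalarProduct.ext fun Z => ?_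
  have h1 := hskew X Z
  have h2 := hskew Z X
  have h3 := d.contact X Z
  rw [hφ] at h1
  rw [map_neg, neg_apply, h.form_phi_left]
  linarith

/-- The analogue of the theorem that integrability and a closed Kähler form make the complex
structure parallel. The cyclic identity expresses closedness of the fundamental form, and with the
Nijenhuis identity it determines the components of `P X Y` along the image of `Φ`. The component
along `ξ` comes from `N = -Φ`. -/
theorem deriv_phi (h : IsAlmostContact b Φ ξ η) (d : IsNormalDeriv b Φ ξ η N P) (X Y : V) :
    P X Y = b X Y • ξ - η Y • X := by
  have hN := h.deriv_xi d
  have hsym := h.scalarProduct.symm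
  have h9 : ∀ X Y Z, b (P X (Φ Y)) Z - b (P X Y) (Φ Z)
      = b X (Φ Y) * η Z + η Y * b X (Φ Z) := by
    intro X Y Z
    have h1 := congrArg (fun v => b v Z) (d.phi_deriv X Y)
    simp only [hN, map_add, map_neg, add_apply, neg_apply, h.form_phi_left, map_smul,
      smul_apply, smul_eq_mul, hsym ξ, h.form_xi] at h1
    linarith
  have h8 : ∀ X Y Z, b (P (Φ X) Y) Z - b (P (Φ Y) X) Z - b (P Y X) (Φ Z) + b (P X Y) (Φ Z)
      + 2 * b X (Φ Y) * η Z = 0 := by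
    intro X Y Z
    have h1 := congrArg (fun v => b v Z) (d.nijenhuis X Y)
    simp only [map_add, map_sub, add_apply, sub_apply, h.form_phi_left, map_smul,
      smul_apply, smul_eq_mul, hsym ξ, h.form_xi, map_zero, zero_apply] at h1
    linarith
  have hS : ∀ X Y Z, b (P X Y) (Φ Z) = - (η Y * b X (Φ Z)) := by
    -- The names are permuted so that `Z` is the direction of differentiation. The cyclic identities
    -- with `ΦX` and `ΦY` remove the derivatives in these directions from the Nijenhuis identity;
    -- the remaining identities move `Φ` between the slots.
    intro Z X Y
    have a1 := h8 X Y Z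
    have c1 := d.cyclic (Φ X) Y Z
    have c2 := d.cyclic (Φ Y) X Z
    have s1 := d.P_skew Y Z (Φ X)
    have s2 := d.P_skew X Z (Φ Y)
    have e1 := h9 Y Z X
    have e2 := h9 X Z Y
    have e3 := h9 Z X Y
    have e4 := h9 Z Y X
    have s3 := d.P_skew Z (Φ X) Y
    have s4 := d.P_skew Z (Φ Y) X
    have e5 := h9 Y X Z
    have e6 := h9 X Y Z
    have s5 := d.P_skew Y (Φ X) Z
    have s6 := d.P_skew X (Φ Y) Z
    have s7 := d.P_skew Y X (Φ Z)
    have s8 := d.P_skew X Y (Φ Z)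
    have f : ∀ X Y, b Y (Φ X) = - b X (Φ Y) := fun X Y => by rw [hsym, h.form_phi_left]
    have f1 := f X Y
    have f2 := f X Z
    have f3 := f Y Z
    simp only [f1, f2, f3] at a1 e1 e2 e3 e4 e5 e6 ⊢
    linarith
  refine h.scalarProduct.ext fun Z => ?_
  have hdec : Z = -Φ (Φ Z) + η Z • ξ := by rw [h.phi_phi]; simp
  have hξ : b (P X Y) ξ = b X Y - η X * η Y := by
    rw [d.P_skew, d.P_xi, hN]
    simp only [h.phi_phi, neg_neg, map_add, map_neg, map_smul, add_apply, neg_apply, smul_apply, smul_eq_mul,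
      hsym ξ, h.form_xi]
    ring
  have hΦ : b X (Φ (Φ Z)) = - b X Z + η X * η Z := by
    rw [h.phi_phi, map_add, map_neg, map_smul, h.form_xi, smul_eq_mul]; ring
  have h1 : b (P X Y) Z = - b (P X Y) (Φ (Φ Z)) + η Z * b (P X Y) ξ := by
    conv_lhs => rw [hdec]
    simp
  rw [h1, hS, hξ, hΦ]
  simp only [map_sub, map_smul, sub_apply, smul_apply, smul_eq_mul, hsym ξ, h.form_xi]
  ring

end IsAlmostContact

end ContactAlgebra

/-! ### Sectional curvature of a Sasakian space form -/

section CurvatureAlgebra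

variable {V : Type*} [NormedAddCommGroup V] [NormedSpace ℝ V]

/-- The algebraic identities of the curvature of a Sasakian manifold with constant `φ`-sectional
curvature `c`. -/
structure IsSasakianCurvature (b : V →L[ℝ] V →L[ℝ] ℝ) (Φ : V →L[ℝ] V) (ξ : V) (η : V →L[ℝ] ℝ)
    (R : V → V → V → V) (c : ℝ) : Prop where
  contact : IsAlmostContact b Φ ξ η
  bilin₁₂ : ∀ Z, IsBilin fun X Y => R X Y Z
  bilin₂₃ : ∀ X, IsBilin (R X)
  swap : ∀ X Y Z, R X Y Z = - R Y X Z
  skew : ∀ X Y Z W, b (R X Y Z) W = - b (R X Y W) Z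
  bianchi : ∀ X Y Z, R X Y Z + R Y Z X + R Z X Y = 0
  curv_xi : ∀ X Y, R X Y ξ = η Y • X - η X • Y
  curv_phi : ∀ X Y Z, R X Y (Φ Z) = Φ (R X Y Z) - b Y Z • Φ X + b X Z • Φ Y
    + b Z (Φ X) • Y - b Z (Φ Y) • X
  phi_sectional : ∀ X, b X X = 1 → b X ξ = 0 → b (R X (Φ X) (Φ X)) X = c

namespace IsSasakianCurvature

variable {b : V →L[ℝ] V →L[ℝ] ℝ} {Φ : V →L[ℝ] V} {ξ : V} {η : V →L[ℝ] ℝ} {R : V → V → V → V}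
  {c : ℝ}

theorem pair_symm (h : IsSasakianCurvature b Φ ξ η R c) (X Y Z W : V) :
    b (R X Y Z) W = b (R Z W X) Y := by
  refine pair_symm_of_skew (R := fun X Y Z W => b (R X Y Z) W) (fun u v a w => ?_) h.skew
    (fun u v a w => ?_) X Y Z W
  · rw [h.swap u v]; simp
  · rw [← add_apply, ← add_apply, ← map_add, ← map_add, h.bianchi]; simp

/-- Constancy of the `φ`-sectional curvature, for vectors of arbitrary length. -/
theorem phi_sectional_homogeneous (h : IsSasakianCurvature b Φ ξ η R c) (X : V) (hX : η X = 0) :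
    b (R X (Φ X) (Φ X)) X = c * (b X X) ^ 2 := by
  by_cases h0 : X = 0
  · subst h0; simp
  have hp := h.contact.scalarProduct.pos X h0
  set r := Real.sqrt (b X X) with hr
  have hr2 : r * r = b X X := Real.mul_self_sqrt hp.le
  have hr0 : r ≠ 0 := (Real.sqrt_pos.2 hp).ne'
  set Y := r⁻¹ • X with hY
  have hXY : X = r • Y := by rw [hY, smul_smul, mul_inv_cancel₀ hr0, one_smul]
  have h1 : b Y Y = 1 := by
    simp only [hY, map_smul, smul_apply, smul_eq_mul, ← hr2]
    field_simp
  have h2 : b Y ξ = 0 := by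
    rw [h.contact.form_xi, hY, map_smul, hX, smul_zero]
  have h3 := h.phi_sectional Y h1 h2
  rw [← hr2, hXY]
  simp only [map_smul, (h.bilin₁₂ _).smul_left, (h.bilin₂₃ _).smul_left, (h.bilin₂₃ _).smul_right,
    smul_apply, smul_eq_mul, h3]
  ring

/-- The substitute for the Kähler invariance of the curvature under the complex structure, with
correction terms because `φ` is not parallel. For horizontal `X, Y` one has `R(X, Y)ξ = 0`, so `R(X,
Y)Z` has no `ξ` component. -/
theorem form_curv_phi (h : IsSasakianCurvature b Φ ξ η R c) {X Y Z W : V}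
    (hX : η X = 0) (hY : η Y = 0) :
    b (R X Y (Φ Z)) (Φ W) = b (R X Y Z) W - b Y Z * b X W + b X Z * b Y W
      + b Z (Φ X) * b Y (Φ W) - b Z (Φ Y) * b X (Φ W) := by
  have hR : η (R X Y Z) = 0 := by
    rw [← h.contact.form_xi, h.skew, h.curv_xi, hX, hY]; simp
  rw [h.curv_phi]
  simp only [map_add, map_sub, map_smul, add_apply, sub_apply, smul_apply, smul_eq_mul,
    h.contact.form_phi_phi, hR, hX, hY]
  ring

/-- Polarisation of the quartic identity for the `φ`-sectional curvature: adding its values at `X +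
Y` and `X - Y` cancels the odd terms. The Bianchi identity and the commutation with `φ` reduce the
mixed terms to the curvatures of the planes of `X, Y` and of `X, φY`. -/
theorem sectional_relation (h : IsSasakianCurvature b Φ ξ η R c) {X Y : V} (hX : η X = 0)
    (hY : η Y = 0) :
    b (R X Y Y) X + 3 * b (R X (Φ Y) (Φ Y)) X
      = (c + 3) * (b X X * b Y Y) + (2 * c - 3) * (b X Y) ^ 2 - 3 * (b X (Φ Y)) ^ 2 := by
  have hc := h.contact
  have hs := hc.scalarProduct.symm
  have hJ : ∀ v, η v = 0 → Φ (Φ v) = - v := fun v hv => by rw [hc.phi_phi, hv]; simp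
  have p1 := h.phi_sectional_homogeneous (X + Y) (by simp [hX, hY])
  have p2 := h.phi_sectional_homogeneous (X - Y) (by simp [hX, hY])
  have p3 := h.phi_sectional_homogeneous X hX
  have p4 := h.phi_sectional_homogeneous Y hY
  have hRn : ∀ X Y Z, R (-X) Y Z = - R X Y Z := fun X Y Z => by
    rw [← neg_one_smul ℝ, (h.bilin₁₂ _).smul_left, neg_one_smul]
  have hRn2 : ∀ X Y Z, R X (-Y) Z = - R X Y Z := fun X Y Z => by
    rw [← neg_one_smul ℝ, (h.bilin₁₂ _).smul_right, neg_one_smul]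
  have hRn3 : ∀ X Y Z, R X Y (-Z) = - R X Y Z := fun X Y Z => by
    rw [← neg_one_smul ℝ, (h.bilin₂₃ _).smul_right, neg_one_smul]
  simp only [sub_eq_add_neg, map_add, map_neg, (h.bilin₁₂ _).add_left, (h.bilin₂₃ _).add_left,
    (h.bilin₂₃ _).add_right, hRn, hRn2, hRn3, add_apply, neg_apply, neg_neg, hs Y X] at p1 p2
  have ηΦ := hc.eta_phi
  have f1 : b Y (Φ X) = - b X (Φ Y) := by rw [hs, hc.form_phi_left]
  have f2 : b X (Φ X) = 0 := by
    have := hc.form_phi_left X X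
    rw [hs] at this; linarith
  have f3 : b Y (Φ Y) = 0 := by
    have := hc.form_phi_left Y Y
    rw [hs] at this; linarith
  have fl : ∀ v w, b (Φ v) w = - b v (Φ w) := hc.form_phi_left
  -- `R(Y, JY, JX, X) = R(X, JX, JY, Y)`
  have e1 : b (R Y (Φ Y) (Φ X)) X = b (R X (Φ X) (Φ Y)) Y := by
    rw [h.pair_symm, h.swap, map_neg, neg_apply, h.skew, neg_neg]
  -- `R(X, JY, JX, Y)`
  have e2 := h.form_curv_phi (X := X) (Y := Φ Y) (Z := Φ X) (W := Y) hX (ηΦ Y)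
  rw [hJ X hX, hRn3, map_neg, neg_apply, h.skew, neg_neg] at e2
  -- `R(Y, JX, JY, X)`
  have e3 := h.form_curv_phi (X := Y) (Y := Φ X) (Z := Φ Y) (W := X) hY (ηΦ X)
  rw [hJ Y hY, hRn3, map_neg, neg_apply, h.skew, neg_neg] at e3
  have e4 : b (R Y (Φ X) (Φ Y)) X = b (R X (Φ Y) (Φ X)) Y := by
    rw [h.pair_symm, h.swap, map_neg, neg_apply, h.skew, neg_neg]
  -- Bianchi
  have e5 := congrArg (fun v => b v Y) (h.bianchi X (Φ X) (Φ Y))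
  simp only [map_add, add_apply, map_zero, zero_apply] at e5
  have e6 := h.form_curv_phi (X := X) (Y := Y) (Z := X) (W := Y) hX hY
  have e7 : b (R (Φ X) (Φ Y) X) Y = b (R X Y (Φ X)) (Φ Y) := h.pair_symm _ _ _ _
  have e8 : b (R X Y X) Y = - b (R X Y Y) X := h.skew _ _ _ _
  have e9 : b (R (Φ Y) X (Φ X)) Y = - b (R X (Φ Y) (Φ X)) Y := by
    rw [h.swap, map_neg, neg_apply]
  simp only [fl, hJ X hX, hJ Y hY, map_neg, neg_neg, f1, f2, f3, hs Y X] at e2 e3 e6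
  linarith

/-- The sectional curvature of horizontal planes. -/
theorem sectional_horizontal (h : IsSasakianCurvature b Φ ξ η R c) {X Y : V} (hX : η X = 0)
    (hY : η Y = 0) :
    b (R X Y Y) X = (c + 3) / 4 * (b X X * b Y Y - (b X Y) ^ 2)
      + 3 * (c - 1) / 4 * (b X (Φ Y)) ^ 2 := by
  have h1 := h.sectional_relation hX hY
  -- Replacing `Y` by `φY` exchanges the two unknown curvatures, because `φ²Y = -Y`. The two
  -- relations form an invertible linear system.
  have h2 := h.sectional_relation hX (h.contact.eta_phi Y)
  have hJ : Φ (Φ Y) = - Y := by rw [h.contact.phi_phi, hY]; simp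
  have hRn : R X (-Y) (-Y) = R X Y Y := by
    rw [← neg_one_smul ℝ Y, (h.bilin₂₃ _).smul_left, (h.bilin₂₃ _).smul_right]; simp
  rw [hJ, hRn, h.contact.form_phi_phi, hY] at h2
  simp only [map_neg, neg_sq] at h2
  linarith

/-- Split off the `ξ` component of `Y`: the cross terms vanish by the formula for `R(X, Y)ξ`, and
planes containing `ξ` have curvature one. -/
theorem sectional (h : IsSasakianCurvature b Φ ξ η R c) {X : V} (hX : η X = 0) (Y : V) :
    b (R X Y Y) X = (c + 3) / 4 * (b X X * (b Y Y - (η Y) ^ 2) - (b X Y) ^ 2)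
      + 3 * (c - 1) / 4 * (b X (Φ Y)) ^ 2 + (η Y) ^ 2 * b X X := by
  have hc := h.contact
  have hs := hc.scalarProduct.symm
  set Z := Y - η Y • ξ with hZ
  have hYZ : Y = Z + η Y • ξ := by rw [hZ]; abel
  have hηZ : η Z = 0 := by simp [hZ, hc.eta_xi]
  have h1 := h.sectional_horizontal hX hηZ
  have hbZ : b Z Z = b Y Y - (η Y) ^ 2 := by
    simp only [hZ, map_sub, map_smul, sub_apply, smul_apply, smul_eq_mul, hs ξ, hc.form_xi,
      hc.eta_xi]
    ring
  have hXZ : b X Z = b X Y := by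
    simp only [hZ, map_sub, map_smul, smul_eq_mul, hc.form_xi, hX]; ring
  have hΦZ : Φ Z = Φ Y := by simp [hZ, hc.phi_xi]
  rw [hbZ, hXZ, hΦZ] at h1
  have hξ1 : b (R X Z ξ) X = 0 := by rw [h.curv_xi, hX, hηZ]; simp
  have hξ2 : b (R X ξ Z) X = 0 := by
    rw [h.pair_symm, h.swap, map_neg, neg_apply, h.skew, h.curv_xi, hX, hηZ]; simp
  have hξ3 : b (R X ξ ξ) X = b X X := by rw [h.curv_xi, hX, hc.eta_xi]; simp
  have h2 : b (R X Y Y) X = b (R X Z Z) X + (η Y) ^ 2 * b X X := by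
    conv_lhs => rw [hYZ]
    simp only [(h.bilin₂₃ _).add_left, (h.bilin₂₃ _).add_right, (h.bilin₂₃ _).smul_left,
      (h.bilin₂₃ _).smul_right, map_add, map_smul, add_apply, smul_apply, smul_eq_mul, hξ1, hξ2,
      hξ3]
    ring
  rw [h2, h1]

end IsSasakianCurvature

end CurvatureAlgebra

/-! ### Ricci curvature in horizontal directions -/

section Ricci

variable {k : ℕ} {b : Euc k →L[ℝ] Euc k →L[ℝ] ℝ} {Φ : Euc k →L[ℝ] Euc k} {ξ : Euc k}
  {η : Euc k →L[ℝ] ℝ} {R : Euc k → Euc k → Euc k → Euc k} {c : ℝ}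

theorem IsOrthonormal.parseval {b : Euc k →L[ℝ] Euc k →L[ℝ] ℝ} {o : Fin k → Euc k}
    (ho : IsOrthonormal (fun u v => b u v) o) (v w : Euc k) :
    ∑ i, b v (o i) * b w (o i) = b w v := by
  conv_rhs => rw [ho.expand (isBilin_clm b) v, map_sum]
  exact Finset.sum_congr rfl fun i _ => by rw [map_smul, smul_eq_mul]

/-- The Ricci curvature of a Sasakian space form in horizontal directions. -/
theorem IsSasakianCurvature.sum_curv (h : IsSasakianCurvature b Φ ξ η R c) {o : Fin k → Euc k}
    (ho : IsOrthonormal (fun u v => b u v) o) {X : Euc k} (hX : η X = 0) :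
    ∑ i, R (o i) X (o i) = - ((c + 3) / 4 * (k - 2) + 3 * (c - 1) / 4 + 1) • X := by
  have hc := h.contact
  have hs := hc.scalarProduct.symm
  set κ : ℝ := (c + 3) / 4 * (k - 2) + 3 * (c - 1) / 4 + 1 with hκ
  -- With this order of the arguments the form is minus the Ricci tensor.
  let ric : Euc k → Euc k → ℝ := fun X W => ∑ i, b (R (o i) X (o i)) W
  have hsymm : ∀ X W, ric X W = ric W X := fun X W =>
    Finset.sum_congr rfl fun i _ => h.pair_symm _ _ _ _
  -- By Parseval the squares of the coefficients of `ξ`, `X` and `φX` sum to `1`, `|X|²` and `|X|²`.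
  -- Removing `ξ` and `X` from the `k` frame directions leaves the factor `k - 2`.
  have hdiag : ∀ X, η X = 0 → ric X X = - κ * b X X := by
    intro X hX
    have h1 : ∀ i, b (R (o i) X (o i)) X
        = - ((c + 3) / 4 * (b X X * (1 - (b ξ (o i) * b ξ (o i))) - b X (o i) * b X (o i))
      + 3 * (c - 1) / 4 * (b (Φ X) (o i) * b (Φ X) (o i)) + b ξ (o i) * b ξ (o i) * b X X) := by
      intro i
      have h2 := h.sectional hX (o i)
      have h3 : b (o i) (o i) = 1 := by simpa using ho i i
      rw [h3, ← hc.form_xi, hs (o i) ξ] at h2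
      rw [h.swap, map_neg, neg_apply, h2, hc.form_phi_left]
      ring
    have e1 := ho.parseval ξ ξ
    have e2 := ho.parseval X X
    have e3 := ho.parseval (Φ X) (Φ X)
    rw [hc.form_phi_phi, hX] at e3
    rw [hc.form_xi, hc.eta_xi] at e1
    simp only [ric, h1, Finset.sum_neg_distrib, Finset.sum_add_distrib, ← Finset.mul_sum,
      Finset.sum_sub_distrib, ← Finset.sum_mul, e1, e2, e3]
    simp only [Finset.sum_const, Finset.card_univ, Fintype.card_fin, nsmul_eq_mul, mul_one]
    rw [hκ]; ring
  have hadd : ∀ X X' W, ric (X + X') W = ric X W + ric X' W := by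
    intro X X' W
    simp only [ric, (h.bilin₂₃ _).add_left, map_add, add_apply, Finset.sum_add_distrib]
  have hadd' : ∀ X W W', ric X (W + W') = ric X W + ric X W' := by
    intro X W W'
    simp only [ric, map_add, Finset.sum_add_distrib]
  have hpol : ∀ W, η W = 0 → ric X W = - κ * b X W := by
    intro W hW
    have h1 := hdiag (X + W) (by simp [hX, hW])
    rw [hadd, hadd', hadd', hdiag X hX, hdiag W hW, hsymm W X] at h1
    simp only [map_add, add_apply, hs W X] at h1
    linarith
  -- Polarisation covers only horizontal second arguments; the mixed term with `ξ` is computed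
  -- separately from `R(X, Y)ξ`.
  have hξ : ric X ξ = 0 := by
    have h1 : ∀ i, b (R (o i) X (o i)) ξ = b ξ (o i) * b X (o i) := by
      intro i
      rw [h.skew, h.curv_xi, hX, hs ξ, hc.form_xi]
      simp
    simp only [ric, h1]
    rw [ho.parseval, hc.form_xi, hX]
  refine hc.scalarProduct.ext fun W => ?_
  have h1 : b (∑ i, R (o i) X (o i)) W = ric X W := by
    simp only [ric, map_sum, sum_apply]
  rw [h1]
  have hW : W = (W - η W • ξ) + η W • ξ := by abel
  have h2 : ric X (η W • ξ) = 0 := by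
    have : ric X (η W • ξ) = η W * ric X ξ := by
      simp only [ric, map_smul, smul_eq_mul, Finset.mul_sum]
    rw [this, hξ, mul_zero]
  conv_lhs => rw [hW, hadd', h2, add_zero, hpol _ (by simp [hc.eta_xi])]
  simp [hc.form_xi, hX]

end Ricci

/-! ### Covariant derivatives of endomorphism fields -/

section CovariantEndomorphism

variable {K : Type*} [NormedAddCommGroup K] [NormedSpace ℝ K]

/-- The covariant derivative of an endomorphism field. -/
def covEnd (θ : K → K →L[ℝ] K →L[ℝ] K) (Φ : K → K →L[ℝ] K) (z X Y : K) : K :=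
  fderiv ℝ Φ z X Y + θ z X (Φ z Y) - Φ z (θ z X Y)

variable {θ : K → K →L[ℝ] K →L[ℝ] K} {Φ : K → K →L[ℝ] K} {z : K}

theorem covD_apply_end (hΦ : DifferentiableAt ℝ Φ z) {V : K → K} (hV : DifferentiableAt ℝ V z)
    (X : K) : covD θ (fun y => Φ y (V y)) z X = covEnd θ Φ z X (V z) + Φ z (covD θ V z X) := by
  rw [covD_apply, fderiv_apply₁ hΦ hV, covEnd, covD_apply, map_add]
  abel

theorem covD_const (Y z X : K) : covD θ (fun _ => Y) z X = θ z X Y := by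
  simp [covD_apply]

theorem covD_fun_smul {f : K → ℝ} (hf : DifferentiableAt ℝ f z) {V : K → K}
    (hV : DifferentiableAt ℝ V z) (X : K) :
    covD θ (fun y => f y • V y) z X = fderiv ℝ f z X • V z + f z • covD θ V z X := by
  simp only [covD_apply, fderiv_fun_smul hf hV, add_apply, smul_apply, map_smul,
    ContinuousLinearMap.smulRight_apply, smul_add]
  abel

theorem isBilin_curvForm₁₂ (θ : K → K →L[ℝ] K →L[ℝ] K) (z Z : K) :
    IsBilin fun X Y => curvForm θ z X Y Z := by
  constructor
  · intro u u' v; simp only [curvForm, map_add, add_apply]; abel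
  · intro r u v; simp only [curvForm, map_smul, smul_apply, smul_add, smul_sub]
  · intro u v v'; simp only [curvForm, map_add, add_apply]; abel
  · intro r u v; simp only [curvForm, map_smul, smul_apply, smul_add, smul_sub]

theorem isBilin_curvForm₂₃ (θ : K → K →L[ℝ] K →L[ℝ] K) (z X : K) :
    IsBilin (curvForm θ z X) := by
  constructor
  · intro u u' v; simp only [curvForm, map_add, add_apply]; abel
  · intro r u v; simp only [curvForm, map_smul, smul_apply, smul_add, smul_sub]
  · intro u v v'; simp only [curvForm, map_add]; abel
  · intro r u v; simp only [curvForm, map_smul, smul_add, smul_sub]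

end CovariantEndomorphism

/-! ### Sasakian structures on open subsets of a vector space -/

section FlatSasakian

variable {K : Type*} [NormedAddCommGroup K] [NormedSpace ℝ K]

/-- A Sasakian structure on an open subset of a vector space, expressed through constant fields. -/
structure IsSasakianOn (U : Set K) (G : K → K →L[ℝ] K →L[ℝ] ℝ) (Φ : K → K →L[ℝ] K) (ξ : K → K)
    (η : K → K →L[ℝ] ℝ) : Prop where
  isOpen : IsOpen U
  smooth_G : ∀ z ∈ U, ContDiffAt ℝ ∞ G z
  smooth_phi : ∀ z ∈ U, ContDiffAt ℝ ∞ Φ z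
  smooth_xi : ∀ z ∈ U, ContDiffAt ℝ ∞ ξ z
  smooth_eta : ∀ z ∈ U, ContDiffAt ℝ ∞ η z
  almostContact : ∀ z ∈ U, IsAlmostContact (G z) (Φ z) (ξ z) (η z)
  contact : ∀ z ∈ U, ∀ X Y,
    G z X (Φ z Y) = 1 / 2 * (fderiv ℝ η z X Y - fderiv ℝ η z Y X)
  nijenhuis : ∀ z ∈ U, ∀ X Y, fderiv ℝ Φ z (Φ z X) Y - fderiv ℝ Φ z (Φ z Y) X
    + Φ z (fderiv ℝ Φ z Y X) - Φ z (fderiv ℝ Φ z X Y) + (2 * G z X (Φ z Y)) • ξ z = 0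

namespace IsSasakianOn

variable {U : Set K} {G : K → K →L[ℝ] K →L[ℝ] ℝ} {Φ : K → K →L[ℝ] K}
  {ξ : K → K} {η : K → K →L[ℝ] ℝ} {z : K}

theorem eventually (h : IsSasakianOn U G Φ ξ η) (hz : z ∈ U) : ∀ᶠ y in 𝓝 z, y ∈ U :=
  h.isOpen.mem_nhds hz

theorem eventually_scalarProduct (h : IsSasakianOn U G Φ ξ η) (hz : z ∈ U) :
    ∀ᶠ y in 𝓝 z, IsScalarProduct (G y) := by
  filter_upwards [h.eventually hz] with y hy using (h.almostContact y hy).scalarProduct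

variable [FiniteDimensional ℝ K]

theorem smooth_conn (h : IsSasakianOn U G Φ ξ η) (hz : z ∈ U) : ContDiffAt ℝ ∞ (lcConn G) z :=
  contDiffAt_lcConn (h.almostContact z hz).scalarProduct (h.smooth_G z hz)

theorem compat (h : IsSasakianOn U G Φ ξ η) (hz : z ∈ U) (u a b : K) :
    fderiv ℝ G z u a b = G z (lcConn G z u a) b + G z a (lcConn G z u b) :=
  lcConn_compat (h.eventually_scalarProduct hz) (h.smooth_G z hz).diff u a b

theorem conn_symm (h : IsSasakianOn U G Φ ξ η) (hz : z ∈ U) (u v : K) :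
    lcConn G z u v = lcConn G z v u :=
  lcConn_symm (h.eventually_scalarProduct hz) (h.smooth_G z hz).diff u v

theorem fderiv_form (h : IsSasakianOn U G Φ ξ η) (hz : z ∈ U) {X Y : K → K}
    (hX : DifferentiableAt ℝ X z) (hY : DifferentiableAt ℝ Y z) (u : K) :
    fderiv ℝ (fun y => G y (X y) (Y y)) z u
      = G z (covD (lcConn G) X z u) (Y z) + G z (X z) (covD (lcConn G) Y z u) :=
  fderiv_form_covD (h.smooth_G z hz).diff (h.compat hz u) hX hY

/-- The covariant derivative of the contact form. -/
theorem fderiv_eta (h : IsSasakianOn U G Φ ξ η) (hz : z ∈ U) (X Y : K) :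
    fderiv ℝ η z X Y = η z (lcConn G z X Y) + G z (covD (lcConn G) ξ z X) Y := by
  have hc := h.almostContact z hz
  have h1 : (fun y => η y Y) =ᶠ[𝓝 z] fun y => G y Y (ξ y) := by
    filter_upwards [h.eventually hz] with y hy using ((h.almostContact y hy).form_xi Y).symm
  rw [← fderiv_apply_const (h.smooth_eta z hz).diff, h1.fderiv_eq,
    h.fderiv_form hz (differentiableAt_const Y) (h.smooth_xi z hz).diff, covD_const, hc.form_xi,
    hc.scalarProduct.symm Y]

/-- Each identity is the derivative of a structure equation: skewness of `φ`, `|ξ|² = 1`, `φξ = 0`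
and `φ² = -1 + η ⊗ ξ`. The contact and Nijenhuis conditions are rewritten with the torsion-free
connection, and the cyclic identity is `d(dη) = 0`. -/
theorem isNormalDeriv (h : IsSasakianOn U G Φ ξ η) (hz : z ∈ U) :
    IsAlmostContact.IsNormalDeriv (G z) (Φ z) (ξ z) (η z) (covD (lcConn G) ξ z) (covEnd (lcConn G) Φ z) := by
  have hc := h.almostContact z hz
  have hs := hc.scalarProduct.symm
  have hΦ := (h.smooth_phi z hz).diff
  have hΦY : ∀ Y, DifferentiableAt ℝ (fun y => Φ y Y) z := fun Y =>
    hΦ.clm_apply (differentiableAt_const Y)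
  have hcovΦ : ∀ X Y, covD (lcConn G) (fun y => Φ y Y) z X
      = covEnd (lcConn G) Φ z X Y + Φ z (lcConn G z X Y) := fun X Y => by
    rw [covD_apply_end hΦ (differentiableAt_const Y), covD_const]
  have hskew : ∀ X Y Z, G z (covEnd (lcConn G) Φ z X Y) Z
      = - G z (covEnd (lcConn G) Φ z X Z) Y := by
    intro X Y Z
    have h1 : (fun y => G y (Φ y Y) Z) =ᶠ[𝓝 z] fun y => - G y Y (Φ y Z) := by
      filter_upwards [h.eventually hz] with y hy using (h.almostContact y hy).form_phi_left Y Z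
    have h2 := congrArg (fun L => L X) (h1.fderiv_eq (𝕜 := ℝ))
    rw [fderiv_fun_neg, neg_apply, h.fderiv_form hz (hΦY Y) (differentiableAt_const Z),
      h.fderiv_form hz (differentiableAt_const Y) (hΦY Z), hcovΦ, hcovΦ, covD_const, covD_const,
      map_add, map_add, add_apply, hc.form_phi_left, hc.form_phi_left] at h2
    rw [hs (covEnd (lcConn G) Φ z X Z)]
    linarith
  refine ⟨fun X Y => map_add _ _ _, fun r X => map_smul _ _ _, hskew, fun X => ?_, fun X => ?_,
    fun X Y => ?_, fun X Y Z => ?_, fun X Y => ?_, fun X Y => ?_⟩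
  · have h1 : (fun y => G y (ξ y) (ξ y)) =ᶠ[𝓝 z] fun _ => (1 : ℝ) := by
      filter_upwards [h.eventually hz] with y hy
      rw [(h.almostContact y hy).form_xi, (h.almostContact y hy).eta_xi]
    have h2 := congrArg (fun L => L X) (h1.fderiv_eq (𝕜 := ℝ))
    rw [h.fderiv_form hz (h.smooth_xi z hz).diff (h.smooth_xi z hz).diff, hs (ξ z)] at h2
    simp only [fderiv_fun_const, Pi.zero_apply, zero_apply] at h2
    linarith
  · have h1 : (fun y => Φ y (ξ y)) =ᶠ[𝓝 z] fun _ => (0 : K) := by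
      filter_upwards [h.eventually hz] with y hy using (h.almostContact y hy).phi_xi
    have h2 := congrArg (fun L => L X) (covD_congr (θ := lcConn G) h1)
    rw [covD_apply_end hΦ (h.smooth_xi z hz).diff, covD_const, map_zero] at h2
    exact eq_neg_of_add_eq_zero_left h2
  · have h1 := h.contact z hz X Y
    rw [h.fderiv_eta hz, h.fderiv_eta hz, h.conn_symm hz Y X] at h1
    linarith
  -- The derivative of the contact condition. In the cyclic sum the second derivatives of `η` cancel
  -- by symmetry, and the connection terms cancel because the connection is symmetric.
  · have key : ∀ X Y Z, 2 * (G z (lcConn G z Z X) (Φ z Y) - G z (Φ z X) (lcConn G z Z Y)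
        - G z (covEnd (lcConn G) Φ z Z X) Y)
        = fderiv ℝ (fderiv ℝ η) z Z X Y - fderiv ℝ (fderiv ℝ η) z Z Y X := by
      intro X Y Z
      have h1 : (fun y => G y X (Φ y Y))
          =ᶠ[𝓝 z] fun y => 1 / 2 * (fderiv ℝ η y X Y - fderiv ℝ η y Y X) := by
        filter_upwards [h.eventually hz] with y hy using h.contact y hy X Y
      have hη := (h.smooth_eta z hz).smooth_fderiv.diff
      have hd : ∀ X Y, DifferentiableAt ℝ (fun y => fderiv ℝ η y X Y) z := fun X Y =>
        (hη.clm_apply (differentiableAt_const X)).clm_apply (differentiableAt_const Y)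
      have hdd : DifferentiableAt ℝ (fun y => fderiv ℝ η y X Y - fderiv ℝ η y Y X) z :=
        (hd X Y).sub (hd Y X)
      have h2 := congrArg (fun L => L Z) (h1.fderiv_eq (𝕜 := ℝ))
      rw [h.fderiv_form hz (differentiableAt_const X) (hΦY Y), covD_const, hcovΦ,
        fderiv_const_mul hdd, smul_apply,
        fderiv_fun_sub (hd X Y) (hd Y X), sub_apply, fderiv_apply_const₂ hη,
        fderiv_apply_const₂ hη, map_add, hs X, hskew Z Y X, smul_eq_mul] at h2
      have h3 := hc.form_phi_left X (lcConn G z Z Y)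
      linarith
    have k1 := key X Y Z
    have k2 := key Y Z X
    have k3 := key Z X Y
    have s1 := congrArg (fun L => L X) ((h.smooth_eta z hz).second_symm Z Y)
    have s2 := congrArg (fun L => L Y) ((h.smooth_eta z hz).second_symm X Z)
    have s3 := congrArg (fun L => L Z) ((h.smooth_eta z hz).second_symm Y X)
    rw [hs (Φ z X), h.conn_symm hz Z Y] at k1
    rw [hs (Φ z Y), h.conn_symm hz X Z] at k2
    rw [hs (Φ z Z), h.conn_symm hz Y X] at k3
    linarith
  · have h1 := h.nijenhuis z hz X Y
    rw [← h1]
    simp only [covEnd, map_add, map_sub]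
    rw [h.conn_symm hz (Φ z X) (Φ z Y), h.conn_symm hz Y X, h.conn_symm hz (Φ z X) Y,
      h.conn_symm hz (Φ z Y) X]
    abel
  · have h1 : (fun y => Φ y (Φ y Y)) =ᶠ[𝓝 z] fun y => -Y + η y Y • ξ y := by
      filter_upwards [h.eventually hz] with y hy using (h.almostContact y hy).phi_phi Y
    have h2 := congrArg (fun L => L X) (covD_congr (θ := lcConn G) h1)
    have hηY : DifferentiableAt ℝ (fun y => η y Y) z :=
      (h.smooth_eta z hz).diff.clm_apply (differentiableAt_const Y)
    have hηξ : DifferentiableAt ℝ (fun y => η y Y • ξ y) z := hηY.smul (h.smooth_xi z hz).diff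
    rw [covD_apply_end hΦ (hΦY Y), hcovΦ, covD_add (differentiableAt_const _) hηξ, covD_const, covD_fun_smul hηY (h.smooth_xi z hz).diff,
      fderiv_apply_const (h.smooth_eta z hz).diff, h.fderiv_eta hz, map_add, hc.phi_phi,
      map_neg, add_smul] at h2
    have h3 : covEnd (lcConn G) Φ z X (Φ z Y) + Φ z (covEnd (lcConn G) Φ z X Y)
        = (covEnd (lcConn G) Φ z X (Φ z Y) + (Φ z (covEnd (lcConn G) Φ z X Y)
          + (-lcConn G z X Y + η z (lcConn G z X Y) • ξ z)))
          - (-lcConn G z X Y + η z (lcConn G z X Y) • ξ z) := by abel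
    rw [h3, h2]
    abel

theorem covD_xi (h : IsSasakianOn U G Φ ξ η) (hz : z ∈ U) (X : K) :
    covD (lcConn G) ξ z X = - Φ z X :=
  (h.almostContact z hz).deriv_xi (h.isNormalDeriv hz) X

theorem covEnd_phi (h : IsSasakianOn U G Φ ξ η) (hz : z ∈ U) (X Y : K) :
    covEnd (lcConn G) Φ z X Y = G z X Y • ξ z - η z Y • X :=
  (h.almostContact z hz).deriv_phi (h.isNormalDeriv hz) X Y

/-- Because `∇ξ = -φ`, the commutator of covariant derivatives on `ξ` is minus the alternation of
the known expression for `∇φ`. -/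
theorem curv_xi (h : IsSasakianOn U G Φ ξ η) (hz : z ∈ U) (X Y : K) :
    curvForm (lcConn G) z X Y (ξ z) = η z Y • X - η z X • Y := by
  have hs := (h.almostContact z hz).scalarProduct.symm
  have h1 := covD_comm (h.smooth_conn hz) (h.smooth_xi z hz) (differentiableAt_const X)
    (differentiableAt_const Y)
  have hΦ := (h.smooth_phi z hz).diff
  have key : ∀ X Y, covD (lcConn G) (fun y => covD (lcConn G) ξ y Y) z X
      = - (G z X Y • ξ z - η z Y • X + Φ z (lcConn G z X Y)) := by
    intro X Y
    have hev : (fun y => covD (lcConn G) ξ y Y) =ᶠ[𝓝 z] fun y => (-1 : ℝ) • Φ y Y := by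
      filter_upwards [h.eventually hz] with y hy
      rw [h.covD_xi hy, neg_one_smul]
    rw [covD_congr hev, covD_smul _ (hΦ.clm_apply (differentiableAt_const Y)),
      covD_apply_end hΦ (differentiableAt_const Y), covD_const, h.covEnd_phi hz, neg_one_smul]
  simp only [fderiv_fun_const, Pi.zero_apply, zero_apply, sub_self, map_zero, add_zero] at h1
  rw [← h1, key, key, hs Y X, h.conn_symm hz Y X]
  abel

/-- The commutator of covariant derivatives is taken on `φZ` and on the constant field `Z`. Their
difference is the alternated second derivative of `φ`, found by differentiating the formula for `∇φ`
and using `∇ξ = -φ`. -/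
theorem curv_phi (h : IsSasakianOn U G Φ ξ η) (hz : z ∈ U) (X Y Z : K) :
    curvForm (lcConn G) z X Y (Φ z Z) = Φ z (curvForm (lcConn G) z X Y Z) - G z Y Z • Φ z X
      + G z X Z • Φ z Y + G z Z (Φ z X) • Y - G z Z (Φ z Y) • X := by
  have hc := h.almostContact z hz
  have hs := hc.scalarProduct.symm
  have hΦs := h.smooth_phi z hz
  have hΦ := hΦs.diff
  have hξ := (h.smooth_xi z hz).diff
  have hcon := h.smooth_conn hz
  have hconV : ∀ Y Z, DifferentiableAt ℝ (fun y => lcConn G y Y Z) z := fun Y Z =>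
    (hcon.diff.clm_apply (differentiableAt_const Y)).clm_apply (differentiableAt_const Z)
  have hηZ : DifferentiableAt ℝ (fun y => η y Z) z :=
    (h.smooth_eta z hz).diff.clm_apply (differentiableAt_const Z)
  have hG : ∀ Y, DifferentiableAt ℝ (fun y => G y Y Z) z := fun Y =>
    ((h.smooth_G z hz).diff.clm_apply (differentiableAt_const Y)).clm_apply
      (differentiableAt_const Z)
  have h1 := covD_comm hcon (hΦs.clm_apply (contDiffAt_const (c := Z)))
    (differentiableAt_const X) (differentiableAt_const Y)
  have h0 := covD_comm hcon (contDiffAt_const (c := Z) (x := z))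
    (differentiableAt_const X) (differentiableAt_const Y)
  simp only [fderiv_fun_const, Pi.zero_apply, zero_apply, sub_self, map_zero, add_zero,
    covD_const] at h0 h1
  have key : ∀ X Y, covD (lcConn G) (fun y => covD (lcConn G) (fun x => Φ x Z) y Y) z X
      = (G z (lcConn G z X Y) Z + G z Y (lcConn G z X Z)) • ξ z - G z Y Z • Φ z X
        - ((η z (lcConn G z X Z) - G z (Φ z X) Z) • Y + η z Z • lcConn G z X Y)
        + (G z X (lcConn G z Y Z) • ξ z - η z (lcConn G z Y Z) • X
          + Φ z (covD (lcConn G) (fun y => lcConn G y Y Z) z X)) := by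
    intro X Y
    have hev : (fun y => covD (lcConn G) (fun x => Φ x Z) y Y)
        =ᶠ[𝓝 z] fun y => (G y Y Z • ξ y - η y Z • Y) + Φ y (lcConn G y Y Z) := by
      filter_upwards [h.eventually hz] with y hy
      rw [covD_apply_end (h.smooth_phi y hy).diff (differentiableAt_const Z), covD_const,
        h.covEnd_phi hy]
    have hA : DifferentiableAt ℝ (fun y => G y Y Z • ξ y) z := (hG Y).smul hξ
    have hB : DifferentiableAt ℝ (fun y => η y Z • Y) z := hηZ.smul (differentiableAt_const Y)
    have hAB : DifferentiableAt ℝ (fun y => G y Y Z • ξ y - η y Z • Y) z := hA.sub hB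
    have hC : DifferentiableAt ℝ (fun y => Φ y (lcConn G y Y Z)) z := hΦ.clm_apply (hconV Y Z)
    rw [covD_congr hev, covD_add hAB hC, covD_sub hA hB,
      covD_fun_smul (hG Y) hξ, covD_fun_smul hηZ (differentiableAt_const Y),
      h.fderiv_form hz (differentiableAt_const Y) (differentiableAt_const Z),
      fderiv_apply_const (h.smooth_eta z hz).diff, h.fderiv_eta hz,
      covD_apply_end hΦ (hconV Y Z), h.covEnd_phi hz, h.covD_xi hz, covD_const, covD_const,
      map_neg, neg_apply, smul_neg, ← sub_eq_add_neg, ← sub_eq_add_neg]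
  rw [← h1, key, key, ← h0, map_sub, h.conn_symm hz Y X, hs Z (Φ z X), hs Z (Φ z Y),
    hs Y (lcConn G z X Z), hs X (lcConn G z Y Z)]
  module

/-- The curvature of a flat Sasakian structure with constant `φ`-sectional curvature. -/
theorem isSasakianCurvature (h : IsSasakianOn U G Φ ξ η) (hz : z ∈ U) {c : ℝ}
    (hsec : ∀ X, G z X X = 1 → G z X (ξ z) = 0 →
      G z (curvForm (lcConn G) z X (Φ z X) (Φ z X)) X = c) :
    IsSasakianCurvature (G z) (Φ z) (ξ z) (η z) (curvForm (lcConn G) z) c where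
  contact := h.almostContact z hz
  bilin₁₂ := isBilin_curvForm₁₂ _ z
  bilin₂₃ := isBilin_curvForm₂₃ _ z
  swap := curvForm_swap z
  skew X Y Z W := by
    rw [curvForm_skew (h.smooth_G z hz) (h.smooth_conn hz)
      (by filter_upwards [h.eventually hz] with y hy using h.compat hy),
      (h.almostContact z hz).scalarProduct.symm]
  bianchi := curvForm_bianchi (h.smooth_conn hz).diff
    (by filter_upwards [h.eventually hz] with y hy using h.conn_symm hy)
  curv_xi := h.curv_xi hz
  curv_phi := h.curv_phi hz
  phi_sectional := hsec

end IsSasakianOn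

end FlatSasakian

/-! ### Vector fields and derivatives in preferred charts -/

section ChartDerivative

variable {k : ℕ} {N : Type*} [TopologicalSpace N] [ChartedSpace (Euc k) N]

/-- The derivative at `p` of the preferred chart around `y`. -/
def chartD (y p : N) : Euc k →L[ℝ] Euc k :=
  mfderiv (𝓡 k) 𝓘(ℝ, Euc k) (extChartAt (𝓡 k) y) p

/-- The derivative of a vector-valued function. -/
def funD {F : Type*} [NormedAddCommGroup F] [NormedSpace ℝ F] (h : N → F) (p : N) :
    Euc k →L[ℝ] F :=
  mfderiv (𝓡 k) 𝓘(ℝ, F) h p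

/-- The derivative of a map, on model spaces. -/
def mapD {m : ℕ} {M : Type*} [TopologicalSpace M] [ChartedSpace (Euc m) M] (f : M → N) (x : M) :
    Euc m →L[ℝ] Euc k :=
  mfderiv (𝓡 m) (𝓡 k) f x

theorem coordField_eq (y : N) (v : Euc k) (p : N) : coordField y v p = (chartD y p).inverse v := rfl

variable {y p : N}

theorem mem_extChartAt_source_iff : p ∈ (extChartAt (𝓡 k) y).source ↔
    p ∈ (chartAt (Euc k) y).source := by
  rw [extChartAt_source]

variable [IsManifold (𝓡 k) ∞ N]

theorem isInvertible_chartD (hp : p ∈ (extChartAt (𝓡 k) y).source) : (chartD (k := k) y p).IsInvertible :=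
  isInvertible_mfderiv_extChartAt hp

/-- The tangent space at `y` is the model space through the preferred chart at `y`. This is why
formulas at the base point carry no transition factors. -/
theorem chartD_self (y : N) : chartD y y = ContinuousLinearMap.id ℝ (Euc k) :=
  mfderiv_extChartAt_self

theorem coordField_self (y : N) (v : Euc k) : coordField y v y = v := by
  rw [coordField_eq, chartD_self, ContinuousLinearMap.inverse_id]; rfl

theorem chartD_coordField (hp : p ∈ (extChartAt (𝓡 k) y).source) (v : Euc k) :
    chartD y p (coordField y v p) = v :=
  (isInvertible_chartD hp).self_apply_inverse v

theorem contMDiffAt_chart (hp : p ∈ (extChartAt (𝓡 k) y).source) :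
    ContMDiffAt (𝓡 k) 𝓘(ℝ, Euc k) ∞ (extChartAt (𝓡 k) y) p :=
  contMDiffAt_extChartAt' (mem_extChartAt_source_iff.1 hp)

theorem contMDiffAt_chart_symm {z : Euc k} (hz : z ∈ (extChartAt (𝓡 k) y).target) :
    ContMDiffAt 𝓘(ℝ, Euc k) (𝓡 k) ∞ (extChartAt (𝓡 k) y).symm z :=
  (contMDiffOn_extChartAt_symm y).contMDiffAt ((isOpen_extChartAt_target y).mem_nhds hz)

/-- Smoothness of a vector field, read in a chart. -/
theorem contMDiffAt_field_iff (hp : p ∈ (extChartAt (𝓡 k) y).source)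
    (X : ∀ q : N, TangentSpace (𝓡 k) q) :
    FieldSmoothAt X p ↔ ContMDiffAt (𝓡 k) 𝓘(ℝ, Euc k) ∞ (fun q => chartD y q (X q)) p := by
  have hp' := mem_extChartAt_source_iff.1 hp
  unfold FieldSmoothAt
  rw [(trivializationAt (Euc k) (TangentSpace (𝓡 k)) y).contMDiffAt_section_iff (by simpa using hp')]
  refine Filter.EventuallyEq.contMDiffAt_iff ?_
  filter_upwards [(chartAt (Euc k) y).open_source.mem_nhds hp'] with q hq
  have h1 := TangentBundle.continuousLinearMapAt_trivializationAt (I := 𝓡 k) (𝕜 := ℝ) hq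
  have h2 : (trivializationAt (Euc k) (TangentSpace (𝓡 k)) y).continuousLinearMapAt ℝ q (X q)
    = chartD y q (X q) := congrArg (fun L => L (X q)) h1
  rw [← h2, Bundle.Trivialization.continuousLinearMapAt_apply_of_mem _ _ (by simpa using hq)]

theorem coordField_smooth (hp : p ∈ (extChartAt (𝓡 k) y).source) (v : Euc k) :
    FieldSmoothAt (coordField y v) p := by
  rw [contMDiffAt_field_iff hp]
  refine (contMDiffAt_const (c := v)).congr_of_eventuallyEq ?_
  filter_upwards [(isOpen_extChartAt_source y).mem_nhds hp] with q hq
  exact chartD_coordField hq v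

section VectorValued

variable {F : Type*} [NormedAddCommGroup F] [NormedSpace ℝ F]

theorem contDiffAt_comp_symm {h : N → F} {z : Euc k}
    (hz : z ∈ (extChartAt (𝓡 k) y).target)
    (hh : ContMDiffAt (𝓡 k) 𝓘(ℝ, F) ∞ h ((extChartAt (𝓡 k) y).symm z)) :
    ContDiffAt ℝ ∞ (h ∘ (extChartAt (𝓡 k) y).symm) z :=
  (hh.comp z (contMDiffAt_chart_symm hz)).contDiffAt

/-- The derivative of a function with known coordinate expression. -/
theorem hasMFDerivAt_of_chart {h : N → F} {ĥ : Euc k → F} (hp : p ∈ (extChartAt (𝓡 k) y).source)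
    (hev : ∀ᶠ q in 𝓝 p, h q = ĥ (extChartAt (𝓡 k) y q))
    (hd : DifferentiableAt ℝ ĥ (extChartAt (𝓡 k) y p)) :
    HasMFDerivAt (𝓡 k) 𝓘(ℝ, F) h p
      ((fderiv ℝ ĥ (extChartAt (𝓡 k) y p)).comp (chartD y p) : Euc k →L[ℝ] F) := by
  have h1 : HasMFDerivAt (𝓡 k) 𝓘(ℝ, Euc k) (extChartAt (𝓡 k) y) p (chartD y p) :=
    ((contMDiffAt_chart hp).mdifferentiableAt (by simp)).hasMFDerivAt
  have h2 := hd.hasFDerivAt.hasMFDerivAt.comp p h1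
  exact h2.congr_of_eventuallyEq hev

theorem funD_of_chart {h : N → F} {ĥ : Euc k → F} (hp : p ∈ (extChartAt (𝓡 k) y).source)
    (hev : ∀ᶠ q in 𝓝 p, h q = ĥ (extChartAt (𝓡 k) y q))
    (hd : DifferentiableAt ℝ ĥ (extChartAt (𝓡 k) y p)) (v : Euc k) :
    funD h p v = fderiv ℝ ĥ (extChartAt (𝓡 k) y p) (chartD y p v) := by
  rw [funD, (hasMFDerivAt_of_chart hp hev hd).mfderiv]; rfl

end VectorValued

/-- The change of coordinates between two preferred charts. -/
def chartChange (y y' : N) (z : Euc k) : Euc k :=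
  extChartAt (𝓡 k) y' ((extChartAt (𝓡 k) y).symm z)

variable {y' : N}

theorem contDiffAt_chartChange (hp : p ∈ (extChartAt (𝓡 k) y).source)
    (hp' : p ∈ (extChartAt (𝓡 k) y').source) :
    ContDiffAt ℝ ∞ (chartChange y y') (extChartAt (𝓡 k) y p) :=
  contDiffAt_comp_symm ((extChartAt (𝓡 k) y).map_source hp)
    (by rw [(extChartAt (𝓡 k) y).left_inv hp]; exact contMDiffAt_chart hp')

theorem chartD_change (hp : p ∈ (extChartAt (𝓡 k) y).source)
    (hp' : p ∈ (extChartAt (𝓡 k) y').source) (v : Euc k) :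
    chartD y' p v = fderiv ℝ (chartChange y y') (extChartAt (𝓡 k) y p) (chartD y p v) := by
  refine funD_of_chart (h := extChartAt (𝓡 k) y') hp ?_ (contDiffAt_chartChange hp hp').diff v
  filter_upwards [(isOpen_extChartAt_source y).mem_nhds hp] with q hq
  rw [chartChange, (extChartAt (𝓡 k) y).left_inv hq]

end ChartDerivative

/-! ### Metric, Christoffel symbols and curvature in a chart -/

section MetricInChart

variable {k : ℕ} {N : Type*} [TopologicalSpace N] [ChartedSpace (Euc k) N]

/-- On `U`, the coordinate expression of the field of forms `g` in the preferred chart around `y` is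
the smooth metric `G`. -/
structure IsMetricRep (g : ∀ p : N, TangentSpace (𝓡 k) p → TangentSpace (𝓡 k) p → ℝ) (y : N)
    (U : Set (Euc k)) (G : Euc k → Euc k →L[ℝ] Euc k →L[ℝ] ℝ) : Prop where
  isOpen : IsOpen U
  smooth : ∀ z ∈ U, ContDiffAt ℝ ∞ G z
  scalarProduct : ∀ z ∈ U, IsScalarProduct (G z)
  eq : ∀ z ∈ U, ∀ u w, metricInChart g y z u w = G z u w

namespace IsMetricRep

variable {g : ∀ p : N, TangentSpace (𝓡 k) p → TangentSpace (𝓡 k) p → ℝ} {y : N}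
  {U : Set (Euc k)} {G : Euc k → Euc k →L[ℝ] Euc k →L[ℝ] ℝ} {z : Euc k}

theorem eventually (h : IsMetricRep g y U G) (hz : z ∈ U) : ∀ᶠ z' in 𝓝 z, z' ∈ U :=
  h.isOpen.mem_nhds hz

theorem eventually_scalarProduct (h : IsMetricRep g y U G) (hz : z ∈ U) :
    ∀ᶠ z' in 𝓝 z, IsScalarProduct (G z') := by
  filter_upwards [h.eventually hz] with z' hz' using h.scalarProduct z' hz'

theorem smooth_conn (h : IsMetricRep g y U G) (hz : z ∈ U) : ContDiffAt ℝ ∞ (lcConn G) z :=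
  contDiffAt_lcConn (h.scalarProduct z hz) (h.smooth z hz)

theorem fderiv_metricInChart (h : IsMetricRep g y U G) (hz : z ∈ U) (t u w : Euc k) :
    fderiv ℝ (fun z' => metricInChart g y z' u w) z t = fderiv ℝ G z t u w := by
  have hev : (fun z' => metricInChart g y z' u w) =ᶠ[𝓝 z] fun z' => G z' u w := by
    filter_upwards [h.eventually hz] with z' hz' using h.eq z' hz' u w
  rw [hev.fderiv_eq, fderiv_apply_const₂ (h.smooth z hz).diff]

/-- Contraction with the inverse Gram matrix is the inverse of the metric operator, so the
coordinate formula solves the Koszul equation. -/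
theorem christoffel_eq (h : IsMetricRep g y U G) (hz : z ∈ U) (u w : Euc k) :
    christoffel g y z u w = lcConn G z u w := by
  have hs := h.scalarProduct z hz
  have hgram : gramInChart g y z = Matrix.of fun i j => G z (stdE k i) (stdE k j) := by
    ext i j; exact h.eq z hz _ _
  have h1 : christoffel g y z u w
      = traceIn (stdE k) (fun a b => G z a b) fun a b => (G z (lcConn G z u w) a) • b := by
    unfold christoffel traceIn
    rw [hgram]
    refine Finset.sum_congr rfl fun l _ => Finset.sum_congr rfl fun r _ => ?_
    rw [h.fderiv_metricInChart hz, h.fderiv_metricInChart hz, h.fderiv_metricInChart hz,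
      smul_smul, form_lcConn hs, fderiv_symm_form (h.eventually_scalarProduct hz)
        (h.smooth z hz).diff (stdE k l)]
    congr 1
    rw [fderiv_symm_form (h.eventually_scalarProduct hz) (h.smooth z hz).diff (stdE k l) w u]
    ring
  rw [h1]
  exact hs.ext fun t => form_traceIn_smul (isBilin_clm (G z)) hs.symm hs.pos (by simp) (by simp) t

theorem eventually_christoffel_eq (h : IsMetricRep g y U G) (hz : z ∈ U) (u w : Euc k) :
    (fun z' => christoffel g y z' u w) =ᶠ[𝓝 z] fun z' => lcConn G z' u w := by
  filter_upwards [h.eventually hz] with z' hz' using h.christoffel_eq hz' u w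

theorem curvature_eq {p : N} (h : IsMetricRep g p U G) (hz : extChartAt (𝓡 k) p p ∈ U)
    (u v w : Euc k) :
    curvature g p u v w = curvForm (lcConn G) (extChartAt (𝓡 k) p p) u v w := by
  have hd := (h.smooth_conn hz).diff
  show fderiv ℝ (fun z' => christoffel g p z' v w) (extChartAt (𝓡 k) p p) u
    - fderiv ℝ (fun z' => christoffel g p z' u w) (extChartAt (𝓡 k) p p) v
    + christoffel g p (extChartAt (𝓡 k) p p) u (christoffel g p (extChartAt (𝓡 k) p p) v w)
    - christoffel g p (extChartAt (𝓡 k) p p) v (christoffel g p (extChartAt (𝓡 k) p p) u w) = _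
  rw [(h.eventually_christoffel_eq hz v w).fderiv_eq, (h.eventually_christoffel_eq hz u w).fderiv_eq,
    fderiv_apply_const₂ hd, fderiv_apply_const₂ hd, h.christoffel_eq hz v w,
    h.christoffel_eq hz u w, h.christoffel_eq hz, h.christoffel_eq hz, curvForm]

end IsMetricRep

variable [IsManifold (𝓡 k) ∞ N]
  (γ : Bundle.ContMDiffRiemannianMetric (𝓡 k) ∞ (Euc k) (fun p : N => TangentSpace (𝓡 k) p))

/-- The field of bilinear forms of a Riemannian metric. -/
def metricForm (p : N) (u v : TangentSpace (𝓡 k) p) : ℝ := γ.inner p u v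

/-- A Riemannian metric at a point, on the model space. -/
def metricAt (p : N) : Euc k →L[ℝ] Euc k →L[ℝ] ℝ := γ.inner p

/-- The coordinate expression of a Riemannian metric in the preferred chart around `y`. -/
def metricRep (y : N) (z : Euc k) : Euc k →L[ℝ] Euc k →L[ℝ] ℝ :=
  (metricAt γ ((extChartAt (𝓡 k) y).symm z)).bilinearComp
    (chartD y ((extChartAt (𝓡 k) y).symm z)).inverse (chartD y ((extChartAt (𝓡 k) y).symm z)).inverse

variable {γ}

theorem contMDiffAt_metric_apply {X Y : ∀ q : N, TangentSpace (𝓡 k) q} {p : N}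
    (hX : FieldSmoothAt X p) (hY : FieldSmoothAt Y p) :
    ContMDiffAt (𝓡 k) 𝓘(ℝ, ℝ) ∞ (fun q => γ.inner q (X q) (Y q)) p := by
  have h1 := ContMDiffAt.clm_bundle_apply₂ (F₁ := Euc k) (F₂ := Euc k) (F₃ := ℝ)
    (E₃ := Bundle.Trivial N ℝ) (b := fun q : N => q) (x := p) γ.contMDiff.contMDiffAt hX hY
  rw [Bundle.contMDiffAt_totalSpace] at h1
  exact h1.2

theorem contDiffAt_clm {V W : Type*} [NormedAddCommGroup V] [NormedSpace ℝ V]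
    [NormedAddCommGroup W] [NormedSpace ℝ W] [FiniteDimensional ℝ V] {E : Type*}
    [NormedAddCommGroup E] [NormedSpace ℝ E] {A : E → V →L[ℝ] W} {U : Set E} (hU : IsOpen U)
    (h : ∀ z ∈ U, ∀ v, ContDiffAt ℝ ∞ (fun y => A y v) z) {z : E} (hz : z ∈ U) :
    ContDiffAt ℝ ∞ A z := by
  have : ContDiffOn ℝ ∞ A U :=
    contDiffOn_clm_apply.2 fun v y hy => (h y hy v).contDiffWithinAt
  exact this.contDiffAt (hU.mem_nhds hz)

theorem isScalarProduct_metricAt (p : N) : IsScalarProduct (metricAt γ p) :=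
  ⟨fun u v => γ.symm p u v, fun u hu => γ.pos p u hu⟩

theorem smooth_metricRep {y : N} {z : Euc k} (hz : z ∈ (extChartAt (𝓡 k) y).target) :
    ContDiffAt ℝ ∞ (metricRep γ y) z := by
  refine contDiffAt_clm (isOpen_extChartAt_target y) (fun z hz u => ?_) hz
  refine contDiffAt_clm (isOpen_extChartAt_target y) (fun z hz w => ?_) hz
  have hp := (extChartAt (𝓡 k) y).map_target hz
  have := contDiffAt_comp_symm hz
    (contMDiffAt_metric_apply (γ := γ) (coordField_smooth hp u) (coordField_smooth hp w))
  exact this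

theorem isScalarProduct_metricRep {y : N} {z : Euc k} (hz : z ∈ (extChartAt (𝓡 k) y).target) :
    IsScalarProduct (metricRep γ y z) := by
  have hp := (extChartAt (𝓡 k) y).map_target hz
  have hs := isScalarProduct_metricAt (γ := γ) ((extChartAt (𝓡 k) y).symm z)
  refine ⟨fun u v => hs.symm _ _, fun u hu => hs.pos _ fun h0 => hu ?_⟩
  exact ((isInvertible_chartD hp).self_apply_inverse u).symm.trans
    ((congrArg (chartD y _) h0).trans (map_zero _))

theorem isMetricRep_metricRep (y : N) :
    IsMetricRep (metricForm γ) y (extChartAt (𝓡 k) y).target (metricRep γ y) :=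
  ⟨isOpen_extChartAt_target y, fun _ hz => smooth_metricRep hz,
    fun _ hz => isScalarProduct_metricRep hz, fun _ _ _ _ => rfl⟩

/-- The coordinate expression of the metric, at a point of the chart. -/
theorem metricRep_chartD {y p : N} (hp : p ∈ (extChartAt (𝓡 k) y).source) (u w : Euc k) :
    metricRep γ y (extChartAt (𝓡 k) y p) (chartD y p u) (chartD y p w) = metricAt γ p u w := by
  unfold metricRep
  rw [(extChartAt (𝓡 k) y).left_inv hp]
  show metricAt γ p ((chartD y p).inverse (chartD y p u)) ((chartD y p).inverse (chartD y p w)) = _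
  rw [(isInvertible_chartD hp).inverse_apply_self, (isInvertible_chartD hp).inverse_apply_self]

end MetricInChart

/-! ### Maps and the pulled-back connection in charts -/

section MapInCharts

variable {m k : ℕ} {M : Type*} [TopologicalSpace M] [ChartedSpace (Euc m) M]
  {N : Type*} [TopologicalSpace N] [ChartedSpace (Euc k) N]

/-- The set of coordinates on which the coordinate expression of `f` is meaningful. -/
def flatDom (f : M → N) (x₀ : M) : Set (Euc m) :=
  (extChartAt (𝓡 m) x₀).target ∩
    (extChartAt (𝓡 m) x₀).symm ⁻¹' (f ⁻¹' (extChartAt (𝓡 k) (f x₀)).source)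

/-- The coordinate expression of `f` in the preferred charts around `x₀` and `f x₀`. -/
def flatMap (f : M → N) (x₀ : M) (z : Euc m) : Euc k :=
  extChartAt (𝓡 k) (f x₀) (f ((extChartAt (𝓡 m) x₀).symm z))

/-- The derivative of the coordinate expression of `f`. -/
def flatJ (f : M → N) (x₀ : M) : Euc m → Euc m →L[ℝ] Euc k := fderiv ℝ (flatMap f x₀)

/-- The point `x` lies in the chart around `x₀`, and `f x` in the chart around `f x₀`. -/
structure NearBase (f : M → N) (x₀ x : M) : Prop where
  dom : x ∈ (extChartAt (𝓡 m) x₀).source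
  cod : f x ∈ (extChartAt (𝓡 k) (f x₀)).source

variable {f : M → N} {x₀ x : M}

theorem NearBase.self : NearBase (m := m) (k := k) f x x :=
  ⟨mem_extChartAt_source x, mem_extChartAt_source (f x)⟩

theorem NearBase.mem_flatDom (h : NearBase (m := m) (k := k) f x₀ x) :
    extChartAt (𝓡 m) x₀ x ∈ flatDom (m := m) (k := k) f x₀ := by
  refine ⟨(extChartAt (𝓡 m) x₀).map_source h.dom, ?_⟩
  simp only [Set.mem_preimage]
  rw [(extChartAt (𝓡 m) x₀).left_inv h.dom]
  exact h.cod

theorem nearBase_symm {z : Euc m} (hz : z ∈ flatDom (m := m) (k := k) f x₀) :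
    NearBase (m := m) (k := k) f x₀ ((extChartAt (𝓡 m) x₀).symm z) :=
  ⟨(extChartAt (𝓡 m) x₀).map_target hz.1, hz.2⟩

theorem NearBase.flatMap_eq (h : NearBase (m := m) (k := k) f x₀ x) :
    flatMap (k := k) f x₀ (extChartAt (𝓡 m) x₀ x) = extChartAt (𝓡 k) (f x₀) (f x) := by
  rw [flatMap, (extChartAt (𝓡 m) x₀).left_inv h.dom]

theorem flatMap_mem_target {z : Euc m} (hz : z ∈ flatDom (m := m) (k := k) f x₀) :
    flatMap f x₀ z ∈ (extChartAt (𝓡 k) (f x₀)).target :=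
  (extChartAt (𝓡 k) (f x₀)).map_source hz.2

theorem NearBase.eventually (h : NearBase (m := m) (k := k) f x₀ x) (hf : ContinuousAt f x) :
    ∀ᶠ x' in 𝓝 x, NearBase (m := m) (k := k) f x₀ x' := by
  filter_upwards [(isOpen_extChartAt_source x₀).mem_nhds h.dom,
    hf.preimage_mem_nhds ((isOpen_extChartAt_source (f x₀)).mem_nhds h.cod)] with x' h1 h2
    using ⟨h1, h2⟩

theorem isOpen_flatDom (hf : Continuous f) : IsOpen (flatDom (m := m) (k := k) f x₀) :=
  (continuousOn_extChartAt_symm x₀).isOpen_inter_preimage (isOpen_extChartAt_target x₀)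
    ((isOpen_extChartAt_source (f x₀)).preimage hf)

variable [IsManifold (𝓡 k) ∞ N] (γ : Bundle.ContMDiffRiemannianMetric (𝓡 k) ∞ (Euc k)
  (fun p : N => TangentSpace (𝓡 k) p))

/-- The covariant derivative along `f`, on model spaces. -/
def covAt (f : M → N) (V : M → Euc k) (x : M) (v : Euc m) : Euc k :=
  covAlong m (metricForm γ) f V x v

theorem covAt_eq (V : M → Euc k) (v : Euc m) :
    covAt γ f V x v = funD (fun x' => chartD (f x) (f x') (V x')) x v
      + christoffel (metricForm γ) (f x) (extChartAt (𝓡 k) (f x) (f x)) (mapD f x v) (V x) := rfl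

variable {γ} [IsManifold (𝓡 m) ∞ M]

theorem contDiffAt_flatMap (hf : ContMDiff (𝓡 m) (𝓡 k) ∞ f) {z : Euc m}
    (hz : z ∈ flatDom (m := m) (k := k) f x₀) :
    ContDiffAt ℝ ∞ (flatMap (m := m) (k := k) f x₀) z :=
  contDiffAt_comp_symm (h := fun x => extChartAt (𝓡 k) (f x₀) (f x)) hz.1
    ((contMDiffAt_chart hz.2).comp _ hf.contMDiffAt)

theorem contDiffAt_flatJ (hf : ContMDiff (𝓡 m) (𝓡 k) ∞ f) {z : Euc m}
    (hz : z ∈ flatDom (m := m) (k := k) f x₀) :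
    ContDiffAt ℝ ∞ (flatJ (m := m) (k := k) f x₀) z :=
  (contDiffAt_flatMap hf hz).smooth_fderiv

theorem NearBase.chartD_mapD (h : NearBase (m := m) (k := k) f x₀ x)
    (hf : ContMDiff (𝓡 m) (𝓡 k) ∞ f) (v : Euc m) :
    chartD (k := k) (f x₀) (f x) (mapD f x v)
      = flatJ f x₀ (extChartAt (𝓡 m) x₀ x) (chartD x₀ x v) := by
  have h1 := funD_of_chart (h := fun x' => extChartAt (𝓡 k) (f x₀) (f x')) h.dom
    (by filter_upwards [h.eventually hf.continuous.continuousAt] with q hq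
          using hq.flatMap_eq.symm) (contDiffAt_flatMap hf h.mem_flatDom).diff v
  have h2 := mfderiv_comp_apply x ((contMDiffAt_chart h.cod).mdifferentiableAt (by simp))
    (hf.mdifferentiableAt (by simp)) v
  exact h2.symm.trans h1

theorem injective_flatJ (hf : ContMDiff (𝓡 m) (𝓡 k) ∞ f)
    (hinj : ∀ x, Function.Injective (mapD (m := m) (k := k) f x)) {z : Euc m}
    (hz : z ∈ flatDom (m := m) (k := k) f x₀) :
    Function.Injective (flatJ (m := m) (k := k) f x₀ z) := by
  have h := nearBase_symm hz
  have hC := isInvertible_chartD h.dom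
  rw [← (extChartAt (𝓡 m) x₀).right_inv hz.1]
  intro u u' huu
  rw [← hC.self_apply_inverse u, ← hC.self_apply_inverse u', ← h.chartD_mapD hf,
    ← h.chartD_mapD hf] at huu
  exact hC.inverse.injective (hinj _ ((isInvertible_chartD h.cod).injective huu))

variable (γ) in
/-- The metric of the ambient manifold along `f`, in charts. -/
def flatMet (f : M → N) (x₀ : M) (z : Euc m) : Euc k →L[ℝ] Euc k →L[ℝ] ℝ :=
  metricRep γ (f x₀) (flatMap f x₀ z)

variable (γ) in
/-- The pulled-back Levi-Civita connection, in charts. -/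
def flatConn (f : M → N) (x₀ : M) (z : Euc m) : Euc m →L[ℝ] Euc k →L[ℝ] Euc k :=
  (lcConn (metricRep γ (f x₀)) (flatMap f x₀ z)).comp (flatJ f x₀ z)

/-- Compatibility is the chain rule applied to a metric connection. Torsion-freeness combines the
symmetry of the Hessian of the coordinate expression with the symmetry of the Levi-Civita form. -/
theorem isSoldered (hf : ContMDiff (𝓡 m) (𝓡 k) ∞ f)
    (hinj : ∀ x, Function.Injective (mapD (m := m) (k := k) f x)) (x₀ : M) :
    IsSoldered (flatDom (m := m) (k := k) f x₀) (flatMet γ f x₀) (flatConn γ f x₀)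
      (flatJ f x₀) where
  isOpen := isOpen_flatDom hf.continuous
  smooth_g z hz := (smooth_metricRep (flatMap_mem_target hz)).comp z (contDiffAt_flatMap hf hz)
  smooth_conn z hz := ((contDiffAt_lcConn (isScalarProduct_metricRep (flatMap_mem_target hz))
    (smooth_metricRep (flatMap_mem_target hz))).comp z (contDiffAt_flatMap hf hz)).clm_comp
      (contDiffAt_flatJ hf hz)
  smooth_J z hz := contDiffAt_flatJ hf hz
  scalarProduct z hz := isScalarProduct_metricRep (flatMap_mem_target hz)
  injective z hz := injective_flatJ hf hinj hz
  compat z hz u a b := by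
    have hs := (isMetricRep_metricRep (γ := γ) (f x₀)).eventually_scalarProduct
      (flatMap_mem_target hz)
    have hG := (smooth_metricRep (γ := γ) (flatMap_mem_target hz)).diff
    have h1 : fderiv ℝ (flatMet γ f x₀) z u
        = fderiv ℝ (metricRep γ (f x₀)) (flatMap f x₀ z) (flatJ f x₀ z u) := by
      have := fderiv_comp z hG (contDiffAt_flatMap hf hz).diff
      exact congrArg (fun L => L u) this
    rw [h1, lcConn_compat hs hG]
    rfl
  torsion z hz u v := by
    have hs := (isMetricRep_metricRep (γ := γ) (f x₀)).eventually_scalarProduct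
      (flatMap_mem_target hz)
    have hG := (smooth_metricRep (γ := γ) (flatMap_mem_target hz)).diff
    rw [flatJ, (contDiffAt_flatMap hf hz).second_symm]
    exact congrArg _ (lcConn_symm hs hG _ _)

/-- The metric is preserved by changes of coordinates. -/
theorem metricRep_change {y y' : N} {w : Euc k} (hw : w ∈ (extChartAt (𝓡 k) y).target)
    (hw' : (extChartAt (𝓡 k) y).symm w ∈ (extChartAt (𝓡 k) y').source) (u v : Euc k) :
    metricRep γ y w u v = metricRep γ y' (chartChange y y' w)
      (fderiv ℝ (chartChange y y') w u) (fderiv ℝ (chartChange y y') w v) := by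
  set p := (extChartAt (𝓡 k) y).symm w with hp
  have hps : p ∈ (extChartAt (𝓡 k) y).source := (extChartAt (𝓡 k) y).map_target hw
  have hwp : w = extChartAt (𝓡 k) y p := ((extChartAt (𝓡 k) y).right_inv hw).symm
  have hC := isInvertible_chartD hps
  have hu := hC.self_apply_inverse u
  have hv := hC.self_apply_inverse v
  rw [← hu, ← hv, hwp, metricRep_chartD hps, ← chartD_change hps hw', ← chartD_change hps hw',
    chartChange, (extChartAt (𝓡 k) y).left_inv hps, metricRep_chartD hw']

/-- Transition of the pulled-back connection to the charts around `x₀` and `f x₀`. -/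
theorem NearBase.chartD_covAt (h : NearBase (m := m) (k := k) f x₀ x)
    (hf : ContMDiff (𝓡 m) (𝓡 k) ∞ f) {V : M → Euc k} {V' : Euc m → Euc k}
    (hev : ∀ᶠ x' in 𝓝 x, chartD (f x₀) (f x') (V x') = V' (extChartAt (𝓡 m) x₀ x'))
    (hd : DifferentiableAt ℝ V' (extChartAt (𝓡 m) x₀ x)) (v : Euc m) :
    chartD (f x₀) (f x) (covAt γ f V x v)
      = covD (flatConn γ f x₀) V' (extChartAt (𝓡 m) x₀ x) (chartD x₀ x v) := by
  set χ := chartChange (k := k) (f x₀) (f x) with hχ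
  have hself := mem_extChartAt_source (I := 𝓡 k) (f x)
  have hFz := h.flatMap_eq
  have hF := contDiffAt_flatMap hf h.mem_flatDom
  have hVz := hev.self_of_nhds
  have hJ := h.chartD_mapD hf v
  have htar := flatMap_mem_target h.mem_flatDom
  set z := extChartAt (𝓡 m) x₀ x with hz
  set a := chartD x₀ x v with ha
  set w := flatMap (k := k) f x₀ z
  have hχs : ContDiffAt ℝ ∞ χ w := by
    rw [hFz]; exact contDiffAt_chartChange h.cod hself
  have hχw : χ w = extChartAt (𝓡 k) (f x) (f x) := by
    rw [hFz, hχ, chartChange, (extChartAt (𝓡 k) (f x₀)).left_inv h.cod]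
  have hχF : DifferentiableAt ℝ (fun z' => fderiv ℝ χ (flatMap f x₀ z')) z :=
    hχs.smooth_fderiv.diff.comp z hF.diff
  have hinv : ∀ u, fderiv ℝ χ w (chartD (f x₀) (f x) u) = u := fun u => by
    rw [hFz, ← chartD_change h.cod hself, chartD_self, ContinuousLinearMap.id_apply]
  have hC := isInvertible_chartD h.cod
  have hχinv : (fderiv ℝ χ w).IsInvertible := by
    have : fderiv ℝ χ w = (chartD (f x₀) (f x)).inverse := by
      ext1 u
      rw [← hC.self_apply_inverse u, hinv, hC.inverse_apply_self]
    rw [this]; exact hC.inverse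
  -- The covariant derivative at `x` is defined in the chart around `f x`, which moves with `x`. The
  -- section is rewritten in the fixed chart around `f x₀`.
  have hV1 : funD (fun x' => chartD (f x) (f x') (V x')) x v
      = fderiv ℝ (fun z' => fderiv ℝ χ (flatMap f x₀ z') (V' z')) z a := by
    refine funD_of_chart h.dom ?_ (hχF.clm_apply hd) v
    filter_upwards [hev, h.eventually hf.continuous.continuousAt,
      hf.continuous.continuousAt.preimage_mem_nhds
        ((isOpen_extChartAt_source (f x)).mem_nhds hself)] with x' h1 h2 h3
    rw [chartD_change h2.cod h3, h1, h2.flatMap_eq]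
  have hfd : fderiv ℝ (fun z' => fderiv ℝ χ (flatMap f x₀ z')) z a
      = fderiv ℝ (fderiv ℝ χ) w (flatJ f x₀ z a) :=
    congrArg (fun L => L a) (fderiv_comp z hχs.smooth_fderiv.diff hF.diff)
  have hmr := isMetricRep_metricRep (γ := γ) (f x)
  have hself' : χ w ∈ (extChartAt (𝓡 k) (f x)).target := by
    rw [hχw]; exact (extChartAt (𝓡 k) (f x)).map_source hself
  -- The Hessian of `χ` from the product rule is exactly the inhomogeneous term in the
  -- transformation law of the Christoffel symbols.
  have hchange := lcConn_change (G := metricRep γ (f x₀)) (G₂ := metricRep γ (f x)) hχs hχinv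
    ((isMetricRep_metricRep (f x₀)).eventually_scalarProduct htar) (smooth_metricRep htar).diff
    (hmr.eventually_scalarProduct hself') (smooth_metricRep hself').diff
    (by
      have h1 : ContinuousAt (extChartAt (𝓡 k) (f x₀)).symm w :=
        continuousAt_extChartAt_symm'' htar
      have h2 : (extChartAt (𝓡 k) (f x₀)).symm w = f x := by
        rw [hFz, (extChartAt (𝓡 k) (f x₀)).left_inv h.cod]
      filter_upwards [(isOpen_extChartAt_target (f x₀)).mem_nhds htar,
        h1.preimage_mem_nhds ((isOpen_extChartAt_source (f x)).mem_nhds (by rw [h2]; exact hself))]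
        with y hy hy' using metricRep_change hy hy') (flatJ f x₀ z a) (V' z)
  have hVx : V x = fderiv ℝ χ w (V' z) := by rw [← hVz, hinv]
  have hfx : mapD f x v = fderiv ℝ χ w (flatJ f x₀ z a) := by rw [← hJ, hinv]
  have hcov : covAt γ f V x v = fderiv ℝ χ w (covD (flatConn γ f x₀) V' z a) := by
    rw [covAt_eq, hV1, ← hχw, hmr.christoffel_eq hself', fderiv_apply₁ hχF hd, hfd, covD_apply,
      map_add, hVx, hfx]
    have : flatConn γ f x₀ z a (V' z) = lcConn (metricRep γ (f x₀)) w (flatJ f x₀ z a) (V' z) := rfl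
    rw [this, hchange]
    abel
  rw [hcov, ← hC.self_apply_inverse (covD (flatConn γ f x₀) V' z a), hinv]

end MapInCharts

/-! ### Invariance of traces under linear maps -/

section TraceChange

variable {m : ℕ}

theorem traceIn_comp {F : Type*} [AddCommGroup F] [Module ℝ F] {A : Euc m →L[ℝ] Euc m}
    (hA : A.IsInvertible) {b : Euc m → Euc m → ℝ} (hb : IsBilin b) {Q : Euc m → Euc m → F}
    (hQ : IsBilin Q) :
    traceIn (stdE m) (fun u v => b (A u) (A v)) (fun u v => Q (A u) (A v))
      = traceIn (stdE m) b Q := by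
  have hli : LinearIndependent ℝ fun i => A (stdE m i) := by
    have h1 : LinearIndependent ℝ (stdE m) := by
      have h0 : stdE m = ⇑(EuclideanSpace.basisFun (Fin m) ℝ).toBasis := by funext i; simp
      rw [h0]
      exact (EuclideanSpace.basisFun (Fin m) ℝ).toBasis.linearIndependent
    exact h1.map' A.toLinearMap (LinearMap.ker_eq_bot.2 hA.injective)
  exact traceIn_eq_std hli hb hQ

theorem map_traceIn {F F' : Type*} [NormedAddCommGroup F] [NormedSpace ℝ F]
    [NormedAddCommGroup F'] [NormedSpace ℝ F'] (L : F →L[ℝ] F') (a : Fin m → Euc m)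
    (b : Euc m → Euc m → ℝ) (Q : Euc m → Euc m → F) :
    L (traceIn a b Q) = traceIn a b fun u v => L (Q u v) := by
  simp [traceIn, map_sum]

end TraceChange

/-! ### The second fundamental form in charts -/

section ImmersionInCharts

variable {m k : ℕ} {M : Type*} [TopologicalSpace M] [ChartedSpace (Euc m) M]
  {N : Type*} [TopologicalSpace N] [ChartedSpace (Euc k) N] [IsManifold (𝓡 k) ∞ N]
  (γ : Bundle.ContMDiffRiemannianMetric (𝓡 k) ∞ (Euc k) (fun p : N => TangentSpace (𝓡 k) p))
  (f : M → N)

/-- The metric induced by `f`, on the model space. -/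
def pullAt (x : M) : Euc m →L[ℝ] Euc m →L[ℝ] ℝ :=
  (metricAt γ (f x)).bilinearComp (mapD f x) (mapD f x)

/-- The induced connection on coordinate fields, on the model space. -/
def covCoordAt (x : M) (u v : Euc m) : Euc m := covCoord m (metricForm γ) f x u v

/-- The tangential component, on the model spaces. -/
def tangentAt (x : M) (w : Euc k) : Euc m := tangentPart m (metricForm γ) f x w

/-- The normal component, on the model space. -/
def normalAt (x : M) (w : Euc k) : Euc k := normalPart m (metricForm γ) f x w

/-- The second fundamental form, on the model spaces. -/
def secondFundAt (x : M) (u v : Euc m) : Euc k := secondFund m (metricForm γ) f x u v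

/-- The tension field, on the model space. -/
def tensionAt (x : M) : Euc k := tension m (metricForm γ) f x

variable {γ f} {x₀ x : M}

theorem pullAt_apply (u v : Euc m) :
    pullAt γ f x u v = metricAt γ (f x) (mapD f x u) (mapD f x v) := rfl

theorem normalAt_eq (w : Euc k) :
    normalAt (m := m) γ f x w = w - mapD f x (tangentAt (m := m) γ f x w) := rfl

theorem secondFundAt_eq (u v : Euc m) : secondFundAt γ f x u v = normalAt (m := m) γ f x
    (covAt γ f (fun x' => mapD f x' (coordField (k := m) x v x')) x u) := rfl

theorem tensionAt_eq : tensionAt (m := m) γ f x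
    = traceIn (stdE m) (fun u v => pullAt γ f x u v) fun u v =>
        covAt γ f (fun x' => mapD f x' (coordField (k := m) x v x')) x u
          - mapD f x (covCoordAt γ f x u v) := rfl

theorem isScalarProduct_pullAt (hinj : Function.Injective (mapD (m := m) (k := k) f x)) :
    IsScalarProduct (pullAt (m := m) γ f x) := by
  have hs := isScalarProduct_metricAt (γ := γ) (f x)
  exact ⟨fun u v => hs.symm _ _, fun u hu => hs.pos _ fun h0 => hu
    (hinj (h0.trans (map_zero (mapD f x)).symm))⟩

theorem pullAt_tangentAt (hinj : Function.Injective (mapD (m := m) (k := k) f x)) (w : Euc k)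
    (u : Euc m) : pullAt γ f x (tangentAt γ f x w) u = metricAt γ (f x) w (mapD f x u) := by
  have hs := isScalarProduct_pullAt (γ := γ) hinj
  exact form_traceIn_smul (isBilin_clm (pullAt (m := m) γ f x)) hs.symm hs.pos
    (α := fun u => metricAt γ (f x) w (mapD f x u)) (by simp) (by simp) u


namespace NearBase

theorem flatMet_chartD (h : NearBase (m := m) (k := k) f x₀ x) (a b : Euc k) :
    flatMet γ f x₀ (extChartAt (𝓡 m) x₀ x) (chartD (f x₀) (f x) a) (chartD (f x₀) (f x) b)
      = metricAt γ (f x) a b := by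
  rw [flatMet, h.flatMap_eq, metricRep_chartD h.cod]

variable [IsManifold (𝓡 m) ∞ M]

theorem indMet_chartD (h : NearBase (m := m) (k := k) f x₀ x) (hf : ContMDiff (𝓡 m) (𝓡 k) ∞ f)
    (u v : Euc m) :
    indMet (flatMet γ f x₀) (flatJ f x₀) (extChartAt (𝓡 m) x₀ x) (chartD x₀ x u) (chartD x₀ x v)
      = pullAt γ f x u v := by
  rw [indMet_apply, ← h.chartD_mapD hf, ← h.chartD_mapD hf, h.flatMet_chartD, pullAt_apply]

theorem tanProj_chartD (h : NearBase (m := m) (k := k) f x₀ x) (hf : ContMDiff (𝓡 m) (𝓡 k) ∞ f)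
    (hinj : ∀ x, Function.Injective (mapD (m := m) (k := k) f x)) (w : Euc k) :
    chartD x₀ x (tangentAt (m := m) γ f x w)
      = tanProj (flatMet γ f x₀) (flatJ f x₀) (extChartAt (𝓡 m) x₀ x) (chartD (f x₀) (f x) w) := by
  have hS := isSoldered (γ := γ) hf hinj x₀
  refine (hS.isScalarProduct_indMet h.mem_flatDom).ext fun u => ?_
  obtain ⟨u, rfl⟩ : ∃ u', u = chartD x₀ x u' :=
    ⟨_, ((isInvertible_chartD h.dom).self_apply_inverse u).symm⟩
  rw [h.indMet_chartD hf, hS.form_tanProj h.mem_flatDom, ← h.chartD_mapD hf, h.flatMet_chartD,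
    pullAt_tangentAt (hinj x)]

theorem norProj_chartD (h : NearBase (m := m) (k := k) f x₀ x) (hf : ContMDiff (𝓡 m) (𝓡 k) ∞ f)
    (hinj : ∀ x, Function.Injective (mapD (m := m) (k := k) f x)) (w : Euc k) :
    chartD (f x₀) (f x) (normalAt (m := m) γ f x w)
      = norProj (flatMet γ f x₀) (flatJ f x₀) (extChartAt (𝓡 m) x₀ x) (chartD (f x₀) (f x) w) := by
  rw [normalAt_eq, map_sub, h.chartD_mapD hf, h.tanProj_chartD hf hinj, norProj_apply]

theorem secondFundAt_chartD (h : NearBase (m := m) (k := k) f x₀ x)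
    (hf : ContMDiff (𝓡 m) (𝓡 k) ∞ f)
    (hinj : ∀ x, Function.Injective (mapD (m := m) (k := k) f x)) (u v : Euc m) :
    chartD (f x₀) (f x) (secondFundAt γ f x u v)
      = flatB (flatMet γ f x₀) (flatConn γ f x₀) (flatJ f x₀) (extChartAt (𝓡 m) x₀ x)
          (chartD x₀ x u) (chartD x₀ x v) := by
  have hS := isSoldered (γ := γ) hf hinj x₀
  have hself := mem_extChartAt_source (I := 𝓡 m) x
  -- The coordinate field belongs to the chart around `x`, so its expression `Y` in the chart around
  -- `x₀` is not constant. The derivative of `Y` gives a tangential vector, which the normal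
  -- projection removes.
  set Y : Euc m → Euc m := fun z =>
    fderiv ℝ (chartChange x x₀) (chartChange x₀ x z) v with hY
  have hY1 : ∀ x', x' ∈ (extChartAt (𝓡 m) x₀).source → x' ∈ (extChartAt (𝓡 m) x).source →
      chartD x₀ x' (coordField (k := m) x v x') = Y (extChartAt (𝓡 m) x₀ x') := by
    intro x' h0 h1
    have h2 := chartD_change h1 h0 (coordField (k := m) x v x')
    have h3 : chartD x x' (coordField (k := m) x v x') = v := chartD_coordField h1 v
    rw [h3] at h2
    rw [hY]
    simp only
    rw [chartChange, (extChartAt (𝓡 m) x₀).left_inv h0]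
    exact h2
  have hYd : DifferentiableAt ℝ Y (extChartAt (𝓡 m) x₀ x) := by
    have h1 := contDiffAt_chartChange h.dom hself
    have h2 : ContDiffAt ℝ ∞ (chartChange x x₀) (chartChange x₀ x (extChartAt (𝓡 m) x₀ x)) := by
      rw [chartChange, (extChartAt (𝓡 m) x₀).left_inv h.dom]
      exact contDiffAt_chartChange hself h.dom
    exact ((h2.smooth_fderiv.comp _ h1).clm_apply contDiffAt_const).diff
  have hYx : Y (extChartAt (𝓡 m) x₀ x) = chartD x₀ x v := by
    rw [← hY1 x h.dom hself]
    exact congrArg _ (coordField_self x v)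
  rw [secondFundAt_eq, h.norProj_chartD hf hinj,
    h.chartD_covAt hf (V' := fun z => flatJ f x₀ z (Y z)) ?_
      ((contDiffAt_flatJ hf h.mem_flatDom).diff.clm_apply hYd),
    hS.norProj_covD_J h.mem_flatDom hYd, hYx]
  filter_upwards [h.eventually hf.continuous.continuousAt,
    (isOpen_extChartAt_source x).mem_nhds hself] with x' h1 h2
  have h3 := h1.chartD_mapD hf (coordField (k := m) x v x')
  rw [hY1 x' h1.dom h2] at h3
  exact h3

end NearBase

end ImmersionInCharts

/-! ### The induced connection and the tension field -/

section FlatTangential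

variable {m : ℕ} {K : Type*} [NormedAddCommGroup K] [NormedSpace ℝ K] {U : Set (Euc m)}
  {g : Euc m → K →L[ℝ] K →L[ℝ] ℝ} {θ : Euc m → Euc m →L[ℝ] K →L[ℝ] K}
  {J : Euc m → Euc m →L[ℝ] K} {z : Euc m}

/-- The induced connection is the Levi-Civita connection of the induced metric. -/
theorem IsSoldered.lcConn_indMet (h : IsSoldered U g θ J) (hz : z ∈ U) (u v : Euc m) :
    lcConn (indMet g J) z u v = tanProj g J z (secondJ θ J z u v) := by
  refine lcConn_unique (Γ := fun u v => tanProj g J z (secondJ θ J z u v))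
    (h.isScalarProduct_indMet hz) (fun u v => by rw [h.secondJ_symm hz])
    (fun u a b => ?_) u v
  have hJ : ∀ a, DifferentiableAt ℝ (fun y => J y a) z := fun a =>
    (h.smooth_J z hz).diff.clm_apply (differentiableAt_const a)
  rw [← fderiv_apply_const₂ (h.smooth_indMet hz).diff]
  have h1 := h.fderiv_form hz (hJ a) (hJ b) u
  rw [(h.isScalarProduct_indMet hz).symm a, h.form_tanProj hz, h.form_tanProj hz,
    (h.scalarProduct z hz).symm _ (J z a)]
  exact h1

end FlatTangential

section ImmersionAtBase

variable {m k : ℕ} {M : Type*} [TopologicalSpace M] [ChartedSpace (Euc m) M]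
  {N : Type*} [TopologicalSpace N] [ChartedSpace (Euc k) N] [IsManifold (𝓡 k) ∞ N]
  {γ : Bundle.ContMDiffRiemannianMetric (𝓡 k) ∞ (Euc k) (fun p : N => TangentSpace (𝓡 k) p)}
  {f : M → N} {x₀ x : M} [IsManifold (𝓡 m) ∞ M]

theorem metricInChart_pullback (hf : ContMDiff (𝓡 m) (𝓡 k) ∞ f) {z : Euc m}
    (hz : z ∈ flatDom (m := m) (k := k) f x) (u w : Euc m) :
    metricInChart (pullbackForm m (metricForm γ) f) x z u w
      = indMet (flatMet γ f x) (flatJ f x) z u w := by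
  have h := nearBase_symm hz
  have hC := isInvertible_chartD h.dom
  have h1 := h.indMet_chartD (γ := γ) hf ((chartD x ((extChartAt (𝓡 m) x).symm z)).inverse u)
    ((chartD x ((extChartAt (𝓡 m) x).symm z)).inverse w)
  rw [hC.self_apply_inverse, hC.self_apply_inverse, (extChartAt (𝓡 m) x).right_inv hz.1] at h1
  exact h1.symm

theorem isMetricRep_pullback (hf : ContMDiff (𝓡 m) (𝓡 k) ∞ f)
    (hinj : ∀ x, Function.Injective (mapD (m := m) (k := k) f x)) (x : M) :
    IsMetricRep (pullbackForm m (metricForm γ) f) x (flatDom (m := m) (k := k) f x)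
      (indMet (flatMet γ f x) (flatJ f x)) :=
  have hS := isSoldered (γ := γ) hf hinj x
  ⟨isOpen_flatDom hf.continuous, fun _ hz => hS.smooth_indMet hz,
    fun _ hz => hS.isScalarProduct_indMet hz, fun _ hz => metricInChart_pullback hf hz⟩

theorem covCoordAt_base (hf : ContMDiff (𝓡 m) (𝓡 k) ∞ f)
    (hinj : ∀ x, Function.Injective (mapD (m := m) (k := k) f x)) (u v : Euc m) :
    covCoordAt γ f x u v = tanProj (flatMet γ f x) (flatJ f x) (extChartAt (𝓡 m) x x)
      (secondJ (flatConn γ f x) (flatJ f x) (extChartAt (𝓡 m) x x) u v) := by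
  have hself := mem_extChartAt_source (I := 𝓡 m) x
  have hz := (NearBase.self (m := m) (k := k) (f := f) (x := x)).mem_flatDom
  have h1 : covCoordAt γ f x u v
      = funD (fun x' => chartD x x' (coordField (k := m) x v x')) x u
        + christoffel (pullbackForm m (metricForm γ) f) x (extChartAt (𝓡 m) x x)
            (mapD (m := m) (k := m) (id : M → M) x u) (coordField (k := m) x v x) := rfl
  have h2 : funD (fun x' => chartD x x' (coordField (k := m) x v x')) x u = 0 := by
    rw [funD_of_chart (ĥ := fun _ => v) hself ?_ (differentiableAt_const v)]
    · simp
    · filter_upwards [(isOpen_extChartAt_source x).mem_nhds hself] with x' hx'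
      exact chartD_coordField hx' v
  have h3 : mapD (m := m) (k := m) (id : M → M) x u = u := by
    have : mapD (m := m) (k := m) (id : M → M) x = ContinuousLinearMap.id ℝ (Euc m) := mfderiv_id
    rw [this]; rfl
  have h4 : (coordField (k := m) x v x : Euc m) = v := coordField_self x v
  rw [h1, h2, h3, h4, zero_add, (isMetricRep_pullback (γ := γ) hf hinj x).christoffel_eq hz,
    (isSoldered (γ := γ) hf hinj x).lcConn_indMet hz]

theorem mapD_base (hf : ContMDiff (𝓡 m) (𝓡 k) ∞ f) (v : Euc m) :
    mapD (k := k) f x v = flatJ f x (extChartAt (𝓡 m) x x) v := by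
  have h := (NearBase.self (m := m) (k := k) (f := f) (x := x)).chartD_mapD hf v
  rwa [chartD_self, chartD_self] at h

theorem secondFundAt_base (hf : ContMDiff (𝓡 m) (𝓡 k) ∞ f)
    (hinj : ∀ x, Function.Injective (mapD (m := m) (k := k) f x)) (u v : Euc m) :
    secondFundAt γ f x u v = flatB (flatMet γ f x) (flatConn γ f x) (flatJ f x)
      (extChartAt (𝓡 m) x x) u v := by
  have h := (NearBase.self (m := m) (k := k) (f := f) (x := x)).secondFundAt_chartD
    (γ := γ) hf hinj u v
  rwa [chartD_self, chartD_self] at h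

theorem covAt_base (hf : ContMDiff (𝓡 m) (𝓡 k) ∞ f) {V : M → Euc k} {V' : Euc m → Euc k}
    (hev : ∀ᶠ x' in 𝓝 x, chartD (f x) (f x') (V x') = V' (extChartAt (𝓡 m) x x'))
    (hd : DifferentiableAt ℝ V' (extChartAt (𝓡 m) x x)) (v : Euc m) :
    covAt γ f V x v = covD (flatConn γ f x) V' (extChartAt (𝓡 m) x x) v := by
  have h := (NearBase.self (m := m) (k := k) (f := f) (x := x)).chartD_covAt (γ := γ) hf hev hd v
  rwa [chartD_self, chartD_self] at h

/-- The tension field is the trace of the second fundamental form. -/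
theorem tensionAt_eq_trace (hf : ContMDiff (𝓡 m) (𝓡 k) ∞ f)
    (hinj : ∀ x, Function.Injective (mapD (m := m) (k := k) f x)) :
    tensionAt (m := m) γ f x
      = traceIn (stdE m) (fun u v => pullAt γ f x u v) (secondFundAt γ f x) := by
  have hself := NearBase.self (m := m) (k := k) (f := f) (x := x)
  rw [tensionAt_eq]
  congr 1
  funext u v
  rw [covCoordAt_base hf hinj, mapD_base hf, secondFundAt_base hf hinj,
    covAt_base hf (V' := fun z => flatJ f x z v) ?_
      ((contDiffAt_flatJ hf hself.mem_flatDom).diff.clm_apply (differentiableAt_const v))]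
  · rfl
  · filter_upwards [hself.eventually hf.continuous.continuousAt] with x' hx'
    have h1 := hx'.chartD_mapD hf (coordField (k := m) x v x')
    have h2 : chartD x x' (coordField (k := m) x v x') = v := chartD_coordField hx'.dom v
    rwa [h2] at h1

theorem isBilin_secondFundAt (hf : ContMDiff (𝓡 m) (𝓡 k) ∞ f)
    (hinj : ∀ x, Function.Injective (mapD (m := m) (k := k) f x)) :
    IsBilin (secondFundAt (m := m) γ f x) := by
  have h : secondFundAt (m := m) γ f x = flatB (flatMet γ f x) (flatConn γ f x) (flatJ f x)
      (extChartAt (𝓡 m) x x) := by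
    funext u v; exact secondFundAt_base hf hinj u v
  rw [h]
  exact (isSoldered hf hinj x).isBilin_flatB NearBase.self.mem_flatDom

theorem NearBase.traceIn_pullAt {F : Type*} [AddCommGroup F] [Module ℝ F]
    (h : NearBase (m := m) (k := k) f x₀ x) (hf : ContMDiff (𝓡 m) (𝓡 k) ∞ f)
    {Q : Euc m → Euc m → F} (hQ : IsBilin Q) :
    traceIn (stdE m) (fun u v => pullAt γ f x u v)
        (fun u v => Q (chartD x₀ x u) (chartD x₀ x v))
      = traceIn (stdE m) (fun u v => indMet (flatMet γ f x₀) (flatJ f x₀)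
          (extChartAt (𝓡 m) x₀ x) u v) Q := by
  rw [← traceIn_comp (isInvertible_chartD h.dom) (isBilin_clm _) hQ]
  congr 1
  funext u v
  rw [h.indMet_chartD hf]

/-- The Laplacian at `x₀` differentiates `τ` at neighbouring points, so a formula for `τ` in one
fixed pair of charts is needed, not only at the base point. -/
theorem NearBase.tensionAt_chartD (h : NearBase (m := m) (k := k) f x₀ x)
    (hf : ContMDiff (𝓡 m) (𝓡 k) ∞ f)
    (hinj : ∀ x, Function.Injective (mapD (m := m) (k := k) f x)) :
    chartD (f x₀) (f x) (tensionAt (m := m) γ f x)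
      = flatTau (flatMet γ f x₀) (flatConn γ f x₀) (flatJ f x₀) (extChartAt (𝓡 m) x₀ x) := by
  rw [tensionAt_eq_trace hf hinj, map_traceIn, flatTau,
    ← h.traceIn_pullAt hf ((isSoldered hf hinj x₀).isBilin_flatB h.mem_flatDom)]
  congr 1
  funext u v
  exact h.secondFundAt_chartD hf hinj u v

end ImmersionAtBase

/-! ### Rough and normal Laplacians at the base point -/

section FlatSecondOrder

variable {m : ℕ} {K : Type*} [NormedAddCommGroup K] [NormedSpace ℝ K] {U : Set (Euc m)}
  {g : Euc m → K →L[ℝ] K →L[ℝ] ℝ} {θ : Euc m → Euc m →L[ℝ] K →L[ℝ] K}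
  {J : Euc m → Euc m →L[ℝ] K} {z : Euc m}

theorem covD_clm_apply {A : Euc m → Euc m →L[ℝ] K} {Y : Euc m → Euc m}
    (hA : DifferentiableAt ℝ A z) (hY : DifferentiableAt ℝ Y z) (u : Euc m) :
    covD θ (fun y => A y (Y y)) z u
      = covD θ (fun y => A y (Y z)) z u + A z (fderiv ℝ Y z u) := by
  rw [covD_apply, covD_apply, fderiv_apply₁ hA hY, fderiv_apply_const hA]
  abel

/-- The trace of a second-order operator, in a frame that is orthonormal and parallel at `z`. -/
theorem IsSoldered.traceIn_second (h : IsSoldered U g θ J) (hz : z ∈ U)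
    {A : Euc m → Euc m →L[ℝ] K} (hA : DifferentiableAt ℝ A z) (P : K →L[ℝ] K)
    {o : Fin m → Euc m} (ho : IsOrthonormal (fun u v => indMet g J z u v) o) :
    traceIn (stdE m) (fun u v => indMet g J z u v)
        (fun u v => P (covD θ (fun y => A y v) z u)
          - P (A z (tanProj g J z (secondJ θ J z u v))))
      = ∑ i, P (covD θ (fun y => A y (parField g θ J z (o i) y)) z (o i)) := by
  -- Replacing the constant field `v` by the field parallel at `z` subtracts exactly the connection
  -- correction of the second-order operator.
  have hpar : ∀ u v, covD θ (fun y => A y (parField g θ J z v y)) z u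
      = covD θ (fun y => A y v) z u - A z (tanProj g J z (secondJ θ J z u v)) := fun u v => by
    rw [covD_clm_apply hA (contDiff_parField z v).contDiffAt.diff, parField_self, fderiv_parField,
      map_neg, ← sub_eq_add_neg]
  have hd : ∀ v, DifferentiableAt ℝ (fun y => A y v) z := fun v =>
    hA.clm_apply (differentiableAt_const v)
  have hJ := h.isBilin_secondJ hz
  have h1 : IsBilin fun u v => P (covD θ (fun y => A y v) z u)
      - P (A z (tanProj g J z (secondJ θ J z u v))) := by
    constructor
    · intro u u' v; simp only [map_add, hJ.add_left]; abel
    · intro r u v; simp only [map_smul, hJ.smul_left, smul_sub]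
    · intro u v v'
      simp only [map_add, hJ.add_right, covD_add (hd v) (hd v')]; abel
    · intro r u v; simp only [map_smul, hJ.smul_right, smul_sub, covD_smul r (hd v)]
  rw [ho.traceIn_std (isBilin_clm _) h1]
  simp only [hpar, map_sub]

end FlatSecondOrder

section LaplaciansAtBase

variable {m k : ℕ} {M : Type*} [TopologicalSpace M] [ChartedSpace (Euc m) M]
  {N : Type*} [TopologicalSpace N] [ChartedSpace (Euc k) N] [IsManifold (𝓡 k) ∞ N]
  (γ : Bundle.ContMDiffRiemannianMetric (𝓡 k) ∞ (Euc k) (fun p : N => TangentSpace (𝓡 k) p))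
  (f : M → N)

/-- The Laplacian along `f`, on the model space. -/
def lapAt (V : M → Euc k) (x : M) : Euc k := lapAlong m (metricForm γ) f V x

/-- The Laplacian of the normal bundle, on the model space. -/
def normalLapAt (V : M → Euc k) (x : M) : Euc k := normalLap m (metricForm γ) f V x

/-- The normal connection, on the model spaces. -/
def normalCovAt (V : M → Euc k) (x : M) (v : Euc m) : Euc k := normalCov m (metricForm γ) f V x v

/-- The curvature, on the model space. -/
def curvAt (p : N) (u v w : Euc k) : Euc k := curvature (metricForm γ) p u v w

variable {γ f} {x : M}

theorem lapAt_eq (V : M → Euc k) : lapAt (m := m) γ f V x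
    = - traceIn (stdE m) (fun u v => pullAt γ f x u v) fun u v =>
        covAt γ f (fun x' => covAt γ f V x' (coordField (k := m) x v x')) x u
          - covAt γ f V x (covCoordAt γ f x u v) := rfl

theorem normalCovAt_eq (V : M → Euc k) (v : Euc m) :
    normalCovAt γ f V x v = normalAt (m := m) γ f x (covAt γ f V x v) := rfl

theorem normalLapAt_eq (V : M → Euc k) : normalLapAt (m := m) γ f V x
    = - traceIn (stdE m) (fun u v => pullAt γ f x u v) fun u v =>
        normalCovAt γ f (fun x' => normalCovAt γ f V x' (coordField (k := m) x v x')) x u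
          - normalCovAt γ f V x (covCoordAt γ f x u v) := rfl

variable {V : M → Euc k} {V' : Euc m → Euc k}

variable (γ f x) in
/-- The section `V` of `f⁻¹TN` has the smooth coordinate expression `V'`. -/
structure IsSectionRep (V : M → Euc k) (V' : Euc m → Euc k) : Prop where
  eq : ∀ x', NearBase (m := m) (k := k) f x x' →
    chartD (f x) (f x') (V x') = V' (extChartAt (𝓡 m) x x')
  smooth : ∀ z ∈ flatDom (m := m) (k := k) f x, ContDiffAt ℝ ∞ V' z

theorem IsSectionRep.eq_base (h : IsSectionRep f x V V') : V x = V' (extChartAt (𝓡 m) x x) := by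
  have := h.eq x NearBase.self
  rwa [chartD_self] at this

theorem metricAt_base (a b : Euc k) :
    metricAt γ (f x) a b = flatMet γ f x (extChartAt (𝓡 m) x x) a b := by
  have := (NearBase.self (m := m) (k := k) (f := f) (x := x)).flatMet_chartD (γ := γ) a b
  rw [chartD_self] at this
  exact this.symm

variable [IsManifold (𝓡 m) ∞ M]

theorem IsSectionRep.covAt_chartD (h : IsSectionRep f x V V') (hf : ContMDiff (𝓡 m) (𝓡 k) ∞ f)
    {x' : M} (hx' : NearBase (m := m) (k := k) f x x') (v : Euc m) :
    chartD (f x) (f x') (covAt γ f V x' v)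
      = covD (flatConn γ f x) V' (extChartAt (𝓡 m) x x') (chartD x x' v) := by
  refine hx'.chartD_covAt hf ?_ (h.smooth _ hx'.mem_flatDom).diff v
  filter_upwards [hx'.eventually hf.continuous.continuousAt] with q hq using h.eq q hq

theorem IsSectionRep.covAt_base (h : IsSectionRep f x V V') (hf : ContMDiff (𝓡 m) (𝓡 k) ∞ f)
    (v : Euc m) :
    covAt γ f V x v = covD (flatConn γ f x) V' (extChartAt (𝓡 m) x x) v := by
  have := h.covAt_chartD (γ := γ) hf NearBase.self v
  rwa [chartD_self, chartD_self] at this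

/-- A section of `f⁻¹TN` obtained by applying a field of operators to a coordinate field. -/
theorem covAt_operator_base (hf : ContMDiff (𝓡 m) (𝓡 k) ∞ f)
    {B : M → Euc m → Euc k} {A : Euc m → Euc m →L[ℝ] Euc k}
    (hB : ∀ x', NearBase (m := m) (k := k) f x x' → ∀ v, chartD (f x) (f x') (B x' v)
      = A (extChartAt (𝓡 m) x x') (chartD x x' v))
    (hA : DifferentiableAt ℝ A (extChartAt (𝓡 m) x x)) (u v : Euc m) :
    covAt γ f (fun x' => B x' (coordField (k := m) x v x')) x u
      = covD (flatConn γ f x) (fun y => A y v) (extChartAt (𝓡 m) x x) u := by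
  have hself := NearBase.self (m := m) (k := k) (f := f) (x := x)
  refine HopfCyl.covAt_base hf ?_ (hA.clm_apply (differentiableAt_const v)) u
  filter_upwards [hself.eventually hf.continuous.continuousAt] with x' hx'
  have h1 := hB x' hx' (coordField (k := m) x v x')
  have h2 : chartD x x' (coordField (k := m) x v x') = v := chartD_coordField hx'.dom v
  rwa [h2] at h1

theorem pullAt_base (hf : ContMDiff (𝓡 m) (𝓡 k) ∞ f) (u v : Euc m) :
    pullAt γ f x u v = indMet (flatMet γ f x) (flatJ f x) (extChartAt (𝓡 m) x x) u v := by
  have := (NearBase.self (m := m) (k := k) (f := f) (x := x)).indMet_chartD (γ := γ) hf u v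
  rw [chartD_self] at this
  exact this.symm

theorem normalAt_base (hf : ContMDiff (𝓡 m) (𝓡 k) ∞ f)
    (hinj : ∀ x, Function.Injective (mapD (m := m) (k := k) f x)) (a : Euc k) :
    normalAt (m := m) γ f x a
      = norProj (flatMet γ f x) (flatJ f x) (extChartAt (𝓡 m) x x) a := by
  have := (NearBase.self (m := m) (k := k) (f := f) (x := x)).norProj_chartD (γ := γ) hf hinj a
  rwa [chartD_self] at this

theorem lapAt_base (h : IsSectionRep f x V V') (hf : ContMDiff (𝓡 m) (𝓡 k) ∞ f)
    (hinj : ∀ x, Function.Injective (mapD (m := m) (k := k) f x)) {o : Fin m → Euc m}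
    (ho : IsOrthonormal (fun u v => indMet (flatMet γ f x) (flatJ f x)
      (extChartAt (𝓡 m) x x) u v) o) :
    lapAt (m := m) γ f V x = - ∑ i, covD (flatConn γ f x)
      (fun y => covD (flatConn γ f x) V' y
        (parField (flatMet γ f x) (flatConn γ f x) (flatJ f x) (extChartAt (𝓡 m) x x) (o i) y))
      (extChartAt (𝓡 m) x x) (o i) := by
  have hself := NearBase.self (m := m) (k := k) (f := f) (x := x)
  have hS := isSoldered (γ := γ) hf hinj x
  have hA := (hS.smooth_covD hself.mem_flatDom (h.smooth _ hself.mem_flatDom)).diff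
  rw [lapAt_eq]
  have h1 := hS.traceIn_second hself.mem_flatDom hA (ContinuousLinearMap.id ℝ (Euc k)) ho
  simp only [ContinuousLinearMap.id_apply] at h1
  rw [← h1]
  simp only [pullAt_base hf, covCoordAt_base hf hinj, h.covAt_base hf]
  congr 2
  funext u v
  congr 1
  exact covAt_operator_base (B := fun x' => covAt γ f V x') hf
    (fun x' hx' v => h.covAt_chartD hf hx' v) hA u v

theorem normalLapAt_base (h : IsSectionRep f x V V') (hf : ContMDiff (𝓡 m) (𝓡 k) ∞ f)
    (hinj : ∀ x, Function.Injective (mapD (m := m) (k := k) f x)) {o : Fin m → Euc m}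
    (ho : IsOrthonormal (fun u v => indMet (flatMet γ f x) (flatJ f x)
      (extChartAt (𝓡 m) x x) u v) o) :
    normalLapAt (m := m) γ f V x = - ∑ i,
      norProj (flatMet γ f x) (flatJ f x) (extChartAt (𝓡 m) x x) (covD (flatConn γ f x)
      (fun y => norProj (flatMet γ f x) (flatJ f x) y (covD (flatConn γ f x) V' y
        (parField (flatMet γ f x) (flatConn γ f x) (flatJ f x) (extChartAt (𝓡 m) x x) (o i) y)))
      (extChartAt (𝓡 m) x x) (o i)) := by
  have hself := NearBase.self (m := m) (k := k) (f := f) (x := x)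
  have hS := isSoldered (γ := γ) hf hinj x
  have hA := ((hS.smooth_norProj hself.mem_flatDom).clm_comp
    (hS.smooth_covD hself.mem_flatDom (h.smooth _ hself.mem_flatDom))).diff
  rw [normalLapAt_eq]
  have h1 := hS.traceIn_second hself.mem_flatDom hA
    (norProj (flatMet γ f x) (flatJ f x) (extChartAt (𝓡 m) x x)) ho
  -- The general trace formula projects the correction term twice, the normal Laplacian once;
  -- idempotence reconciles the two.
  have hidem : ∀ a, norProj (flatMet γ f x) (flatJ f x) (extChartAt (𝓡 m) x x)
      (norProj (flatMet γ f x) (flatJ f x) (extChartAt (𝓡 m) x x) a)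
      = norProj (flatMet γ f x) (flatJ f x) (extChartAt (𝓡 m) x x) a := fun a =>
    hS.norProj_of_normal hself.mem_flatDom (hS.norProj_normal hself.mem_flatDom a)
  simp only [ContinuousLinearMap.comp_apply, hidem] at h1
  rw [← h1]
  simp only [pullAt_base hf, normalCovAt_eq, normalAt_base hf hinj, covCoordAt_base hf hinj,
    h.covAt_base hf]
  congr 2
  funext u v
  have h2 := covAt_operator_base (γ := γ) (B := fun x' v => normalAt (m := m) γ f x' (covAt γ f V x' v)) hf
    (fun x' hx' v => (hx'.norProj_chartD hf hinj _).trans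
      (congrArg _ (h.covAt_chartD hf hx' v))) hA u v
  exact congrArg (fun a => norProj (flatMet γ f x) (flatJ f x) (extChartAt (𝓡 m) x x) a
    - norProj (flatMet γ f x) (flatJ f x) (extChartAt (𝓡 m) x x) (covD (flatConn γ f x) V'
      (extChartAt (𝓡 m) x x) (tanProj (flatMet γ f x) (flatJ f x) (extChartAt (𝓡 m) x x)
        (secondJ (flatConn γ f x) (flatJ f x) (extChartAt (𝓡 m) x x) u v)))) h2

end LaplaciansAtBase

/-! ### Unit normals and curvature traces in codimension one -/

section CodimensionOne

variable {m : ℕ} {b : Euc (m + 1) →L[ℝ] Euc (m + 1) →L[ℝ] ℝ} {J : Euc m →L[ℝ] Euc (m + 1)}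

/-- Orthogonality to the image of `J` amounts to `m` linear equations in `m + 1` unknowns; a nonzero
solution is normalised. -/
theorem exists_unit_normal (hb : IsScalarProduct b) (J : Euc m →L[ℝ] Euc (m + 1)) :
    ∃ ν, b ν ν = 1 ∧ ∀ u, b ν (J u) = 0 := by
  let L : Euc (m + 1) →ₗ[ℝ] (Fin m → ℝ) :=
    LinearMap.pi fun i => (b.flip (J (stdE m i))).toLinearMap
  have hker : LinearMap.ker L ≠ ⊥ := LinearMap.ker_ne_bot_of_finrank_lt (by simp)
  obtain ⟨v, hv, hv0⟩ := (Submodule.ne_bot_iff _).1 hker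
  have hv1 : ∀ u, b v (J u) = 0 := fun u => by
    rw [euc_eq_sum u]
    simp only [map_sum, map_smul]
    refine Finset.sum_eq_zero fun i _ => ?_
    have := congrFun (LinearMap.mem_ker.1 hv) i
    rw [show b v (J (stdE m i)) = 0 from this, smul_zero]
  have hp := hb.pos v hv0
  have hr : Real.sqrt (b v v) * Real.sqrt (b v v) = b v v := Real.mul_self_sqrt hp.le
  have hr0 : Real.sqrt (b v v) ≠ 0 := (Real.sqrt_pos.2 hp).ne'
  refine ⟨(Real.sqrt (b v v))⁻¹ • v, ?_, fun u => by simp [hv1]⟩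
  simp only [map_smul, smul_apply, smul_eq_mul]
  nth_rewrite 3 [← hr]
  field_simp

/-- An orthonormal basis adapted to a hyperplane. -/
theorem isOrthonormal_cons (hb : IsScalarProduct b) {o : Fin m → Euc m}
    (ho : IsOrthonormal (fun u v => b (J u) (J v)) o) {ν : Euc (m + 1)} (hν1 : b ν ν = 1)
    (hν : ∀ u, b ν (J u) = 0) :
    IsOrthonormal (fun u v => b u v) (Fin.cons ν fun i => J (o i) : Fin (m + 1) → Euc (m + 1)) := by
  intro i j
  refine Fin.cases ?_ (fun i => ?_) i <;> refine Fin.cases ?_ (fun j => ?_) j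
  · simp [hν1]
  · simp [hν, (Fin.succ_ne_zero j).symm]
  · simp [hb.symm _ ν, hν]
  · simpa using ho i j

theorem eq_smul_of_normal (hb : IsScalarProduct b) {o : Fin m → Euc m}
    (ho : IsOrthonormal (fun u v => b (J u) (J v)) o) {ν : Euc (m + 1)} (hν1 : b ν ν = 1)
    (hν : ∀ u, b ν (J u) = 0) {a : Euc (m + 1)} (ha : ∀ u, b a (J u) = 0) : a = b a ν • ν := by
  have h := (isOrthonormal_cons hb ho hν1 hν).expand (isBilin_clm b) a
  rw [Fin.sum_univ_succ] at h
  simpa [ha] using h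

theorem eq_zero_of_form (hb : IsScalarProduct b) {o : Fin m → Euc m}
    (ho : IsOrthonormal (fun u v => b (J u) (J v)) o) {ν : Euc (m + 1)} (hν1 : b ν ν = 1)
    (hν : ∀ u, b ν (J u) = 0) {a : Euc (m + 1)} (ha : ∀ u, b a (J u) = 0) (haν : b a ν = 0) :
    a = 0 := by
  rw [eq_smul_of_normal hb ho hν1 hν ha, haν, zero_smul]

variable {Φ : Euc (m + 1) →L[ℝ] Euc (m + 1)} {ξ : Euc (m + 1)} {η : Euc (m + 1) →L[ℝ] ℝ}
  {R : Euc (m + 1) → Euc (m + 1) → Euc (m + 1) → Euc (m + 1)} {c : ℝ}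

/-- The trace of the curvature over a horizontal hyperplane normal. -/
theorem IsSasakianCurvature.sum_curv_hyperplane (h : IsSasakianCurvature b Φ ξ η R c)
    {o : Fin m → Euc m} (ho : IsOrthonormal (fun u v => b (J u) (J v)) o) {ν : Euc (m + 1)}
    (hν1 : b ν ν = 1) (hν : ∀ u, b ν (J u) = 0) (hη : η ν = 0) {X : Euc (m + 1)}
    (hX : ∀ u, b X (J u) = 0) :
    ∑ i, R (J (o i)) X (J (o i))
      = -((c + 3) / 4 * ((m + 1 : ℕ) - 2) + 3 * (c - 1) / 4 + 1) • X := by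
  have hb := h.contact.scalarProduct
  have hXν := eq_smul_of_normal hb ho hν1 hν hX
  have h1 := h.sum_curv (isOrthonormal_cons hb ho hν1 hν) (X := X)
    (by rw [hXν, map_smul, hη, smul_zero])
  rw [Fin.sum_univ_succ] at h1
  simp only [Fin.cons_zero, Fin.cons_succ] at h1
  -- The normal direction contributes nothing, since `X` is a multiple of `ν`. Hence the trace over
  -- the hyperplane equals the full trace.
  have h2 : R ν X ν = 0 := by
    have h3 : R ν ν ν = 0 := by
      have := h.swap ν ν ν
      rw [eq_neg_iff_add_eq_zero, ← two_smul ℝ] at this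
      exact (smul_eq_zero.1 this).resolve_left two_ne_zero
    rw [hXν, (h.bilin₁₂ ν).smul_right, h3, smul_zero]
  rw [h2, zero_add] at h1
  exact h1

end CodimensionOne

/-! ### The bitension field and the mean curvature at a point -/

section BitensionDefinitions

variable {m k : ℕ} {M : Type*} [TopologicalSpace M] [ChartedSpace (Euc m) M]
  {N : Type*} [TopologicalSpace N] [ChartedSpace (Euc k) N] [IsManifold (𝓡 k) ∞ N]
  (γ : Bundle.ContMDiffRiemannianMetric (𝓡 k) ∞ (Euc k) (fun p : N => TangentSpace (𝓡 k) p))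
  (f : M → N) (x : M)

/-- The bitension field, on the model space. -/
def bitensionAt : Euc k := bitension m (metricForm γ) f x

/-- The mean curvature vector field, on the model space. -/
def meanCurvAt : Euc k := meanCurv m (metricForm γ) f x

/-- The squared norm of the second fundamental form. -/
def secondFundNormSqAt : ℝ := secondFundNormSq m (metricForm γ) f x

/-- The shape operator, on the model spaces. -/
def shapeAt (ν : Euc k) (u : Euc m) : Euc m := shapeOp m (metricForm γ) f x ν u

/-- The trace of the shape operators of the derivatives of the mean curvature, on the model
space. -/
def traceShapeAt : Euc m := traceShape m (metricForm γ) f x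

/-- The gradient of the squared mean curvature, on the model space. -/
def gradAt : Euc m := gradMeanCurvSq m (metricForm γ) f x

variable {γ f x}

theorem bitensionAt_eq : bitensionAt (m := m) γ f x
    = - lapAt (m := m) γ f (tensionAt (m := m) γ f) x
      - traceIn (stdE m) (fun u v => pullAt γ f x u v) fun u v =>
          curvAt γ (f x) (mapD f x u) (tensionAt (m := m) γ f x) (mapD f x v) := rfl

theorem meanCurvAt_eq : meanCurvAt (m := m) γ f x
    = (1 / (m : ℝ)) • traceIn (stdE m) (fun u v => pullAt γ f x u v) (secondFundAt γ f x) := rfl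

theorem secondFundNormSqAt_eq : secondFundNormSqAt (m := m) γ f x
    = traceIn (stdE m) (fun u v => pullAt γ f x u v) fun u u' =>
        traceIn (stdE m) (fun u v => pullAt γ f x u v) fun v v' =>
          metricAt γ (f x) (secondFundAt γ f x u v) (secondFundAt γ f x u' v') := rfl

theorem traceShapeAt_eq : traceShapeAt (m := m) γ f x
    = traceIn (stdE m) (fun u v => pullAt γ f x u v) fun u v =>
        shapeAt γ f x (normalCovAt (m := m) γ f (meanCurvAt (m := m) γ f) x u) v := rfl

end BitensionDefinitions

section BitensionAtBase

variable {m k : ℕ} {M : Type*} [TopologicalSpace M] [ChartedSpace (Euc m) M]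
  {N : Type*} [TopologicalSpace N] [ChartedSpace (Euc k) N] [IsManifold (𝓡 k) ∞ N]
  {γ : Bundle.ContMDiffRiemannianMetric (𝓡 k) ∞ (Euc k) (fun p : N => TangentSpace (𝓡 k) p)}
  {f : M → N} {x : M} {o : Fin m → Euc m}

theorem traceIn_pullAt_base {F : Type*} [AddCommGroup F] [Module ℝ F]
    (ho : IsOrthonormal (fun u v => pullAt (m := m) γ f x u v) o) {Q : Euc m → Euc m → F}
    (hQ : IsBilin Q) :
    traceIn (stdE m) (fun u v => pullAt γ f x u v) Q = ∑ i, Q (o i) (o i) :=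
  ho.traceIn_std (isBilin_clm _) hQ

theorem pullAt_gradAt (hinj : ∀ x, Function.Injective (mapD (m := m) (k := k) f x)) (w : Euc m) :
    pullAt γ f x (gradAt (m := m) γ f x) w = funD (fun x' => metricAt γ (f x')
      (meanCurvAt (m := m) γ f x') (meanCurvAt (m := m) γ f x')) x w := by
  have hs := isScalarProduct_pullAt (γ := γ) (hinj x)
  exact form_traceIn_smul (isBilin_clm (pullAt (m := m) γ f x)) hs.symm hs.pos
    (α := fun v => funD (fun x' => metricAt γ (f x')
      (meanCurvAt (m := m) γ f x') (meanCurvAt (m := m) γ f x')) x v) (by simp) (by simp) w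

variable [IsManifold (𝓡 m) ∞ M]

theorem isSectionRep_tension (hf : ContMDiff (𝓡 m) (𝓡 k) ∞ f)
    (hinj : ∀ x, Function.Injective (mapD (m := m) (k := k) f x)) (x : M) :
    IsSectionRep f x (tensionAt (m := m) γ f)
      (flatTau (flatMet (m := m) γ f x) (flatConn γ f x) (flatJ f x)) :=
  ⟨fun _ hx' => hx'.tensionAt_chartD hf hinj,
    fun _ hz => (isSoldered (γ := γ) hf hinj x).smooth_flatTau hz⟩

theorem meanCurvAt_eq_tension (hf : ContMDiff (𝓡 m) (𝓡 k) ∞ f)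
    (hinj : ∀ x, Function.Injective (mapD (m := m) (k := k) f x)) :
    meanCurvAt (m := m) γ f x = (1 / (m : ℝ)) • tensionAt (m := m) γ f x := by
  rw [meanCurvAt_eq, tensionAt_eq_trace hf hinj]

theorem isSectionRep_meanCurv (hf : ContMDiff (𝓡 m) (𝓡 k) ∞ f)
    (hinj : ∀ x, Function.Injective (mapD (m := m) (k := k) f x)) (x : M) :
    IsSectionRep f x (meanCurvAt (m := m) γ f)
      (fun z => (1 / (m : ℝ)) • flatTau (flatMet (m := m) γ f x) (flatConn γ f x) (flatJ f x) z) where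
  eq x' hx' := by
    rw [meanCurvAt_eq_tension hf hinj, map_smul, hx'.tensionAt_chartD hf hinj]
  smooth z hz := ((isSoldered (γ := γ) hf hinj x).smooth_flatTau hz).const_smul _

theorem curvAt_base (hf : ContMDiff (𝓡 m) (𝓡 k) ∞ f) (u w : Euc m) (a : Euc k) :
    curvForm (flatConn γ f x) (extChartAt (𝓡 m) x x) u w a
      = curvAt γ (f x) (mapD f x u) (mapD f x w) a := by
  have hself := NearBase.self (m := m) (k := k) (f := f) (x := x)
  have htar := flatMap_mem_target hself.mem_flatDom
  have h1 := curvForm_pullback (contDiffAt_flatMap hf hself.mem_flatDom)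
    (contDiffAt_lcConn (isScalarProduct_metricRep (γ := γ) htar) (smooth_metricRep htar)) u w a
  have h2 := (isMetricRep_metricRep (γ := γ) (f x)).curvature_eq
    (by rw [← hself.flatMap_eq]; exact htar) (mapD f x u) (mapD f x w) a
  rw [hself.flatMap_eq, ← flatJ, ← mapD_base hf, ← mapD_base hf] at h1
  exact h1.trans h2.symm

theorem secondFundNormSqAt_eq_sum (hf : ContMDiff (𝓡 m) (𝓡 k) ∞ f)
    (hinj : ∀ x, Function.Injective (mapD (m := m) (k := k) f x))
    (ho : IsOrthonormal (fun u v => pullAt (m := m) γ f x u v) o) :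
    secondFundNormSqAt (m := m) γ f x
      = ∑ i, ∑ j, metricAt γ (f x) (secondFundAt γ f x (o i) (o j))
          (secondFundAt γ f x (o i) (o j)) := by
  have hB := isBilin_secondFundAt (γ := γ) (x := x) hf hinj
  have h1 : ∀ u u', traceIn (stdE m) (fun u v => pullAt γ f x u v) (fun v v' =>
      metricAt γ (f x) (secondFundAt γ f x u v) (secondFundAt γ f x u' v'))
      = ∑ j, metricAt γ (f x) (secondFundAt γ f x u (o j)) (secondFundAt γ f x u' (o j)) :=
    fun u u' => traceIn_pullAt_base ho
      ⟨fun _ _ _ => by rw [hB.add_right, map_add, add_apply],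
        fun _ _ _ => by rw [hB.smul_right, map_smul, smul_apply],
        fun _ _ _ => by rw [hB.add_right, map_add], fun _ _ _ => by rw [hB.smul_right, map_smul]⟩
  rw [secondFundNormSqAt_eq]
  simp only [h1]
  refine traceIn_pullAt_base ho ⟨fun _ _ _ => ?_, fun _ _ _ => ?_, fun _ _ _ => ?_, fun _ _ _ => ?_⟩
  · simp only [hB.add_left, map_add, add_apply, Finset.sum_add_distrib]
  · simp only [hB.smul_left, map_smul, smul_apply, Finset.smul_sum]
  · simp only [hB.add_left, map_add, Finset.sum_add_distrib]
  · simp only [hB.smul_left, map_smul, Finset.smul_sum]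

theorem pullAt_shapeAt (hf : ContMDiff (𝓡 m) (𝓡 k) ∞ f)
    (hinj : ∀ x, Function.Injective (mapD (m := m) (k := k) f x)) (ν : Euc k) (u w : Euc m) :
    pullAt γ f x (shapeAt γ f x ν u) w = metricAt γ (f x) (secondFundAt γ f x u w) ν := by
  have hs := isScalarProduct_pullAt (γ := γ) (hinj x)
  have hB := isBilin_secondFundAt (γ := γ) (x := x) hf hinj
  exact form_traceIn_smul (isBilin_clm (pullAt (m := m) γ f x)) hs.symm hs.pos
    (α := fun v => metricAt γ (f x) (secondFundAt γ f x u v) ν)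
    (fun _ _ => by simp only [hB.add_right, map_add, add_apply])
    (fun _ _ => by simp only [hB.smul_right, map_smul, smul_apply, smul_eq_mul]) w

theorem pullAt_gradAt_base (hf : ContMDiff (𝓡 m) (𝓡 k) ∞ f)
    (hinj : ∀ x, Function.Injective (mapD (m := m) (k := k) f x)) (w : Euc m) :
    pullAt γ f x (gradAt (m := m) γ f x) w = (1 / (m : ℝ)) ^ 2 * fderiv ℝ (fun y =>
      flatMet γ f x y (flatTau (flatMet γ f x) (flatConn γ f x) (flatJ f x) y)
        (flatTau (flatMet γ f x) (flatConn γ f x) (flatJ f x) y)) (extChartAt (𝓡 m) x x) w := by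
  have hself := NearBase.self (m := m) (k := k) (f := f) (x := x)
  have hS := isSoldered (γ := γ) hf hinj x
  have hτ := hS.smooth_flatTau hself.mem_flatDom
  have hd : DifferentiableAt ℝ (fun y =>
      flatMet γ f x y (flatTau (flatMet γ f x) (flatConn γ f x) (flatJ f x) y)
        (flatTau (flatMet γ f x) (flatConn γ f x) (flatJ f x) y)) (extChartAt (𝓡 m) x x) :=
    (((hS.smooth_g _ hself.mem_flatDom).clm_apply hτ).clm_apply hτ).diff
  rw [pullAt_gradAt hinj, funD_of_chart (ĥ := fun y => (1 / (m : ℝ)) ^ 2 *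
      flatMet γ f x y (flatTau (flatMet γ f x) (flatConn γ f x) (flatJ f x) y)
        (flatTau (flatMet γ f x) (flatConn γ f x) (flatJ f x) y)) hself.dom ?_ (hd.const_mul _),
    fderiv_const_mul hd, chartD_self]
  · rfl
  · filter_upwards [hself.eventually hf.continuous.continuousAt] with x' hx'
    rw [← hx'.tensionAt_chartD hf hinj, hx'.flatMet_chartD, meanCurvAt_eq_tension hf hinj]
    simp only [map_smul, smul_apply, smul_eq_mul]
    ring

theorem pullAt_traceShapeAt (hf : ContMDiff (𝓡 m) (𝓡 k) ∞ f)
    (hinj : ∀ x, Function.Injective (mapD (m := m) (k := k) f x))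
    (ho : IsOrthonormal (fun u v => pullAt (m := m) γ f x u v) o) (w : Euc m) :
    pullAt γ f x (traceShapeAt (m := m) γ f x) w
      = ∑ i, metricAt γ (f x) (secondFundAt γ f x (o i) w)
          (normalCovAt (m := m) γ f (meanCurvAt (m := m) γ f) x (o i)) := by
  have hB := isBilin_secondFundAt (γ := γ) (x := x) hf hinj
  have h1 := map_traceIn ((pullAt (m := m) γ f x).flip w) (stdE m) (fun u v => pullAt γ f x u v)
    fun u v => shapeAt γ f x (normalCovAt (m := m) γ f (meanCurvAt (m := m) γ f) x u) v
  rw [← traceShapeAt_eq] at h1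
  have hself := NearBase.self (m := m) (k := k) (f := f) (x := x)
  have hN : ∀ u, normalCovAt (m := m) γ f (meanCurvAt (m := m) γ f) x u
      = norProj (flatMet γ f x) (flatJ f x) (extChartAt (𝓡 m) x x)
        (covD (flatConn γ f x) (fun z => (1 / (m : ℝ)) • flatTau (flatMet γ f x) (flatConn γ f x)
          (flatJ f x) z) (extChartAt (𝓡 m) x x) u) := fun u => by
    rw [normalCovAt_eq, normalAt_base hf hinj, (isSectionRep_meanCurv hf hinj x).covAt_base hf]
  simp only [ContinuousLinearMap.flip_apply, pullAt_shapeAt hf hinj] at h1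
  rw [h1]
  exact traceIn_pullAt_base ho
    ⟨fun _ _ _ => by simp only [hN, map_add], fun _ _ _ => by simp only [hN, map_smul],
      fun _ _ _ => by simp only [hB.add_left, map_add, add_apply],
      fun _ _ _ => by simp only [hB.smul_left, map_smul, smul_apply]⟩

end BitensionAtBase

/-! ### Splitting the bitension field of a hypersurface -/

section BitensionOfHypersurface

variable {m : ℕ} {M : Type*} [TopologicalSpace M] [ChartedSpace (Euc m) M]
  {N : Type*} [TopologicalSpace N] [ChartedSpace (Euc (m + 1)) N] [IsManifold (𝓡 (m + 1)) ∞ N]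
  {γ : Bundle.ContMDiffRiemannianMetric (𝓡 (m + 1)) ∞ (Euc (m + 1))
    (fun p : N => TangentSpace (𝓡 (m + 1)) p)}
  {f : M → N} {x : M} [IsManifold (𝓡 m) ∞ M]
  {Φ : Euc (m + 1) →L[ℝ] Euc (m + 1)} {ξ : Euc (m + 1)} {η : Euc (m + 1) →L[ℝ] ℝ} {c : ℝ}
  {o : Fin m → Euc m} {ν : Euc (m + 1)}

/-- The constant `κ` with `Ric X = κ X` for horizontal `X` on a Sasakian space form of dimension
`m + 1`. -/
def ricConst (m : ℕ) (c : ℝ) : ℝ := (c + 3) / 4 * ((m + 1 : ℕ) - 2) + 3 * (c - 1) / 4 + 1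

theorem tensionAt_base (hf : ContMDiff (𝓡 m) (𝓡 (m + 1)) ∞ f)
    (hinj : ∀ x, Function.Injective (mapD (m := m) (k := m + 1) f x)) :
    tensionAt (m := m) γ f x = flatTau (flatMet γ f x) (flatConn γ f x) (flatJ f x)
      (extChartAt (𝓡 m) x x) :=
  (isSectionRep_tension hf hinj x).eq_base

theorem tensionAt_normal (hf : ContMDiff (𝓡 m) (𝓡 (m + 1)) ∞ f)
    (hinj : ∀ x, Function.Injective (mapD (m := m) (k := m + 1) f x)) (u : Euc m) :
    metricAt γ (f x) (tensionAt (m := m) γ f x) (mapD f x u) = 0 := by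
  rw [tensionAt_base hf hinj, metricAt_base (m := m), mapD_base hf]
  exact (isSoldered hf hinj x).flatTau_normal NearBase.self.mem_flatDom u

/-- The curvature trace is `-κτ` because `τ` is normal and the normal is horizontal; with the sign
in the bitension field this adds `κτ` to the rough Laplacian term. -/
theorem bitensionAt_eq_sum (hf : ContMDiff (𝓡 m) (𝓡 (m + 1)) ∞ f)
    (hinj : ∀ x, Function.Injective (mapD (m := m) (k := m + 1) f x))
    (hR : IsSasakianCurvature (metricAt γ (f x)) Φ ξ η (curvAt γ (f x)) c)
    (ho : IsOrthonormal (fun u v => pullAt (m := m) γ f x u v) o)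
    (hν1 : metricAt γ (f x) ν ν = 1) (hν : ∀ u : Euc m, metricAt γ (f x) ν (mapD f x u) = 0)
    (hη : η ν = 0) :
    bitensionAt (m := m) γ f x = (∑ i, covD (flatConn γ f x)
      (fun y => covD (flatConn γ f x) (flatTau (flatMet γ f x) (flatConn γ f x) (flatJ f x)) y
        (parField (flatMet γ f x) (flatConn γ f x) (flatJ f x) (extChartAt (𝓡 m) x x) (o i) y))
      (extChartAt (𝓡 m) x x) (o i)) + ricConst m c • tensionAt (m := m) γ f x := by
  have ho' : IsOrthonormal (fun u v => indMet (flatMet γ f x) (flatJ f x)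
      (extChartAt (𝓡 m) x x) u v) o := fun i j =>
    (pullAt_base hf _ _).symm.trans (ho i j)
  have h1 : IsBilin fun u v : Euc m => curvAt γ (f x) (mapD f x u) (tensionAt (m := m) γ f x)
      (mapD f x v) :=
    ⟨fun _ _ _ => by rw [map_add, (hR.bilin₁₂ _).add_left],
      fun _ _ _ => by rw [map_smul, (hR.bilin₁₂ _).smul_left],
      fun _ _ _ => by rw [map_add, (hR.bilin₂₃ _).add_right],
      fun _ _ _ => by rw [map_smul, (hR.bilin₂₃ _).smul_right]⟩
  have h2 := hR.sum_curv_hyperplane (J := mapD f x) ho hν1 hν hη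
    (X := tensionAt (m := m) γ f x) (tensionAt_normal hf hinj)
  rw [bitensionAt_eq, lapAt_base (isSectionRep_tension hf hinj x) hf hinj ho', neg_neg,
    traceIn_pullAt_base ho h1, h2, neg_smul, sub_neg_eq_add]
  rfl

/-- The tangential part of the bitension field. -/
theorem bitensionAt_tangential (hm : (m : ℝ) ≠ 0) (hf : ContMDiff (𝓡 m) (𝓡 (m + 1)) ∞ f)
    (hinj : ∀ x, Function.Injective (mapD (m := m) (k := m + 1) f x))
    (hR : IsSasakianCurvature (metricAt γ (f x)) Φ ξ η (curvAt γ (f x)) c)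
    (ho : IsOrthonormal (fun u v => pullAt (m := m) γ f x u v) o)
    (hν1 : metricAt γ (f x) ν ν = 1) (hν : ∀ u : Euc m, metricAt γ (f x) ν (mapD f x u) = 0)
    (hη : η ν = 0) (w : Euc m) :
    metricAt γ (f x) (bitensionAt (m := m) γ f x) (mapD f x w)
      = - m * pullAt γ f x ((2 : ℝ) • traceShapeAt (m := m) γ f x
          + ((m : ℝ) / 2) • gradAt (m := m) γ f x) w := by
  have hself := NearBase.self (m := m) (k := m + 1) (f := f) (x := x)
  have hS := isSoldered (γ := γ) hf hinj x
  have ho' : IsOrthonormal (fun u v => indMet (flatMet γ f x) (flatJ f x)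
      (extChartAt (𝓡 m) x x) u v) o := fun i j =>
    (pullAt_base hf _ _).symm.trans (ho i j)
  have hsym := (isScalarProduct_metricAt (γ := γ) (f x)).symm
  have htan := hS.sum_form_second_tangent hself.mem_flatDom ho' w
  -- Pair symmetry moves the trace onto `τ`, where it gives a multiple of `τ`, orthogonal to tangent
  -- vectors.
  have hcurv : ∑ i, metricAt γ (f x) (tensionAt (m := m) γ f x)
      (curvAt γ (f x) (mapD f x (o i)) (mapD f x w) (mapD f x (o i))) = 0 := by
    have h2 := hR.sum_curv_hyperplane (J := mapD f x) ho hν1 hν hη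
      (X := tensionAt (m := m) γ f x) (tensionAt_normal hf hinj)
    have h3 := congrArg (fun a => metricAt γ (f x) a (mapD f x w)) h2
    simp only [map_smul, smul_apply, tensionAt_normal hf hinj, smul_zero, map_sum,
      sum_apply] at h3
    rw [← h3]
    refine Finset.sum_congr rfl fun i _ => ?_
    rw [hsym, hR.pair_symm]
  have hshape := pullAt_traceShapeAt (γ := γ) hf hinj ho w
  have hgrad := pullAt_gradAt_base (γ := γ) (x := x) hf hinj w
  have hBn : ∀ i u, flatMet γ f x (extChartAt (𝓡 m) x x)
      (flatB (flatMet γ f x) (flatConn γ f x) (flatJ f x) (extChartAt (𝓡 m) x x) (o i) w)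
      (flatJ f x (extChartAt (𝓡 m) x x) u) = 0 := fun i u =>
    hS.norProj_normal hself.mem_flatDom _ u
  have hshape' : (m : ℝ) * pullAt γ f x (traceShapeAt (m := m) γ f x) w
      = ∑ i, flatMet γ f x (extChartAt (𝓡 m) x x) (covD (flatConn γ f x)
        (flatTau (flatMet γ f x) (flatConn γ f x) (flatJ f x)) (extChartAt (𝓡 m) x x) (o i))
        (flatB (flatMet γ f x) (flatConn γ f x) (flatJ f x) (extChartAt (𝓡 m) x x) (o i) w) := by
    rw [hshape, Finset.mul_sum]
    refine Finset.sum_congr rfl fun i _ => ?_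
    rw [secondFundAt_base hf hinj, normalCovAt_eq, normalAt_base hf hinj,
      (isSectionRep_meanCurv hf hinj x).covAt_base hf, metricAt_base (m := m),
      IsSoldered.form_norProj (hBn i),
      covD_smul _ (hS.smooth_flatTau hself.mem_flatDom).diff, map_smul, smul_eq_mul,
      (hS.scalarProduct _ hself.mem_flatDom).symm, ← mul_assoc, mul_one_div_cancel hm, one_mul]
  rw [bitensionAt_eq_sum hf hinj hR ho hν1 hν hη, map_add, add_apply, map_smul, smul_apply,
    tensionAt_normal hf hinj, smul_zero, add_zero, map_sum, sum_apply, map_add, add_apply,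
    map_smul, map_smul, smul_apply, smul_apply, hgrad]
  simp only [curvAt_base hf, ← mapD_base hf, ← metricAt_base (m := m), ← tensionAt_base hf hinj,
    hcurv] at htan hshape'
  -- Since `τ = mH`, the first sum is `m` times the shape trace and the derivative of `|τ|²` is `m²`
  -- times that of `‖H‖²`; taking out `-m` leaves the coefficients `2` and `m/2`.
  rw [htan, ← hshape']
  simp only [smul_eq_mul]
  field_simp
  ring

theorem normalLapAt_normal (hf : ContMDiff (𝓡 m) (𝓡 (m + 1)) ∞ f)
    (hinj : ∀ x, Function.Injective (mapD (m := m) (k := m + 1) f x)) (u : Euc m) :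
    metricAt γ (f x) (normalLapAt (m := m) γ f (meanCurvAt (m := m) γ f) x) (mapD f x u) = 0 := by
  have hself := NearBase.self (m := m) (k := m + 1) (f := f) (x := x)
  have hS := isSoldered (γ := γ) hf hinj x
  have hs := isScalarProduct_pullAt (γ := γ) (hinj x)
  obtain ⟨o, ho⟩ := exists_isOrthonormal (isBilin_clm (pullAt (m := m) γ f x)) hs.symm hs.pos
  have ho' : IsOrthonormal (fun u v => indMet (flatMet γ f x) (flatJ f x)
      (extChartAt (𝓡 m) x x) u v) o := fun i j =>
    (pullAt_base hf _ _).symm.trans (ho i j)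
  rw [normalLapAt_base (isSectionRep_meanCurv hf hinj x) hf hinj ho', metricAt_base (m := m),
    mapD_base hf]
  simp only [map_neg, neg_apply, map_sum, sum_apply, hS.norProj_normal hself.mem_flatDom,
    Finset.sum_const_zero, neg_zero]

/-- The normal part of the bitension field. -/
theorem bitensionAt_normal (hm : (m : ℝ) ≠ 0) (hf : ContMDiff (𝓡 m) (𝓡 (m + 1)) ∞ f)
    (hinj : ∀ x, Function.Injective (mapD (m := m) (k := m + 1) f x))
    (hR : IsSasakianCurvature (metricAt γ (f x)) Φ ξ η (curvAt γ (f x)) c)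
    (ho : IsOrthonormal (fun u v => pullAt (m := m) γ f x u v) o)
    (hν1 : metricAt γ (f x) ν ν = 1) (hν : ∀ u : Euc m, metricAt γ (f x) ν (mapD f x u) = 0)
    (hη : η ν = 0) :
    metricAt γ (f x) (bitensionAt (m := m) γ f x) ν
      = - m * metricAt γ (f x) (normalLapAt (m := m) γ f (meanCurvAt (m := m) γ f) x
          - (-secondFundNormSqAt (m := m) γ f x + ricConst m c) • meanCurvAt (m := m) γ f x) ν := by
  have hself := NearBase.self (m := m) (k := m + 1) (f := f) (x := x)
  have hS := isSoldered (γ := γ) hf hinj x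
  have ho' : IsOrthonormal (fun u v => indMet (flatMet γ f x) (flatJ f x)
      (extChartAt (𝓡 m) x x) u v) o := fun i j =>
    (pullAt_base hf _ _).symm.trans (ho i j)
  have hsp := isScalarProduct_metricAt (γ := γ) (f x)
  have hsym := hsp.symm
  have hν' : ∀ u, flatMet γ f x (extChartAt (𝓡 m) x x) ν (flatJ f x (extChartAt (𝓡 m) x x) u)
      = 0 := fun u => by rw [← metricAt_base (m := m), ← mapD_base hf, hν]
  have hnor := hS.sum_form_second_normal hself.mem_flatDom ho'
    (by rw [← metricAt_base (m := m), hν1]) hν'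
    (fun a ha => by
      rw [← metricAt_base (m := m)]
      refine eq_smul_of_normal (J := mapD f x) hsp ho hν1 hν fun u => ?_
      rw [metricAt_base (m := m), mapD_base hf, ha])
    (fun z hz => hS.smooth_flatTau hz) (fun z hz => hS.flatTau_normal hz)
  -- The factor `m` turns `H` into `τ`, and pairing with `ν` absorbs the outer normal projection.
  have hlap : (m : ℝ) * metricAt γ (f x)
      (normalLapAt (m := m) γ f (meanCurvAt (m := m) γ f) x) ν
      = - ∑ i, flatMet γ f x (extChartAt (𝓡 m) x x) (covD (flatConn γ f x)
          (fun y => norProj (flatMet γ f x) (flatJ f x) y (covD (flatConn γ f x)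
            (flatTau (flatMet γ f x) (flatConn γ f x) (flatJ f x)) y (parField (flatMet γ f x)
              (flatConn γ f x) (flatJ f x) (extChartAt (𝓡 m) x x) (o i) y)))
          (extChartAt (𝓡 m) x x) (o i)) ν := by
    rw [normalLapAt_base (isSectionRep_meanCurv hf hinj x) hf hinj ho', metricAt_base (m := m)]
    simp only [map_neg, neg_apply, map_sum, sum_apply]
    rw [mul_neg, Finset.mul_sum]
    congr 1
    refine Finset.sum_congr rfl fun i _ => ?_
    rw [(hS.scalarProduct _ hself.mem_flatDom).symm, IsSoldered.form_norProj hν',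
      (hS.scalarProduct _ hself.mem_flatDom).symm]
    have hev : (fun y => norProj (flatMet γ f x) (flatJ f x) y (covD (flatConn γ f x)
        (fun z => (1 / (m : ℝ)) • flatTau (flatMet γ f x) (flatConn γ f x) (flatJ f x) z) y
          (parField (flatMet γ f x) (flatConn γ f x) (flatJ f x) (extChartAt (𝓡 m) x x) (o i) y)))
        =ᶠ[𝓝 (extChartAt (𝓡 m) x x)] fun y => (1 / (m : ℝ)) • norProj (flatMet γ f x) (flatJ f x) y
          (covD (flatConn γ f x) (flatTau (flatMet γ f x) (flatConn γ f x) (flatJ f x)) y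
          (parField (flatMet γ f x) (flatConn γ f x) (flatJ f x)
            (extChartAt (𝓡 m) x x) (o i) y)) := by
      filter_upwards [hS.mem_nhds hself.mem_flatDom] with y hy
      rw [covD_smul _ (hS.smooth_flatTau hy).diff, map_smul]
    have hd : DifferentiableAt ℝ (fun y => norProj (flatMet γ f x) (flatJ f x) y
          (covD (flatConn γ f x) (flatTau (flatMet γ f x) (flatConn γ f x) (flatJ f x)) y
          (parField (flatMet γ f x) (flatConn γ f x) (flatJ f x)
            (extChartAt (𝓡 m) x x) (o i) y))) (extChartAt (𝓡 m) x x) :=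
      ((hS.smooth_norProj hself.mem_flatDom).clm_apply
        (hS.smooth_covD_apply hself.mem_flatDom (hS.smooth_flatTau hself.mem_flatDom)
          (contDiff_parField _ _).contDiffAt)).diff
    rw [covD_congr hev, covD_smul _ hd, map_smul, smul_apply, smul_eq_mul, ← mul_assoc,
      mul_one_div_cancel hm, one_mul]
  have hB := secondFundNormSqAt_eq_sum (γ := γ) (x := x) hf hinj ho
  simp only [secondFundAt_base hf hinj, metricAt_base (m := m)] at hB
  rw [← hB, ← tensionAt_base hf hinj] at hnor
  have hH : (m : ℝ) * metricAt γ (f x) (meanCurvAt (m := m) γ f x) ν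
      = metricAt γ (f x) (tensionAt (m := m) γ f x) ν := by
    rw [meanCurvAt_eq_tension hf hinj, map_smul, smul_apply, smul_eq_mul, ← mul_assoc,
      mul_one_div_cancel hm, one_mul]
  rw [bitensionAt_eq_sum hf hinj hR ho hν1 hν hη, map_add, add_apply, map_smul, smul_apply,
    map_sum, sum_apply]
  simp only [← metricAt_base (m := m)] at hnor hlap
  rw [hnor, map_sub, sub_apply, map_smul, smul_apply, mul_sub, neg_mul, hlap]
  simp only [smul_eq_mul]
  linear_combination (-(-secondFundNormSqAt (m := m) γ f x + ricConst m c)) * hH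

/-- The bitension field of a hypersurface of a Sasakian space form whose normal vectors are
horizontal. -/
theorem bitensionAt_eq_zero_iff (hm : (m : ℝ) ≠ 0) (hf : ContMDiff (𝓡 m) (𝓡 (m + 1)) ∞ f)
    (hinj : ∀ x, Function.Injective (mapD (m := m) (k := m + 1) f x))
    (hR : IsSasakianCurvature (metricAt γ (f x)) Φ ξ η (curvAt γ (f x)) c)
    (hη : ∀ ν : Euc (m + 1), (∀ u : Euc m, metricAt γ (f x) ν (mapD f x u) = 0) → η ν = 0) :
    bitensionAt (m := m) γ f x = 0 ↔
      normalLapAt (m := m) γ f (meanCurvAt (m := m) γ f) x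
        = (-secondFundNormSqAt (m := m) γ f x + ricConst m c) • meanCurvAt (m := m) γ f x ∧
      (2 : ℝ) • traceShapeAt (m := m) γ f x + ((m : ℝ) / 2) • gradAt (m := m) γ f x = 0 := by
  have hs := isScalarProduct_pullAt (γ := γ) (hinj x)
  have hsp := isScalarProduct_metricAt (γ := γ) (f x)
  obtain ⟨o, ho⟩ := exists_isOrthonormal (isBilin_clm (pullAt (m := m) γ f x)) hs.symm hs.pos
  -- The tangent space together with `ν` spans, so the products with `df(w)` and with `ν` determine
  -- the bitension field.
  obtain ⟨ν, hν1, hν⟩ := exists_unit_normal hsp (mapD f x)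
  have hT := bitensionAt_tangential hm hf hinj hR ho hν1 hν (hη ν hν)
  have hN := bitensionAt_normal hm hf hinj hR ho hν1 hν (hη ν hν)
  have hm' : -(m : ℝ) ≠ 0 := neg_ne_zero.2 hm
  constructor
  · intro h0
    rw [h0] at hN
    simp only [h0, map_zero, zero_apply] at hT hN
    refine ⟨sub_eq_zero.1 (eq_zero_of_form (J := mapD f x) hsp ho hν1 hν (fun u => ?_) ?_), ?_⟩
    · rw [map_sub, sub_apply, normalLapAt_normal hf hinj, map_smul, smul_apply,
        meanCurvAt_eq_tension hf hinj, map_smul, smul_apply, tensionAt_normal hf hinj]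
      simp
    · exact (mul_eq_zero.1 hN.symm).resolve_left hm'
    · refine hs.ext fun w => ?_
      rw [map_zero, zero_apply]
      exact (mul_eq_zero.1 (hT w).symm).resolve_left hm'
  · rintro ⟨h1, h2⟩
    refine eq_zero_of_form (J := mapD f x) hsp ho hν1 hν (fun u => ?_) ?_
    · rw [hT, h2]; simp
    · rw [hN, h1]; simp

end BitensionOfHypersurface

/-! ### Lie brackets in charts -/

section Bracket

variable {k : ℕ} {N : Type*} [TopologicalSpace N] [ChartedSpace (Euc k) N]

/-- The coordinate expression of a vector field in the preferred chart around `y`. -/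
def fieldRep (y : N) (X : ∀ q : N, TangentSpace (𝓡 k) q) (z : Euc k) : Euc k :=
  chartD y ((extChartAt (𝓡 k) y).symm z) (X ((extChartAt (𝓡 k) y).symm z))

variable [IsManifold (𝓡 k) ∞ N] {y : N} {z : Euc k}

theorem mfderiv_chart_symm_inverse (hz : z ∈ (extChartAt (𝓡 k) y).target) :
    (mfderiv 𝓘(ℝ, Euc k) (𝓡 k) (extChartAt (𝓡 k) y).symm z : Euc k →L[ℝ] Euc k).inverse
      = chartD y ((extChartAt (𝓡 k) y).symm z) := by
  have h1 := mfderiv_extChartAt_comp_mfderivWithin_extChartAt_symm (I := 𝓡 k) (x := y) hz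
  have h2 := mfderivWithin_extChartAt_symm_comp_mfderiv_extChartAt (I := 𝓡 k) (x := y) hz
  rw [ModelWithCorners.range_eq_univ, mfderivWithin_univ] at h1 h2
  exact ContinuousLinearMap.inverse_eq h2 h1

theorem contDiffAt_fieldRep (hz : z ∈ (extChartAt (𝓡 k) y).target)
    {X : ∀ q : N, TangentSpace (𝓡 k) q} (hX : FieldSmoothAt X ((extChartAt (𝓡 k) y).symm z)) :
    ContDiffAt ℝ ∞ (fieldRep y X) z :=
  contDiffAt_comp_symm hz
    ((contMDiffAt_field_iff ((extChartAt (𝓡 k) y).map_target hz) X).1 hX)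

/-- The Lie bracket of two vector fields, read in a chart. -/
theorem chartD_mlieBracket (hz : z ∈ (extChartAt (𝓡 k) y).target)
    {X Y : ∀ q : N, TangentSpace (𝓡 k) q} (hX : FieldSmoothAt X ((extChartAt (𝓡 k) y).symm z))
    (hY : FieldSmoothAt Y ((extChartAt (𝓡 k) y).symm z)) :
    chartD y ((extChartAt (𝓡 k) y).symm z)
        (VectorField.mlieBracket (𝓡 k) X Y ((extChartAt (𝓡 k) y).symm z))
      = fderiv ℝ (fieldRep y Y) z (fieldRep y X z) - fderiv ℝ (fieldRep y X) z (fieldRep y Y z) := by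
  have : IsManifold (𝓡 k) (minSmoothness ℝ 3) N := by
    rw [minSmoothness_of_isRCLikeNormedField]
    exact IsManifold.of_le (n := ∞) (WithTop.coe_le_coe.2 (le_top (a := (3 : ℕ∞))))
  have hn : minSmoothness ℝ 2 ≤ (∞ : WithTop ℕ∞) := by
    rw [minSmoothness_of_isRCLikeNormedField]; exact WithTop.coe_le_coe.2 (le_top (a := (2 : ℕ∞)))
  -- Pull-back by the inverse chart commutes with brackets, and in the vector space the bracket is
  -- the commutator of derivatives.
  have h := VectorField.mpullback_mlieBracket (n := ∞) (hX.mdifferentiableAt (by simp))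
    (hY.mdifferentiableAt (by simp)) (contMDiffAt_chart_symm hz) hn
  rw [VectorField.mpullback_apply] at h
  have hpull : ∀ W : (∀ q : N, TangentSpace (𝓡 k) q),
      VectorField.mpullback 𝓘(ℝ, Euc k) (𝓡 k) (extChartAt (𝓡 k) y).symm W =ᶠ[𝓝 z] fieldRep y W := by
    intro W
    filter_upwards [(isOpen_extChartAt_target y).mem_nhds hz] with z' hz'
    exact congrArg (fun L : Euc k →L[ℝ] Euc k => L (W ((extChartAt (𝓡 k) y).symm z')))
      (mfderiv_chart_symm_inverse hz')
  have h2 := Filter.EventuallyEq.mlieBracket_vectorField_eq (hpull X) (hpull Y)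
  have h3 := (congrFun (VectorField.mlieBracketWithin_eq_lieBracketWithin (𝕜 := ℝ)
    (V := fieldRep y X) (W := fieldRep y Y) (s := Set.univ)) z).trans
    (congrFun VectorField.lieBracketWithin_univ z)
  have h4 := congrArg (fun L : Euc k →L[ℝ] Euc k =>
    L (VectorField.mlieBracket (𝓡 k) X Y ((extChartAt (𝓡 k) y).symm z)))
      (mfderiv_chart_symm_inverse hz)
  exact h4.symm.trans (h.trans (h2.trans h3))

theorem fieldRep_coordField (hz : z ∈ (extChartAt (𝓡 k) y).target) (v : Euc k) :
    fieldRep y (coordField y v) =ᶠ[𝓝 z] fun _ => v := by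
  filter_upwards [(isOpen_extChartAt_target y).mem_nhds hz] with z' hz'
  exact chartD_coordField ((extChartAt (𝓡 k) y).map_target hz') v

end Bracket

/-! ### The Sasakian structure of the manifold in charts -/

namespace ContactMetricStructure

variable {n : ℕ} {N : Type*} [TopologicalSpace N] [ChartedSpace (Euc (2 * n + 1)) N]
  [IsManifold (𝓡 (2 * n + 1)) ∞ N] (S : ContactMetricStructure n N)

/-- The tensor field `φ` at a point, on the model space. -/
def phiAt (p : N) : Euc (2 * n + 1) →L[ℝ] Euc (2 * n + 1) := S.phi p

/-- The vector field `ξ` at a point, in the model space. -/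
def xiAt (p : N) : Euc (2 * n + 1) := S.xi p

/-- The one-form `η` at a point, on the model space. -/
def etaAt (p : N) : Euc (2 * n + 1) →L[ℝ] ℝ := S.eta p

/-- The coordinate expression of `φ` in the preferred chart around `y`. -/
def phiRep (y : N) (z : Euc (2 * n + 1)) : Euc (2 * n + 1) →L[ℝ] Euc (2 * n + 1) :=
  (chartD y ((extChartAt (𝓡 (2 * n + 1)) y).symm z)).comp
    ((S.phiAt ((extChartAt (𝓡 (2 * n + 1)) y).symm z)).comp
      (chartD y ((extChartAt (𝓡 (2 * n + 1)) y).symm z)).inverse)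

/-- The coordinate expression of `η` in the preferred chart around `y`. -/
def etaRep (y : N) (z : Euc (2 * n + 1)) : Euc (2 * n + 1) →L[ℝ] ℝ :=
  (S.etaAt ((extChartAt (𝓡 (2 * n + 1)) y).symm z)).comp
    (chartD y ((extChartAt (𝓡 (2 * n + 1)) y).symm z)).inverse

variable {S} {y : N} {z : Euc (2 * n + 1)}

theorem fieldSmoothAt_phi {X : ∀ q : N, TangentSpace (𝓡 (2 * n + 1)) q} {p : N}
    (hX : FieldSmoothAt X p) : FieldSmoothAt (fun q => S.phi q (X q)) p :=
  ContMDiffAt.clm_bundle_apply (F₁ := Euc (2 * n + 1)) (F₂ := Euc (2 * n + 1))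
    (b := fun q : N => q) S.phi_smooth.contMDiffAt hX

theorem contMDiffAt_eta {X : ∀ q : N, TangentSpace (𝓡 (2 * n + 1)) q} {p : N}
    (hX : FieldSmoothAt X p) :
    ContMDiffAt (𝓡 (2 * n + 1)) 𝓘(ℝ, ℝ) ∞ (fun q => S.eta q (X q)) p := by
  have h1 := ContMDiffAt.clm_bundle_apply (F₁ := Euc (2 * n + 1)) (F₂ := ℝ)
    (E₂ := Bundle.Trivial N ℝ) (b := fun q : N => q) (x := p) S.eta_smooth.contMDiffAt hX
  rw [Bundle.contMDiffAt_totalSpace] at h1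
  exact h1.2

theorem contDiffAt_phiRep (hz : z ∈ (extChartAt (𝓡 (2 * n + 1)) y).target) :
    ContDiffAt ℝ ∞ (S.phiRep y) z := by
  refine contDiffAt_clm (isOpen_extChartAt_target y) (fun z hz v => ?_) hz
  exact contDiffAt_fieldRep hz (fieldSmoothAt_phi
    (coordField_smooth ((extChartAt (𝓡 (2 * n + 1)) y).map_target hz) v))

theorem contDiffAt_etaRep (hz : z ∈ (extChartAt (𝓡 (2 * n + 1)) y).target) :
    ContDiffAt ℝ ∞ (S.etaRep y) z := by
  refine contDiffAt_clm (isOpen_extChartAt_target y) (fun z hz v => ?_) hz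
  exact contDiffAt_comp_symm hz (contMDiffAt_eta
    (coordField_smooth ((extChartAt (𝓡 (2 * n + 1)) y).map_target hz) v))

variable (S) in
theorem isAlmostContact (p : N) :
    IsAlmostContact (metricAt S.metric p) (S.phiAt p) (S.xiAt p) (S.etaAt p) :=
  ⟨isScalarProduct_metricAt p, S.phi_phi p, S.eta_xi p, S.metric_phi_phi p⟩

theorem isAlmostContact_rep (hz : z ∈ (extChartAt (𝓡 (2 * n + 1)) y).target) :
    IsAlmostContact (metricRep S.metric y z) (S.phiRep y z) (fieldRep y S.xi z) (S.etaRep y z) := by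
  have hp := (extChartAt (𝓡 (2 * n + 1)) y).map_target hz
  have hi := isInvertible_chartD (k := 2 * n + 1) hp
  have hA := S.isAlmostContact ((extChartAt (𝓡 (2 * n + 1)) y).symm z)
  set D := chartD (k := 2 * n + 1) y ((extChartAt (𝓡 (2 * n + 1)) y).symm z) with hD
  have hphi : ∀ v, S.phiRep y z v = D (S.phiAt _ (D.inverse v)) := fun v => rfl
  have hxi : fieldRep y S.xi z = D (S.xiAt _) := rfl
  have heta : ∀ v, S.etaRep y z v = S.etaAt _ (D.inverse v) := fun v => rfl
  have hg : ∀ v w, metricRep S.metric y z v w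
    = metricAt S.metric _ (D.inverse v) (D.inverse w) := fun v w => rfl
  refine ⟨isScalarProduct_metricRep hz, fun v => ?_, ?_, fun v w => ?_⟩
  · rw [hphi, hphi, heta, hxi, hi.inverse_apply_self, hA.phi_phi, map_add, map_neg, map_smul,
      hi.self_apply_inverse]
  · rw [heta, hxi, hi.inverse_apply_self, hA.eta_xi]
  · rw [hg, hphi, hphi, hg, heta, heta, hi.inverse_apply_self, hi.inverse_apply_self,
      hA.form_phi_phi]

/-- The exterior derivative of `η` on coordinate fields. -/
theorem extDeriv_coordField (hz : z ∈ (extChartAt (𝓡 (2 * n + 1)) y).target)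
    (u v : Euc (2 * n + 1)) :
    extDeriv S.eta (coordField y u) (coordField y v) ((extChartAt (𝓡 (2 * n + 1)) y).symm z)
      = 1 / 2 * (fderiv ℝ (S.etaRep y) z u v - fderiv ℝ (S.etaRep y) z v u) := by
  have hp := (extChartAt (𝓡 (2 * n + 1)) y).map_target hz
  have hd : DifferentiableAt ℝ (S.etaRep y) z := (contDiffAt_etaRep hz).diff
  have hb := chartD_mlieBracket hz (coordField_smooth hp u) (coordField_smooth hp v)
  rw [(fieldRep_coordField hz u).fderiv_eq, (fieldRep_coordField hz v).fderiv_eq] at hb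
  set q := (extChartAt (𝓡 (2 * n + 1)) y).symm z with hq
  have hi := isInvertible_chartD (k := 2 * n + 1) hp
  let br : Euc (2 * n + 1) :=
    VectorField.mlieBracket (𝓡 (2 * n + 1)) (coordField y u) (coordField y v) q
  have hbr : br = 0 := hi.injective (hb.trans (by simp))
  have hf : ∀ u v : Euc (2 * n + 1),
      funD (fun q => S.etaAt q ((chartD y q).inverse v)) q ((chartD y q).inverse u)
      = fderiv ℝ (S.etaRep y) z u v := by
    intro u v
    rw [funD_of_chart (ĥ := fun z => S.etaRep y z v) hp, hi.self_apply_inverse,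
      (extChartAt (𝓡 (2 * n + 1)) y).right_inv hz]
    · rw [fderiv_apply_const hd]
    · filter_upwards [(isOpen_extChartAt_source y).mem_nhds hp] with q hq
      rw [etaRep, (extChartAt (𝓡 (2 * n + 1)) y).left_inv hq]
      rfl
    · rw [(extChartAt (𝓡 (2 * n + 1)) y).right_inv hz]
      exact hd.clm_apply (differentiableAt_const v)
  have he : extDeriv S.eta (coordField y u) (coordField y v) q = 1 / 2 *
      (funD (fun q => S.etaAt q ((chartD y q).inverse v)) q ((chartD y q).inverse u)
        - funD (fun q => S.etaAt q ((chartD y q).inverse u)) q ((chartD y q).inverse v)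
        - S.etaAt q br) := rfl
  rw [he, hf, hf, hbr, map_zero, sub_zero]

theorem metricRep_phiRep (hz : z ∈ (extChartAt (𝓡 (2 * n + 1)) y).target)
    (X Y : Euc (2 * n + 1)) : metricRep S.metric y z X (S.phiRep y z Y)
      = extDeriv S.eta (coordField y X) (coordField y Y)
        ((extChartAt (𝓡 (2 * n + 1)) y).symm z) := by
  have hp := (extChartAt (𝓡 (2 * n + 1)) y).map_target hz
  have hi := isInvertible_chartD (k := 2 * n + 1) hp
  refine Eq.trans ?_ (S.metric_phi _ _ _ (coordField_smooth hp X) (coordField_smooth hp Y))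
  exact congrArg (metricAt S.metric _ ((chartD y _).inverse X)) (hi.inverse_apply_self _)

/-- Coordinate fields are constant in the chart, so their bracket vanishes and the brackets with
`φX`, `φY` reduce to derivatives of `φ`. The term `2 dη(X, Y)` becomes `2 g(X, φY)` by the contact
condition. -/
theorem isSasakianOn (hS : S.IsSasakian) (y : N) :
    IsSasakianOn (extChartAt (𝓡 (2 * n + 1)) y).target (metricRep S.metric y) (S.phiRep y)
      (fieldRep y S.xi) (S.etaRep y) where
  isOpen := isOpen_extChartAt_target y
  smooth_G _ hz := smooth_metricRep hz
  smooth_phi _ hz := contDiffAt_phiRep hz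
  smooth_xi _ hz := contDiffAt_fieldRep hz (S.xi_smooth _)
  smooth_eta _ hz := contDiffAt_etaRep hz
  almostContact _ hz := isAlmostContact_rep hz
  contact z hz X Y := by
    have hp := (extChartAt (𝓡 (2 * n + 1)) y).map_target hz
    rw [← extDeriv_coordField hz]
    exact metricRep_phiRep hz X Y
  nijenhuis z hz X Y := by
    have hp := (extChartAt (𝓡 (2 * n + 1)) y).map_target hz
    have hi := isInvertible_chartD (k := 2 * n + 1) hp
    have hX := coordField_smooth hp X
    have hY := coordField_smooth hp Y
    have hd : DifferentiableAt ℝ (S.phiRep y) z := (contDiffAt_phiRep hz).diff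
    have hPX := fieldSmoothAt_phi (S := S) hX
    have hPY := fieldSmoothAt_phi (S := S) hY
    have h := hS _ _ _ hX hY
    have hb₁ := chartD_mlieBracket hz hPX hPY
    have hb₂ := chartD_mlieBracket hz hPX hY
    have hb₃ := chartD_mlieBracket hz hX hPY
    have hb₄ := chartD_mlieBracket hz hX hY
    have hP : ∀ v, fieldRep y (fun q => S.phi q (coordField y v q)) = fun z => S.phiRep y z v :=
      fun v => rfl
    have hPd : ∀ u v, fderiv ℝ (fun z => S.phiRep y z v) z u = fderiv ℝ (S.phiRep y) z u v := by
      intro u v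
      rw [fderiv_apply_const hd]
    simp only [hP, hPd, (fieldRep_coordField hz X).fderiv_eq, (fieldRep_coordField hz Y).fderiv_eq,
      (fieldRep_coordField hz X).eq_of_nhds, (fieldRep_coordField hz Y).eq_of_nhds,
      fderiv_fun_const, Pi.zero_apply, zero_apply, sub_zero, zero_sub] at hb₁ hb₂ hb₃ hb₄
    have hme := metricRep_phiRep (S := S) hz X Y
    set q := (extChartAt (𝓡 (2 * n + 1)) y).symm z with hq
    set D := chartD (k := 2 * n + 1) y q with hD
    let b₁ : Euc (2 * n + 1) := VectorField.mlieBracket (𝓡 (2 * n + 1))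
      (fun q => S.phi q (coordField y X q)) (fun q => S.phi q (coordField y Y q)) q
    let b₂ : Euc (2 * n + 1) := VectorField.mlieBracket (𝓡 (2 * n + 1))
      (fun q => S.phi q (coordField y X q)) (coordField y Y) q
    let b₃ : Euc (2 * n + 1) := VectorField.mlieBracket (𝓡 (2 * n + 1))
      (coordField y X) (fun q => S.phi q (coordField y Y q)) q
    let b₄ : Euc (2 * n + 1) := VectorField.mlieBracket (𝓡 (2 * n + 1))
      (coordField y X) (coordField y Y) q
    let e : ℝ := extDeriv S.eta (coordField y X) (coordField y Y) q
    have h' : b₁ - S.phiAt q b₂ - S.phiAt q b₃ + S.phiAt q (S.phiAt q b₄) + (2 * e) • S.xiAt q = 0 :=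
      h
    have h₁ : D b₁ = fderiv ℝ (S.phiRep y) z (S.phiRep y z X) Y
      - fderiv ℝ (S.phiRep y) z (S.phiRep y z Y) X := hb₁
    have h₂ : D b₂ = - fderiv ℝ (S.phiRep y) z Y X := hb₂
    have h₃ : D b₃ = fderiv ℝ (S.phiRep y) z X Y := hb₃
    have h₄ : b₄ = 0 := hi.injective (hb₄.trans (map_zero _).symm)
    have hphi : ∀ v, D (S.phiAt q v) = S.phiRep y z (D v) := fun v =>
      congrArg (fun w => D (S.phiAt q w)) (hi.inverse_apply_self v).symm
    have hxi : fieldRep y S.xi z = D (S.xiAt q) := rfl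
    have hme' : metricRep S.metric y z X (S.phiRep y z Y) = e := hme
    rw [hme', hxi]
    have h0 := congrArg D h'
    rw [h₄] at h0
    simp only [map_add, map_sub, map_smul, map_zero, hphi, h₁, h₂, h₃, add_zero, map_neg] at h0
    rw [← h0]
    abel

variable (S) in
/-- The curvature of a Sasakian space form at a point. -/
theorem isSasakianCurvature (hS : S.IsSasakian) {c : ℝ} (hc : S.HasConstPhiCurvature c) (p : N) :
    IsSasakianCurvature (metricAt S.metric p) (S.phiAt p) (S.xiAt p) (S.etaAt p)
      (curvAt S.metric p) c := by
  have hz := mem_extChartAt_target (I := 𝓡 (2 * n + 1)) p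
  have hcurv : curvForm (lcConn (metricRep S.metric p)) (extChartAt (𝓡 (2 * n + 1)) p p)
      = curvAt S.metric p := by
    funext u v w
    exact ((isMetricRep_metricRep p).curvature_eq hz u v w).symm
  have hleft := extChartAt_to_inv (I := 𝓡 (2 * n + 1)) p
  have hg : metricRep S.metric p (extChartAt (𝓡 (2 * n + 1)) p p) = metricAt S.metric p := by
    ext u w
    have := metricRep_chartD (γ := S.metric) (mem_extChartAt_source (I := 𝓡 (2 * n + 1)) p) u w
    rwa [chartD_self] at this
  have hphi : S.phiRep p (extChartAt (𝓡 (2 * n + 1)) p p) = S.phiAt p := by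
    rw [phiRep, hleft, chartD_self, ContinuousLinearMap.inverse_id]
    rfl
  have heta : S.etaRep p (extChartAt (𝓡 (2 * n + 1)) p p) = S.etaAt p := by
    rw [etaRep, hleft, chartD_self, ContinuousLinearMap.inverse_id]
    rfl
  have hxi : fieldRep p S.xi (extChartAt (𝓡 (2 * n + 1)) p p) = S.xiAt p := by
    have : ∀ q, q = p → chartD p q (S.xiAt q) = S.xiAt p := by
      rintro q rfl
      rw [chartD_self]; rfl
    exact this _ hleft
  have h := (isSasakianOn hS p).isSasakianCurvature hz (c := c)
  rw [hcurv, hg, hphi, heta, hxi] at h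
  exact h fun X h1 h2 => hc p X h1 h2

end ContactMetricStructure

/-! ### Differentials of immersions and submersions -/

section Mersions

open Manifold

variable {E E' H H' : Type*} [NormedAddCommGroup E] [NormedSpace ℝ E]
  [NormedAddCommGroup E'] [NormedSpace ℝ E'] [TopologicalSpace H] [TopologicalSpace H']
  {I : ModelWithCorners ℝ E H} {J : ModelWithCorners ℝ E' H'}
  {M N : Type*} [TopologicalSpace M] [ChartedSpace H M] [TopologicalSpace N] [ChartedSpace H' N]

theorem mdifferentiableAt_extend_symm [I.Boundaryless] {e : OpenPartialHomeomorph M H}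
    (he : e ∈ IsManifold.maximalAtlas I ∞ M) {z : E} (hz : z ∈ (e.extend I).target) :
    MDifferentiableAt 𝓘(ℝ, E) I (e.extend I).symm z := by
  have h := contMDiffOn_extend_symm he
  rw [← e.extend_target'] at h
  exact (h.contMDiffAt (e.isOpen_extend_target.mem_nhds hz)).mdifferentiableAt (by simp)

/-- The differential of an immersion is injective. -/
theorem injective_mfderiv_of_isImmersionAt [I.Boundaryless] [IsManifold I ∞ M] [IsManifold J ∞ N]
    {f : M → N} {x : M} (h : IsImmersionAt I J ∞ f x) : Function.Injective (mfderiv I J f x) := by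
  have hx := h.mem_domChart_source
  have hz : h.domChart.extend I x ∈ (h.domChart.extend I).target :=
    (h.domChart.extend I).map_source (by rwa [h.domChart.extend_source])
  have hψ : MDifferentiableAt J 𝓘(ℝ, E') (h.codChart.extend J) (f x) :=
    (h.codChart.contMDiffAt_extend h.codChart_mem_maximalAtlas h.mem_codChart_source).mdifferentiableAt
      (by simp)
  -- In adapted charts an immersion is `u ↦ (u, 0)`; the first projection, conjugated by the charts,
  -- is a local left inverse of `f`, and its differential is a left inverse.
  let L : E' →L[ℝ] E := (ContinuousLinearMap.fst ℝ E h.complement).comp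
    (h.equiv.symm : E' →L[ℝ] E × h.complement)
  have hL : ∀ x' ∈ h.domChart.source, L (h.codChart.extend J (f x')) = h.domChart.extend I x' := by
    intro x' hx'
    have hx'' : x' ∈ (h.domChart.extend I).source := by rwa [h.domChart.extend_source]
    have h1 := h.writtenInCharts ((h.domChart.extend I).map_source hx'')
    simp only [Function.comp_apply, (h.domChart.extend I).left_inv hx''] at h1
    show (h.equiv.symm (h.codChart.extend J (f x'))).1 = _
    rw [h1, h.equiv.symm_apply_apply]
  have hLx := hL x hx
  have hφ : MDifferentiableAt 𝓘(ℝ, E) I (h.domChart.extend I).symm (L (h.codChart.extend J (f x))) := by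
    rw [hLx]; exact mdifferentiableAt_extend_symm h.domChart_mem_maximalAtlas hz
  have hr := (hφ.comp (h.codChart.extend J (f x)) L.differentiableAt.mdifferentiableAt).comp (f x) hψ
  have hf : MDifferentiableAt I J f x := h.contMDiffAt.mdifferentiableAt (by simp)
  have hid := (hr.hasMFDerivAt.comp x hf.hasMFDerivAt).congr_of_eventuallyEq (f₁ := id) (by
    filter_upwards [h.domChart.open_source.mem_nhds hx] with x' hx'
    simp only [Function.comp_apply, hL x' hx', id]
    exact ((h.domChart.extend I).left_inv (by rwa [h.domChart.extend_source])).symm)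
  have h2 := hasMFDerivAt_unique hid (hasMFDerivAt_id x)
  intro u v huv
  have hu := congrArg (fun A : E →L[ℝ] E => A u) h2
  have hv := congrArg (fun A : E →L[ℝ] E => A v) h2
  refine hu.symm.trans (Eq.trans ?_ hv)
  exact congrArg (mfderiv J I (((h.domChart.extend I).symm ∘ L) ∘ h.codChart.extend J) (f x)) huv

/-- The differential of a submersion is surjective. -/
theorem surjective_mfderiv_of_isSubmersionAt [I.Boundaryless] [IsManifold I ∞ M] [IsManifold J ∞ N]
    {f : M → N} {x : M} (h : IsSubmersionAt I J ∞ f x) : Function.Surjective (mfderiv I J f x) := by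
  have hx := h.mem_domChart_source
  have hx' : x ∈ (h.domChart.extend I).source := by rwa [h.domChart.extend_source]
  have hz : h.domChart.extend I x ∈ (h.domChart.extend I).target :=
    (h.domChart.extend I).map_source hx'
  have hψ : MDifferentiableAt J 𝓘(ℝ, E') (h.codChart.extend J) (f x) :=
    (h.codChart.contMDiffAt_extend h.codChart_mem_maximalAtlas h.mem_codChart_source).mdifferentiableAt
      (by simp)
  -- A local section through `x`: the complementary coordinate is frozen at its value at `x`.
  let s : E' → E := fun w => h.equiv.symm (w, (h.equiv (h.domChart.extend I x)).2)
  have hsd : Differentiable ℝ s := by fun_prop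
  have hsx : s (h.codChart.extend J (f x)) = h.domChart.extend I x := by
    have h1 := h.writtenInCharts hz
    simp only [Function.comp_apply, (h.domChart.extend I).left_inv hx'] at h1
    show h.equiv.symm (h.codChart.extend J (f x), _) = _
    rw [h1]
    exact h.equiv.symm_apply_apply _
  have hφ : MDifferentiableAt 𝓘(ℝ, E) I (h.domChart.extend I).symm (s (h.codChart.extend J (f x))) := by
    rw [hsx]; exact mdifferentiableAt_extend_symm h.domChart_mem_maximalAtlas hz
  have hr := (hφ.comp (h.codChart.extend J (f x)) (hsd _).mdifferentiableAt).comp (f x) hψ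
  have hrx : ((h.domChart.extend I).symm ∘ s) ((h.codChart.extend J) (f x)) = x := by
    simp only [Function.comp_apply, hsx]
    exact (h.domChart.extend I).left_inv hx'
  have hf : MDifferentiableAt I J f x := h.contMDiffAt.mdifferentiableAt (by simp)
  have hf' : HasMFDerivAt I J f ((((h.domChart.extend I).symm ∘ s) ∘ (h.codChart.extend J)) (f x))
      (mfderiv I J f x) := by
    rw [Function.comp_apply, hrx]; exact hf.hasMFDerivAt
  have hid := (hf'.comp (f x) hr.hasMFDerivAt).congr_of_eventuallyEq (f₁ := id) (by
    have hc : ContinuousAt (fun y => s (h.codChart.extend J y)) (f x) :=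
      hsd.continuous.continuousAt.comp hψ.continuousAt
    have hn : (h.domChart.extend I).target ∈ 𝓝 (s (h.codChart.extend J (f x))) := by
      rw [hsx]; exact h.domChart.isOpen_extend_target.mem_nhds hz
    filter_upwards [h.codChart.open_source.mem_nhds h.mem_codChart_source, hc hn] with y hy hy'
    have h1 := h.writtenInCharts hy'
    simp only [Function.comp_apply, s, ContinuousLinearEquiv.apply_symm_apply] at h1
    have h3 : (h.domChart.extend I).symm (s (h.codChart.extend J y)) ∈ h.domChart.source := by
      rw [← h.domChart.extend_source (I := I)]
      exact (h.domChart.extend I).map_target hy'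
    have h2 := h.source_subset_preimage_source h3
    refine (h.codChart.extend J).injOn (by rwa [h.codChart.extend_source])
      (by rw [h.codChart.extend_source]; exact h2) ?_
    exact h1.symm)
  have h2 := hasMFDerivAt_unique hid (hasMFDerivAt_id (f x))
  intro u
  exact ⟨_, congrArg (fun A : E' →L[ℝ] E' => A u) h2⟩

end Mersions

section MapD

variable {m k l : ℕ} {M N B : Type*} [TopologicalSpace M] [ChartedSpace (Euc m) M]
  [TopologicalSpace N] [ChartedSpace (Euc k) N] [TopologicalSpace B] [ChartedSpace (Euc l) B]

theorem mapD_comp {f : M → N} {h : N → B} {x : M} (hh : MDifferentiableAt (𝓡 k) (𝓡 l) h (f x))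
    (hf : MDifferentiableAt (𝓡 m) (𝓡 k) f x) :
    mapD (m := m) (k := l) (h ∘ f) x = (mapD (m := k) (k := l) h (f x)).comp (mapD (m := m) (k := k) f x) :=
  mfderiv_comp x hh hf

end MapD

/-- A vector in a one-dimensional kernel lies in the range of `A`, if some `A u ≠ 0` is in the
kernel. -/
theorem mem_range_of_ker {V W X Y : Type*} [AddCommGroup V] [Module ℝ V] [AddCommGroup W]
    [Module ℝ W] [AddCommGroup X] [Module ℝ X] [AddCommGroup Y] [Module ℝ Y]
    [FiniteDimensional ℝ V] [FiniteDimensional ℝ W] [FiniteDimensional ℝ X] [FiniteDimensional ℝ Y]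
    (A : V →ₗ[ℝ] W) (P : W →ₗ[ℝ] X) (C : Y →ₗ[ℝ] X) (F : V →ₗ[ℝ] Y)
    (hA : Function.Injective A) (hP : Function.Surjective P) (hcomm : ∀ v, P (A v) = C (F v))
    (hWX : Module.finrank ℝ W = Module.finrank ℝ X + 1)
    (hVY : Module.finrank ℝ Y < Module.finrank ℝ V) {w : W} (hw : P w = 0) : ∃ v, A v = w := by
  -- `F` lowers the dimension and so kills some `v ≠ 0`. Then `A v` is a nonzero vector of the line
  -- `ker P` and spans it.
  have hker := LinearMap.ker_ne_bot_of_finrank_lt (f := F) hVY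
  obtain ⟨v, hv, hv0⟩ := (Submodule.ne_bot_iff _).1 hker
  have h1 : Module.finrank ℝ (LinearMap.ker P) = 1 := by
    have := LinearMap.finrank_range_add_finrank_ker P
    rw [LinearMap.range_eq_top.2 hP, finrank_top] at this
    omega
  have hAv : P (A v) = 0 := by rw [hcomm, LinearMap.mem_ker.1 hv, map_zero]
  have h2 := (finrank_eq_one_iff_of_nonzero' (⟨A v, hAv⟩ : LinearMap.ker P) (by
    intro h0
    exact hv0 (hA ((congrArg Subtype.val h0).trans (map_zero A).symm)))).1 h1 ⟨w, hw⟩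
  obtain ⟨t, ht⟩ := h2
  exact ⟨t • v, by rw [map_smul]; exact congrArg Subtype.val ht⟩

/-! ### Horizontality of the normal of the Hopf cylinder -/

namespace ContactMetricStructure

variable {n : ℕ} {N : Type*} [TopologicalSpace N] [ChartedSpace (Euc (2 * n + 1)) N]
  [IsManifold (𝓡 (2 * n + 1)) ∞ N] {S : ContactMetricStructure n N}

/-- The projection of the Hopf cylinder to the hypersurface of the orbit space. -/
def cylBase {Mb : Type*} (i : Mb → S.OrbitSpace) (z : S.HopfCylinder i) : Mb := z.1.1

variable {Mb : Type*} [TopologicalSpace Mb] [ChartedSpace (Euc (2 * n - 1)) Mb]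
  {i : Mb → S.OrbitSpace} [ChartedSpace (Euc (2 * n)) (S.HopfCylinder i)]

theorem contMDiff_cylMap (hM : Manifold.IsSmoothEmbedding (𝓡 (2 * n))
      ((𝓡 (2 * n - 1)).prod (𝓡 (2 * n + 1))) ∞ (S.cylIncl i)) :
    ContMDiff (𝓡 (2 * n)) (𝓡 (2 * n + 1)) ∞ (S.cylMap i) :=
  contMDiff_snd.comp hM.isImmersion.contMDiff

theorem contMDiff_cylBase (hM : Manifold.IsSmoothEmbedding (𝓡 (2 * n))
      ((𝓡 (2 * n - 1)).prod (𝓡 (2 * n + 1))) ∞ (S.cylIncl i)) :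
    ContMDiff (𝓡 (2 * n)) (𝓡 (2 * n - 1)) ∞ (cylBase i) :=
  contMDiff_fst.comp hM.isImmersion.contMDiff

variable [ChartedSpace (Euc (2 * n)) S.OrbitSpace]

/-- The characteristic vector field is vertical. -/
theorem mapD_proj_xi {p : N}
    (hproj : MDifferentiableAt (𝓡 (2 * n + 1)) (𝓡 (2 * n)) S.proj p) :
    mapD (m := 2 * n + 1) (k := 2 * n) S.proj p (S.xiAt p) = 0 := by
  have : IsManifold (𝓡 (2 * n + 1)) 1 N :=
    IsManifold.of_le (n := ∞) (WithTop.coe_le_coe.2 (le_top (a := (1 : ℕ∞))))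
  have hξ : ContMDiffAt (𝓡 (2 * n + 1)) ((𝓡 (2 * n + 1)).prod 𝓘(ℝ, Euc (2 * n + 1))) 1
      (fun q => Bundle.TotalSpace.mk' (Euc (2 * n + 1)) q (S.xi q)) p :=
    (S.xi_smooth p).of_le (WithTop.coe_le_coe.2 (le_top (a := (1 : ℕ∞))))
  obtain ⟨γ, hγ0, hγ⟩ := exists_isMIntegralCurveAt_of_contMDiffAt_boundaryless (t₀ := 0) hξ
  subst hγ0
  obtain ⟨ε, hε, hγ'⟩ := isMIntegralCurveAt_iff'.1 hγ
  have h0 : (0 : ℝ) ∈ Metric.ball (0 : ℝ) ε := Metric.mem_ball_self hε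
  -- Points of one integral curve are identified in the orbit space, so `π` is constant along the
  -- local curve through `p`, and its derivative there is `dπ(ξ)`.
  have hconst : (fun _ => S.proj (γ 0)) =ᶠ[𝓝 (0 : ℝ)] S.proj ∘ γ := by
    filter_upwards [Metric.ball_mem_nhds (0 : ℝ) hε] with t ht
    exact Quot.sound ⟨γ, _, Metric.isOpen_ball, (convex_ball (0 : ℝ) ε).ordConnected, hγ',
      ⟨0, h0, rfl⟩, ⟨t, ht, rfl⟩⟩
  have h1 := (hproj.hasMFDerivAt.comp (0 : ℝ) hγ.self_of_nhds).congr_of_eventuallyEq hconst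
  have h2 := hasMFDerivAt_unique h1
    (hasMFDerivAt_const (I := 𝓘(ℝ, ℝ)) (I' := 𝓡 (2 * n)) (S.proj (γ 0)) (0 : ℝ))
  have h3 := congrArg (fun A : ℝ →L[ℝ] Euc (2 * n) => A 1) h2
  have h4 : mapD (m := 2 * n + 1) (k := 2 * n) S.proj (γ 0) ((1 : ℝ) • S.xiAt (γ 0)) = 0 := h3
  rwa [one_smul] at h4

/-- The derivative of the equation that defines the fibre product. -/
theorem mapD_proj_cylMap (hproj : Manifold.IsSubmersion (𝓡 (2 * n + 1)) (𝓡 (2 * n)) ∞ S.proj)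
    (hi : Manifold.IsImmersion (𝓡 (2 * n - 1)) (𝓡 (2 * n)) ∞ i)
    (hM : Manifold.IsSmoothEmbedding (𝓡 (2 * n))
      ((𝓡 (2 * n - 1)).prod (𝓡 (2 * n + 1))) ∞ (S.cylIncl i)) (x : S.HopfCylinder i)
    (v : Euc (2 * n)) :
    mapD (m := 2 * n + 1) (k := 2 * n) S.proj (S.cylMap i x)
        (mapD (m := 2 * n) (k := 2 * n + 1) (S.cylMap i) x v)
      = mapD (m := 2 * n - 1) (k := 2 * n) i (cylBase i x)
        (mapD (m := 2 * n) (k := 2 * n - 1) (cylBase i) x v) := by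
  have h1 := mapD_comp (m := 2 * n) (k := 2 * n + 1) (l := 2 * n) (x := x) (f := S.cylMap i)
    ((hproj.isSubmersionAt (S.cylMap i x)).contMDiffAt.mdifferentiableAt (by simp))
    ((contMDiff_cylMap hM).contMDiffAt.mdifferentiableAt (by simp))
  have h2 := mapD_comp (m := 2 * n) (k := 2 * n - 1) (l := 2 * n) (x := x) (f := cylBase i)
    ((hi.isImmersionAt (cylBase i x)).contMDiffAt.mdifferentiableAt (by simp))
    ((contMDiff_cylBase hM).contMDiffAt.mdifferentiableAt (by simp))
  have h3 : S.proj ∘ S.cylMap i = i ∘ cylBase i := funext fun z => z.2.symm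
  rw [h3] at h1
  exact congrArg (fun A : Euc (2 * n) →L[ℝ] Euc (2 * n) => A v) (h1.symm.trans h2)

variable [IsManifold (𝓡 (2 * n)) ∞ S.OrbitSpace] [IsManifold (𝓡 (2 * n - 1)) ∞ Mb]
  [IsManifold (𝓡 (2 * n)) ∞ (S.HopfCylinder i)]

/-- If the differential to `N` kills `v`, then so does the composite to the orbit space, and since
`i` is an immersion the component of `v` along the base vanishes too. The inclusion in the product
is an immersion, so `v = 0`. -/
theorem injective_mapD_cylMap
    (hproj : Manifold.IsSubmersion (𝓡 (2 * n + 1)) (𝓡 (2 * n)) ∞ S.proj)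
    (hi : Manifold.IsImmersion (𝓡 (2 * n - 1)) (𝓡 (2 * n)) ∞ i)
    (hM : Manifold.IsSmoothEmbedding (𝓡 (2 * n))
      ((𝓡 (2 * n - 1)).prod (𝓡 (2 * n + 1))) ∞ (S.cylIncl i)) (x : S.HopfCylinder i) :
    Function.Injective (mapD (m := 2 * n) (k := 2 * n + 1) (S.cylMap i) x) := by
  rw [injective_iff_map_eq_zero]
  intro v hv
  have hC : Function.Injective (mapD (m := 2 * n - 1) (k := 2 * n) i (cylBase i x)) :=
    injective_mfderiv_of_isImmersionAt (hi.isImmersionAt (cylBase i x))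
  have hF : mapD (m := 2 * n) (k := 2 * n - 1) (cylBase i) x v = 0 := by
    refine hC ?_
    rw [← mapD_proj_cylMap hproj hi hM, hv, map_zero, map_zero]
  have hD := ((contMDiff_cylBase hM).contMDiffAt (x := x) |>.mdifferentiableAt
    (by simp)).hasMFDerivAt.prodMk ((contMDiff_cylMap hM).contMDiffAt (x := x) |>.mdifferentiableAt
    (by simp)).hasMFDerivAt
  have hinj := injective_mfderiv_of_isImmersionAt (hM.isImmersion.isImmersionAt x)
  have hinc : S.cylIncl i = fun z => (cylBase i z, S.cylMap i z) := rfl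
  rw [hinc, hD.mfderiv] at hinj
  exact hinj ((Prod.ext hF hv : (mapD (m := 2 * n) (k := 2 * n - 1) (cylBase i) x v,
    mapD (m := 2 * n) (k := 2 * n + 1) (S.cylMap i) x v) = (0, 0)).trans
    (Prod.ext (map_zero _).symm (map_zero _).symm : ((0, 0) : Euc (2 * n - 1) × Euc (2 * n + 1)) =
      (mapD (m := 2 * n) (k := 2 * n - 1) (cylBase i) x 0,
    mapD (m := 2 * n) (k := 2 * n + 1) (S.cylMap i) x 0)))

/-- The characteristic vector field is tangent to the Hopf cylinder. -/
theorem exists_mapD_cylMap_eq_xi (hn : 1 ≤ n)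
    (hproj : Manifold.IsSubmersion (𝓡 (2 * n + 1)) (𝓡 (2 * n)) ∞ S.proj)
    (hi : Manifold.IsImmersion (𝓡 (2 * n - 1)) (𝓡 (2 * n)) ∞ i)
    (hM : Manifold.IsSmoothEmbedding (𝓡 (2 * n))
      ((𝓡 (2 * n - 1)).prod (𝓡 (2 * n + 1))) ∞ (S.cylIncl i)) (x : S.HopfCylinder i) :
    ∃ v, mapD (m := 2 * n) (k := 2 * n + 1) (S.cylMap i) x v = S.xiAt (S.cylMap i x) := by
  have hsub := hproj.isSubmersionAt (S.cylMap i x)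
  -- The two dimension counts are `2n + 1 = (2n) + 1` and `2n - 1 < 2n`; the second, with truncated
  -- subtraction, needs `n ≥ 1`.
  exact mem_range_of_ker (mapD (m := 2 * n) (k := 2 * n + 1) (S.cylMap i) x).toLinearMap
    (mapD (m := 2 * n + 1) (k := 2 * n) S.proj (S.cylMap i x)).toLinearMap
    (mapD (m := 2 * n - 1) (k := 2 * n) i (cylBase i x)).toLinearMap
    (mapD (m := 2 * n) (k := 2 * n - 1) (cylBase i) x).toLinearMap
    (injective_mapD_cylMap hproj hi hM x) (surjective_mfderiv_of_isSubmersionAt hsub)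
    (mapD_proj_cylMap hproj hi hM x) (by simp) (by simp; omega)
    (mapD_proj_xi (hsub.contMDiffAt.mdifferentiableAt (by simp)))

/-- Normal vectors of the Hopf cylinder are horizontal. -/
theorem eta_eq_zero_of_normal (hn : 1 ≤ n)
    (hproj : Manifold.IsSubmersion (𝓡 (2 * n + 1)) (𝓡 (2 * n)) ∞ S.proj)
    (hi : Manifold.IsImmersion (𝓡 (2 * n - 1)) (𝓡 (2 * n)) ∞ i)
    (hM : Manifold.IsSmoothEmbedding (𝓡 (2 * n))
      ((𝓡 (2 * n - 1)).prod (𝓡 (2 * n + 1))) ∞ (S.cylIncl i)) (x : S.HopfCylinder i)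
    {ν : Euc (2 * n + 1)} (hν : ∀ u : Euc (2 * n), metricAt S.metric (S.cylMap i x) ν
      (mapD (m := 2 * n) (k := 2 * n + 1) (S.cylMap i) x u) = 0) :
    S.etaAt (S.cylMap i x) ν = 0 := by
  obtain ⟨v, hv⟩ := exists_mapD_cylMap_eq_xi hn hproj hi hM x
  rw [← (S.isAlmostContact (S.cylMap i x)).form_xi, ← hv, hν]

end ContactMetricStructure

end HopfCyl

end

/-! ### Biharmonic Hopf cylinders -/

theorem propositiont1 (n : ℕ) (hn : 1 ≤ n) (c : ℝ)
    {N : Type*} [TopologicalSpace N] [T2Space N] [SecondCountableTopology N]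
    [ChartedSpace (HopfCyl.Euc (2 * n + 1)) N] [IsManifold (𝓡 (2 * n + 1)) ∞ N]
    (S : HopfCyl.ContactMetricStructure n N) (hS : S.IsSasakian)
    (hc : S.HasConstPhiCurvature c) (hreg : S.IsStrictlyRegular)
    [ChartedSpace (HopfCyl.Euc (2 * n)) S.OrbitSpace]
    [IsManifold (𝓡 (2 * n)) ∞ S.OrbitSpace]
    (hproj : Manifold.IsSubmersion (𝓡 (2 * n + 1)) (𝓡 (2 * n)) ∞ S.proj)
    {Mb : Type*} [TopologicalSpace Mb] [ChartedSpace (HopfCyl.Euc (2 * n - 1)) Mb]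
    [IsManifold (𝓡 (2 * n - 1)) ∞ Mb]
    (i : Mb → S.OrbitSpace) (hi : Manifold.IsImmersion (𝓡 (2 * n - 1)) (𝓡 (2 * n)) ∞ i)
    [ChartedSpace (HopfCyl.Euc (2 * n)) (S.HopfCylinder i)]
    [IsManifold (𝓡 (2 * n)) ∞ (S.HopfCylinder i)]
    (hM : Manifold.IsSmoothEmbedding (𝓡 (2 * n)) ((𝓡 (2 * n - 1)).prod (𝓡 (2 * n + 1))) ∞
      (S.cylIncl i)) :
    HopfCyl.IsBiharmonic (2 * n) S.form (S.cylMap i) ↔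
      (∀ x, HopfCyl.normalLap (2 * n) S.form (S.cylMap i)
            (HopfCyl.meanCurv (2 * n) S.form (S.cylMap i)) x
          = (-HopfCyl.secondFundNormSq (2 * n) S.form (S.cylMap i) x
              + (c * ((n : ℝ) + 1) + 3 * (n : ℝ) - 1) / 2) •
            HopfCyl.meanCurv (2 * n) S.form (S.cylMap i) x) ∧
      (∀ x, (2 : ℝ) • HopfCyl.traceShape (2 * n) S.form (S.cylMap i) x
          + (n : ℝ) • HopfCyl.gradMeanCurvSq (2 * n) S.form (S.cylMap i) x = 0) := by
  have hm : ((2 * n : ℕ) : ℝ) ≠ 0 := by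
    have : (n : ℝ) ≠ 0 := by exact_mod_cast (by omega : n ≠ 0)
    push_cast
    positivity
  -- For `m = 2n` the ambient dimension minus two is `2n - 1`, so the Ricci constant is `(c + 3)(2n
  -- - 1)/4 + 3(c - 1)/4 + 1`.
  have hric : HopfCyl.ricConst (2 * n) c = (c * ((n : ℝ) + 1) + 3 * (n : ℝ) - 1) / 2 := by
    rw [HopfCyl.ricConst]
    push_cast
    ring
  have hhalf : ((2 * n : ℕ) : ℝ) / 2 = n := by
    push_cast
    ring
  have key := fun x => HopfCyl.bitensionAt_eq_zero_iff (m := 2 * n) (γ := S.metric) (x := x) hm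
    (HopfCyl.ContactMetricStructure.contMDiff_cylMap hM)
    (HopfCyl.ContactMetricStructure.injective_mapD_cylMap hproj hi hM)
    (S.isSasakianCurvature hS hc (S.cylMap i x))
    (fun _ => HopfCyl.ContactMetricStructure.eta_eq_zero_of_normal hn hproj hi hM x)
  rw [hric, hhalf] at key
  exact (forall_congr' key).trans forall_and
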